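/- For $n\in\mathbb{N}$ and $\mu,x\in\mathbb{C}$ let $$Y_n^{\mu}(x)=\sum_{k=0}^{n}\binom{n}{k}(n+\mu+1)_k\left(\tfrac{x}{2}\right)^k,\qquad (p)_k=p(p+1)\cdots(p+k-1),$$ be the generalized Bessel polynomials. For $\Re z>0$ put, with principal branches, $$t=\frac{1}{\sqrt{1+z^2}},\qquad \eta=\sqrt{1+z^2}+\log\frac{z}{1+\sqrt{1+z^2}},$$ $$\phi(s)=2zs-\log s-\log(1+s),\qquad s_+=\frac{1-z+\sqrt{1+z^2}}{2z},$$ so that $\phi'(s_+)=0$. Let $s=s(w)$ be the function, analytic near $w=0$, with $\phi(s)-\phi(s_+)=\tfrac12\phi''(s_+)w^2$, $s(0)=s_+$, $s'(0)=1$, and write $$\frac{s(w)^{\mu}}{\sqrt{s(w)}\,\sqrt{1+s(w)}}\,\frac{ds}{dw}=\sum_{k\ge0}f_kw^k,\qquad F_k(\mu,z)=\frac{(\frac12)_k\,2^k}{\phi''(s_+)^k}\,\frac{f_{2k}}{f_0}.$$ Let $\gamma_k=\gamma_k(\mu+\tfrac12)$ be the coefficients of the asymptotic expansion $$\frac{\Gamma(\nu+\mu+\frac12)}{\sqrt{2\pi}\,\nu^{\nu+\mu}e^{-\nu}}\sim\sum_{k=0}^\infty\frac{\gamma_k}{\nu^k},\qquad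 \nu\to+\infty,$$ and define $A_k(\mu,z)$ recursively by $A_k=F_k-\sum_{j=0}^{k-1}A_j\gamma_{k-j}$, $k=0,1,2,\ldots$ Then the coefficients $A_k(\mu,z)$ are well defined for all $\mu\in\mathbb{C}$ and $\Re z>0$, with $A_0(\mu,z)=1$ and $$A_1(\mu,z)=\frac{t(5t^2-3)}{24}-\frac{\mu t^2(z+1)}{4}+\frac{\mu^2(tz-1)}{4}.$$ Moreover, for fixed $\mu\in\mathbb{C}$ and with $\nu=n+\tfrac12$, $\zeta=1/(\nu z)$, $$Y_n^{\mu}(\zeta)\sim\frac{\left(1-z+\sqrt{1+z^2}\right)^{\mu}\sqrt{z}}{(1+z^2)^{1/4}}\,e^{\nu z-\nu\eta}\sum_{k=0}^\infty\frac{A_k(\mu,z)}{\nu^k},\qquad n\to\infty,$$ uniformly in each sector $|\mathrm{ph}\,z|\le\tfrac12\pi-\delta$, $z\ne0$, with $0<\delta<\tfrac12\pi$. That is, for every such $\delta$ and every $K\ge0$ there are $C$ and $N$, depending only on $\mu,\delta,K$, such that for all $n\ge N$ and all $z\neq 0$ with $|\mathrm{ph}\,z|\le\tfrac12\pi-\delta$,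 if $E$ denotes the factor in front of the sum, then $$\left|Y_n^{\mu}(\zeta)-E\sum_{k=0}^{K-1}\frac{A_k(\mu,z)}{\nu^k}\right|\le\frac{C}{\nu^{K}}\,|E|.$$ -/

import Mathlib

open Filter Topology Asymptotics

noncomputable section

namespace GenBessel

/-- The generalized Bessel polynomial
`Y_n^μ(x) = ∑_{k=0}^n (n choose k) (n+μ+1)_k (x/2)^k`, where `(p)_k` is the rising factorial. -/
def besselPoly (n : ℕ) (μ x : ℂ) : ℂ :=
  ∑ k ∈ Finset.range (n + 1),
    (n.choose k : ℂ) * (ascPochhammer ℂ k).eval ((n : ℂ) + μ + 1) * (x / 2) ^ k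

/-- `√(1+z²)`, principal branch. -/
def root (z : ℂ) : ℂ := (1 + z ^ 2) ^ (1 / 2 : ℂ)

/-- `t = 1/√(1+z²)`. -/
def tVar (z : ℂ) : ℂ := 1 / root z

/-- `η = √(1+z²) + log (z / (1+√(1+z²)))`. -/
def etaVar (z : ℂ) : ℂ := root z + Complex.log (z / (1 + root z))

/-- The phase function `φ(s) = 2zs - log s - log (1+s)`, principal branches. -/
def phase (z s : ℂ) : ℂ := 2 * z * s - Complex.log s - Complex.log (1 + s)

/-- The saddle point `s₊ = (1 - z + √(1+z²)) / (2z)`, a zero of `φ'`. -/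
def saddle (z : ℂ) : ℂ := (1 - z + root z) / (2 * z)

/-- `φ''(s₊)`. -/
def phaseSecond (z : ℂ) : ℂ := iteratedDeriv 2 (phase z) (saddle z)

/-- `s = s(w)` is the analytic solution near `w = 0` of
`φ(s) - φ(s₊) = ½ φ''(s₊) w²` with `s(0) = s₊` and `s'(0) = 1`
(the last condition selects the sign of `w`). It is unique as a germ at `0`. -/
structure IsSaddleMap (z : ℂ) (s : ℂ → ℂ) : Prop where
  analyticAt : AnalyticAt ℂ s 0
  map_zero : s 0 = saddle z
  deriv_zero : deriv s 0 = 1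
  phase_eq : ∀ᶠ w in 𝓝 (0 : ℂ),
    phase z (s w) - phase z (saddle z) = phaseSecond z / 2 * w ^ 2

/-- The amplitude `p_μ(s) = s^μ / √(s(1+s))`, with branches that are real for real `μ` and `s > 0`. -/
def amplitude (μ s : ℂ) : ℂ := s ^ μ / (s ^ (1 / 2 : ℂ) * (1 + s) ^ (1 / 2 : ℂ))

/-- The coefficient `f_j` of `w^j` in the Taylor series at `0` of `f(w) = p_μ(s(w)) s'(w)`. -/
def taylorCoeff (μ : ℂ) (s : ℂ → ℂ) (j : ℕ) : ℂ :=
  iteratedDeriv j (fun w => amplitude μ (s w) * deriv s w) 0 / (j.factorial : ℂ)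

/-- `F_k(μ,z) = (1/2)_k 2^k / φ''(s₊)^k * f_{2k} / f_0`. -/
def laplaceCoeff (μ z : ℂ) (s : ℂ → ℂ) (k : ℕ) : ℂ :=
  (ascPochhammer ℂ k).eval (1 / 2 : ℂ) * 2 ^ k / phaseSecond z ^ k *
    (taylorCoeff μ s (2 * k) / taylorCoeff μ s 0)

/-- `Γ*(ν+α) = Γ(ν+α) / (√(2π) ν^{ν+α-1/2} e^{-ν})`. -/
def gammaStar (α : ℂ) (ν : ℝ) : ℂ :=
  Complex.Gamma ((ν : ℂ) + α) /
    ((Real.sqrt (2 * Real.pi) : ℂ) * (ν : ℂ) ^ ((ν : ℂ) + α - 1 / 2) * Complex.exp (-(ν : ℂ)))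

/-- `γ_0, γ_1, …` are the (unique) coefficients of the asymptotic expansion
`Γ*(ν+α) ~ ∑ γ_k / ν^k` as `ν → +∞`. -/
def IsGammaCoeff (α : ℂ) (γ : ℕ → ℂ) : Prop :=
  ∀ K : ℕ, (fun ν : ℝ => gammaStar α ν - ∑ k ∈ Finset.range K, γ k / (ν : ℂ) ^ k)
    =O[atTop] fun ν : ℝ => (ν ^ K)⁻¹

/-- `a k = A_k(μ,z)`: the coefficients determined recursively by
`A_k = F_k - ∑_{j<k} A_j γ_{k-j}(μ+½)`, that is, by dividing the series `∑ F_k / ν^k` by the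
expansion of `Γ*(ν+μ+½)`. -/
def IsExpansionCoeff (μ z : ℂ) (a : ℕ → ℂ) : Prop :=
  ∃ (s : ℂ → ℂ) (γ : ℕ → ℂ), IsSaddleMap z s ∧ IsGammaCoeff (μ + 1 / 2) γ ∧
    ∀ k : ℕ, a k = laplaceCoeff μ z s k - ∑ j ∈ Finset.range k, a j * γ (k - j)

/-- The front factor
`(1 - z + √(1+z²))^μ √z (1+z²)^{-1/4} e^{νz - νη}`, principal branches. -/
def frontFactor (μ z ν : ℂ) : ℂ :=
  (1 - z + root z) ^ μ * z ^ (1 / 2 : ℂ) / (1 + z ^ 2) ^ (1 / 4 : ℂ) *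
    Complex.exp (ν * z - ν * etaVar z)

/-- The closed sector `|ph z| ≤ π/2 - δ`, without its vertex. -/
def sector (δ : ℝ) : Set ℂ := {z | z ≠ 0 ∧ |Complex.arg z| ≤ Real.pi / 2 - δ}

end GenBessel

end

/-! Put β = √(1+z²) - z, so that z = (1-β²)/(2β) and s₊ = β/(1-β). In the variable v with s =
s₊(1+v), the phase φ(s) - φ(s₊) becomes ψ(v) = g(v) + g(βv) with g(v) = v - log(1+v), and the saddle
sits at v = 0 with ψ''(0) = 1+β². Let J(β) be the integral of (1+v)^(μ-1/2) (1+βv)^(-1/2) e^(-νψ(v))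
from -1 to 0 and on to infinity.

For ν = n+1/2 the powers of 1+βv combine to (1+βv)^n. The binomial theorem and Gamma integrals then
evaluate J(β) as an elementary multiple of Γ(n+μ+1) Y_n^μ(ζ) (`contourIntegral_mul_eq`), while J(0)
is an elementary multiple of Γ(ν+μ+1/2) (`contourIntegral_zero_mul`). Dividing gives the exact
identity Y_n^μ(ζ) J(0) = E √(1+β²) J(β), where E is the front factor
(`besselPoly_mul_contourIntegral`).

Uniformity is a compactness effect. The sector of z is mapped into the set |β| ≤ 1, |Im β| ≤ T Re β,
which includes the vertex β = 0 corresponding to z = ∞ (`admissible_betaVar`). There Re(1+β²) is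
bounded below, and the contour can be chosen, depending on β, so that Re ψ(v) ≥ d r²/(1+r) at
distance r = |v| with one constant d. Laplace's method therefore works uniformly on this set
(`exists_norm_contourIntegral_sub_le`), and one theorem yields both the expansion of J(β) and, at β
= 0, that of the scaled Gamma function.

Near the saddle, with w the coordinate satisfying ψ = (1+β²)w²/2, the amplitude is expanded in the
functions w^i w'(v) of v. Each term integrates to a Gaussian moment. This avoids inverting w on a
disc of uniform radius; an inverse near one point is needed only to identify the coefficients with
F_k (`exists_saddleMap`). Formal division of the two expansions gives A_k, with uniform error
(`norm_sub_mul_sum_quotCoeff_le`), and A_1 follows from the second local coefficient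
(`localCoeff_two`). -/

noncomputable section
-- The centred phase and its lower bounds on the two halves of the contour.
namespace GenBessel

/-- The phase `v - log (1 + v)` of the Gamma integral, centred at its saddle. -/
def gammaPhase (v : ℂ) : ℂ := v - Complex.log (1 + v)

/-- The phase of the Bessel polynomial integral, centred at its saddle. -/
def centredPhase (β v : ℂ) : ℂ := gammaPhase v + gammaPhase (β * v)

/-- The closed sectorial parameter domain, including the vertex `0`. -/
structure Admissible (T : ℝ) (β : ℂ) : Prop where
  norm_le : ‖β‖ ≤ 1
  re_nonneg : 0 ≤ β.re
  im_le : |β.im| ≤ T * β.re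

/-- The lower bound for the real part of the phase along the contour. -/
def decayRate (T : ℝ) : ℝ := 1 / (2 * (1 + T) ^ 2)

lemma decayRate_pos {T : ℝ} (hT : 0 ≤ T) : 0 < decayRate T := by
  unfold decayRate; positivity

/-- A direction in which the phase has positive real part on the whole ray. -/
structure IsDescentDir (T : ℝ) (β ρ : ℂ) : Prop where
  norm_eq : ‖ρ‖ = 1
  re_pos : 0 < ρ.re
  sq_re : 2 * decayRate T ≤ (ρ ^ 2).re
  mul_eq : β * ρ = ‖β‖ * (starRingEnd ℂ) ρ

lemma Admissible.norm_le_re {T : ℝ} {β : ℂ} (h : Admissible T β) : ‖β‖ ≤ (1 + T) * β.re := by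
  have h1 := Complex.norm_le_abs_re_add_abs_im β
  rw [abs_of_nonneg h.re_nonneg] at h1
  linarith [h.im_le]

/-- Take ρ to be the principal square root of conj β / |β|. Then βρ² = |β|, so v = ρx and βv = |β|x
conj ρ are, up to conjugation, on the same ray, and both summands of the phase can be estimated
alike. The bound on Re ρ² = Re β / |β| is where the sector condition enters. At β = 0 every
direction satisfies the product condition, and ρ = 1 is chosen. -/
lemma Admissible.exists_dir {T : ℝ} (hT : 0 ≤ T) {β : ℂ} (h : Admissible T β) :
    ∃ ρ, IsDescentDir T β ρ := by
  have hd : 2 * decayRate T ≤ 1 / (1 + T) := by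
    unfold decayRate
    rw [← mul_div_assoc, div_le_div_iff₀ (by positivity) (by positivity)]
    nlinarith
  have hd1 : 1 / (1 + T) ≤ 1 := by
    rw [div_le_one (by positivity)]; linarith
  rcases eq_or_ne β 0 with rfl | hβ
  · refine ⟨1, by simp, by simp, ?_, by simp⟩
    simpa using hd.trans hd1
  have hn : 0 < ‖β‖ := norm_pos_iff.mpr hβ
  have hre : 0 < β.re := by
    by_contra hc
    have : β.re = 0 := le_antisymm (not_lt.mp hc) h.re_nonneg
    have h1 := h.norm_le_re
    rw [this, mul_zero] at h1
    linarith
  set ξ : ℂ := (starRingEnd ℂ) β / ‖β‖ with hξ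
  have hξre : ξ.re = β.re / ‖β‖ := by
    rw [hξ, Complex.div_ofReal_re, Complex.conj_re]
  have hξpos : 0 < ξ.re := by rw [hξre]; positivity
  have hξ0 : ξ ≠ 0 := fun h0 => by simp [h0] at hξpos
  have hξn : ‖ξ‖ = 1 := by
    rw [hξ, norm_div, Complex.norm_conj, Complex.norm_real, norm_norm, div_self hn.ne']
  set ρ : ℂ := ξ ^ (1 / 2 : ℂ) with hρ
  have hρ2 : ρ ^ 2 = ξ := by
    rw [hρ, ← Complex.cpow_nat_mul]; norm_num
  have hρn : ‖ρ‖ = 1 := by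
    have : ‖ρ‖ ^ 2 = 1 := by rw [← norm_pow, hρ2, hξn]
    nlinarith [norm_nonneg ρ]
  have hρarg : 0 < ρ.re := by
    rw [hρ, Complex.cpow_def_of_ne_zero hξ0, Complex.exp_re]
    apply mul_pos (Real.exp_pos _)
    apply Real.cos_pos_of_mem_Ioo
    have : (Complex.log ξ * (1 / 2)).im = ξ.arg / 2 := by
      rw [← Complex.log_im]
      simp [Complex.mul_im]; ring
    rw [this]
    have := Complex.neg_pi_lt_arg ξ
    have := Complex.arg_le_pi ξ
    have := Complex.abs_arg_lt_pi_div_two_iff.mpr (Or.inl hξpos)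
    rw [abs_lt] at this
    constructor <;> linarith [this.1, this.2, Real.pi_pos]
  refine ⟨ρ, hρn, hρarg, ?_, ?_⟩
  · rw [hρ2, hξre]
    refine hd.trans ?_
    rw [div_le_div_iff₀ (by positivity) hn]
    linarith [h.norm_le_re]
  · have h1 : (starRingEnd ℂ) ρ * ρ = 1 := by
      rw [Complex.conj_mul', hρn]; simp
    have h2 : (starRingEnd ℂ) ρ ^ 2 * ‖β‖ = β := by
      rw [← map_pow, hρ2, hξ, map_div₀, Complex.conj_conj, Complex.conj_ofReal]
      exact div_mul_cancel₀ _ (by exact_mod_cast hn.ne')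
    calc β * ρ = ((starRingEnd ℂ) ρ ^ 2 * ‖β‖) * ρ := by rw [h2]
      _ = ‖β‖ * (starRingEnd ℂ) ρ * ((starRingEnd ℂ) ρ * ρ) := by ring
      _ = _ := by rw [h1, mul_one]

lemma Admissible.one_add_sq_re {T : ℝ} (hT : 0 ≤ T) {β : ℂ} (h : Admissible T β) :
    2 * decayRate T ≤ (1 + β ^ 2).re := by
  have h1 : β.re ^ 2 + β.im ^ 2 ≤ 1 := by
    have := Complex.sq_norm β
    rw [Complex.normSq_apply] at this
    nlinarith [h.norm_le, norm_nonneg β]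
  have h2 : β.im ^ 2 ≤ T ^ 2 * β.re ^ 2 := by
    rw [← mul_pow, ← sq_abs]
    exact pow_le_pow_left₀ (abs_nonneg _) h.im_le 2
  have h3 : (1 + β ^ 2).re = 1 + β.re ^ 2 - β.im ^ 2 := by
    simp [pow_two]; ring
  rw [h3]
  unfold decayRate
  rw [← mul_div_assoc, div_le_iff₀ (by positivity)]
  nlinarith [mul_nonneg hT (sq_nonneg β.re), mul_nonneg hT (sub_nonneg.mpr h1),
    mul_nonneg (sq_nonneg T) (sub_nonneg.mpr h1), mul_nonneg (sq_nonneg T) (sq_nonneg β.re),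
    mul_nonneg (mul_nonneg hT hT) hT, sq_nonneg β.im, mul_nonneg hT (sq_nonneg β.im)]

/-- The series of ψ(-x) has real part ∑ (1 + Re βⁿ) xⁿ/n over n ≥ 2. Since |β| ≤ 1 no coefficient is
negative, so the quadratic term alone is a lower bound. -/
lemma re_sq_le_centredPhase_neg {β : ℂ} (hβ : ‖β‖ ≤ 1) {x : ℝ} (hx0 : 0 ≤ x) (hx : x < 1) :
    (1 + β ^ 2).re / 2 * x ^ 2 ≤ (centredPhase β (-x)).re := by
  have hn1 : ‖(x : ℂ)‖ < 1 := by rw [Complex.norm_real, Real.norm_of_nonneg hx0]; exact hx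
  have hn2 : ‖β * x‖ < 1 := by
    rw [norm_mul]
    nlinarith [norm_nonneg β, norm_nonneg (x : ℂ)]
  have hs := Complex.hasSum_re
    ((Complex.hasSum_taylorSeries_neg_log hn1).add (Complex.hasSum_taylorSeries_neg_log hn2))
  have hterm : ∀ n : ℕ, ((x : ℂ) ^ n / n + (β * x) ^ n / n).re = (1 + (β ^ n).re) * (x ^ n / n) := by
    intro n
    have : (x : ℂ) ^ n / n + (β * x) ^ n / n = (1 + β ^ n) * ((x ^ n / n : ℝ) : ℂ) := by
      push_cast; ring
    rw [this, Complex.re_mul_ofReal]; simp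
  simp only [hterm] at hs
  have hnn : ∀ n : ℕ, 0 ≤ (1 + (β ^ n).re) * (x ^ n / n) := by
    intro n
    refine mul_nonneg ?_ (by positivity)
    have h1 : |(β ^ n).re| ≤ 1 := (Complex.abs_re_le_norm _).trans
      (by rw [norm_pow]; exact pow_le_one₀ (norm_nonneg _) hβ)
    linarith [(abs_le.mp h1).1]
  -- Of the three terms kept, n = 0 is zero because division by zero gives zero, n = 1 cancels
  -- against the linear part of the phase, and n = 2 is the bound.
  have hle := sum_le_hasSum (Finset.range 3) (fun n _ => hnn n) hs
  simp only [Finset.sum_range_succ, Finset.sum_range_zero] at hle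
  have h4 : (centredPhase β (-x)).re =
      (-Complex.log (1 - x) + -Complex.log (1 - β * x)).re - (1 + β.re) * x := by
    simp [centredPhase, gammaPhase, ← sub_eq_add_neg]
    ring
  rw [h4]
  simp only [Complex.add_re, Complex.one_re, Nat.cast_zero, div_zero, mul_zero, pow_one,
    Nat.cast_one, div_one, Nat.cast_ofNat, zero_add] at hle ⊢
  linarith

lemma sq_div_le_sub_log {x : ℝ} (hx : 0 ≤ x) : x ^ 2 / (2 * (1 + x)) ≤ x - Real.log (1 + x) := by
  have hm : MonotoneOn (fun x : ℝ => x - Real.log (1 + x) - x ^ 2 / (2 * (1 + x))) (Set.Ici 0) := by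
    have hd : ∀ x : ℝ, 0 ≤ x → HasDerivAt
        (fun x : ℝ => x - Real.log (1 + x) - x ^ 2 / (2 * (1 + x)))
        (1 - 1 / (1 + x) - (2 * x * (2 * (1 + x)) - x ^ 2 * 2) / (2 * (1 + x)) ^ 2) x := by
      intro x hx
      have h1 : HasDerivAt (fun x : ℝ => 1 + x) 1 x := (hasDerivAt_id x).const_add 1
      have h2 := h1.const_mul (2 : ℝ)
      have h3 := (hasDerivAt_pow 2 x)
      have := ((hasDerivAt_id x).sub (h1.log (by positivity))).sub (h3.div h2 (by positivity))
      convert! this using 1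
      simp
    apply monotoneOn_of_deriv_nonneg (convex_Ici 0)
    · exact fun x hx => (hd x hx).continuousAt.continuousWithinAt
    · intro x hx; rw [interior_Ici] at hx
      exact (hd x (le_of_lt hx)).differentiableAt.differentiableWithinAt
    · intro x hx
      rw [interior_Ici] at hx
      have hx' : 0 < x := hx
      rw [(hd x hx'.le).deriv]
      have : 1 - 1 / (1 + x) - (2 * x * (2 * (1 + x)) - x ^ 2 * 2) / (2 * (1 + x)) ^ 2
          = x ^ 2 / (2 * (1 + x) ^ 2) := by
        field_simp; ring
      rw [this]; positivity
  have := hm (Set.mem_Ici.mpr le_rfl) (Set.mem_Ici.mpr hx) hx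
  simp at this
  linarith

/-- With c = Re ρ and q = Re ρ² = 2c² - 1, both sides vanish at x = 0. The derivative of their
difference is, up to a positive denominator, x²((q + c - 2cq) + x(c - q)), which is nonnegative
because 0 ≤ q ≤ c ≤ 1. -/
lemma re_gammaPhase_ray {ρ : ℂ} (h1 : ‖ρ‖ = 1) (h2 : 0 < ρ.re) (h3 : 0 ≤ (ρ ^ 2).re) {x : ℝ}
    (hx : 0 ≤ x) : (ρ ^ 2).re * (x - Real.log (1 + x)) ≤ (gammaPhase (ρ * x)).re := by
  set c := ρ.re with hc
  set q := (ρ ^ 2).re with hq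
  have hns : c ^ 2 + ρ.im ^ 2 = 1 := by
    have := Complex.sq_norm ρ
    rw [Complex.normSq_apply, h1] at this
    rw [hc]; linarith
  have hqc : q = 2 * c ^ 2 - 1 := by
    have : (ρ ^ 2).re = ρ.re ^ 2 - ρ.im ^ 2 := by simp [pow_two]
    rw [hq, this, ← hc]; linarith
  have hc1 : c ≤ 1 := by nlinarith [sq_nonneg ρ.im]
  have hD : ∀ x : ℝ, 0 ≤ x → 0 < 1 + 2 * c * x + x ^ 2 := fun x hx => by positivity
  have hre : ∀ x : ℝ, 0 ≤ x → (gammaPhase (ρ * x)).re = c * x - Real.log (1 + 2 * c * x + x ^ 2) / 2 := by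
    intro x hx
    have h5 : ‖1 + ρ * x‖ ^ 2 = 1 + 2 * c * x + x ^ 2 := by
      rw [Complex.sq_norm, Complex.normSq_apply]
      simp only [Complex.add_re, Complex.one_re, Complex.re_mul_ofReal, Complex.add_im,
        Complex.one_im, Complex.im_mul_ofReal, ← hc]
      linear_combination x ^ 2 * hns
    unfold gammaPhase
    rw [Complex.sub_re, Complex.re_mul_ofReal, Complex.log_re, ← h5, Real.log_pow]
    push_cast; ring
  have hd : ∀ x : ℝ, 0 ≤ x → HasDerivAt
      (fun x : ℝ => c * x - Real.log (1 + 2 * c * x + x ^ 2) / 2 - q * (x - Real.log (1 + x)))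
      (c - (2 * c + 2 * x) / (1 + 2 * c * x + x ^ 2) / 2 - q * (1 - 1 / (1 + x))) x := by
    intro x hx
    have e1 : HasDerivAt (fun x : ℝ => 1 + x) 1 x := (hasDerivAt_id x).const_add 1
    have e2 : HasDerivAt (fun x : ℝ => 1 + 2 * c * x + x ^ 2) (2 * c + 2 * x) x := by
      have := (((hasDerivAt_id x).const_mul (2 * c)).const_add 1).add (hasDerivAt_pow 2 x)
      convert! this using 1; simp
    have := (((hasDerivAt_id x).const_mul c).sub ((e2.log (hD x hx).ne').div_const 2)).sub
      (((hasDerivAt_id x).sub (e1.log (by positivity))).const_mul q)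
    convert! this using 1
    simp
  have hm : MonotoneOn (fun x : ℝ => c * x - Real.log (1 + 2 * c * x + x ^ 2) / 2
      - q * (x - Real.log (1 + x))) (Set.Ici 0) := by
    apply monotoneOn_of_deriv_nonneg (convex_Ici 0)
    · exact fun x hx => (hd x hx).continuousAt.continuousWithinAt
    · intro x hx; rw [interior_Ici] at hx
      exact (hd x (le_of_lt hx)).differentiableAt.differentiableWithinAt
    · intro x hx
      rw [interior_Ici] at hx
      have hx' : 0 < x := hx
      have := hD x hx'.le
      rw [(hd x hx'.le).deriv]
      have : c - (2 * c + 2 * x) / (1 + 2 * c * x + x ^ 2) / 2 - q * (1 - 1 / (1 + x))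
          = x * ((q + c * x) * (1 + x) - q * (1 + 2 * c * x + x ^ 2))
              / ((1 + 2 * c * x + x ^ 2) * (1 + x)) := by
        have hx1 : 1 + x ≠ 0 := by positivity
        have hx2 : 1 + 2 * c * x + x ^ 2 ≠ 0 := this.ne'
        field_simp
        rw [hqc]; ring
      rw [this]
      apply div_nonneg _ (by positivity)
      apply mul_nonneg hx'.le
      have hcq : q ≤ c := by nlinarith
      have e : (q + c * x) * (1 + x) - q * (1 + 2 * c * x + x ^ 2)
          = x * (q + c - 2 * c * q) + x ^ 2 * (c - q) := by ring
      rw [e]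
      have : 0 ≤ q + c - 2 * c * q := by nlinarith
      have : 0 ≤ c - q := by linarith
      positivity
  have := hm (Set.mem_Ici.mpr le_rfl) (Set.mem_Ici.mpr hx) hx
  simp only [mul_zero, zero_pow two_ne_zero, add_zero, Real.log_one, zero_div, sub_zero] at this
  rw [hre x hx]
  linarith

lemma gammaPhase_conj {v : ℂ} (hv : 0 ≤ v.re) :
    gammaPhase ((starRingEnd ℂ) v) = (starRingEnd ℂ) (gammaPhase v) := by
  unfold gammaPhase
  rw [map_sub, ← Complex.log_conj]
  · simp
  · have : 0 < (1 + v).re := by simp; linarith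
    exact (Complex.slitPlane_arg_ne_pi (Or.inl this))

/-- The second summand of the phase is, up to conjugation, the first one at |β|x. It is nonnegative
by `re_gammaPhase_ray` and is discarded; the first summand alone gives the bound, which thus
survives β → 0. -/
lemma IsDescentDir.le_re_centredPhase {T : ℝ} (hT : 0 ≤ T) {β ρ : ℂ} (h : IsDescentDir T β ρ) {x : ℝ}
    (hx : 0 ≤ x) : decayRate T * (x ^ 2 / (1 + x)) ≤ (centredPhase β (ρ * x)).re := by
  have hq := h.sq_re
  have hc := decayRate_pos hT
  have hq0 : 0 ≤ (ρ ^ 2).re := by linarith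
  have e : β * (ρ * x) = (starRingEnd ℂ) (ρ * ((‖β‖ * x : ℝ) : ℂ)) := by
    rw [← mul_assoc, h.mul_eq, map_mul, Complex.conj_ofReal]; push_cast; ring
  have hnn : 0 ≤ (ρ * ((‖β‖ * x : ℝ) : ℂ)).re := by
    rw [Complex.re_mul_ofReal]
    have := h.re_pos
    positivity
  unfold centredPhase
  rw [Complex.add_re, e, gammaPhase_conj hnn, Complex.conj_re]
  have a1 := re_gammaPhase_ray h.norm_eq h.re_pos hq0 hx
  have hbx : 0 ≤ ‖β‖ * x := by positivity
  have a2 := re_gammaPhase_ray h.norm_eq h.re_pos hq0 hbx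
  have a3 := sq_div_le_sub_log hx
  have a4 := sq_div_le_sub_log hbx
  have a5 : 0 ≤ (‖β‖ * x) ^ 2 / (2 * (1 + ‖β‖ * x)) := by positivity
  have a6 : 0 ≤ (ρ ^ 2).re * (‖β‖ * x - Real.log (1 + ‖β‖ * x)) := mul_nonneg hq0 (by linarith)
  have a7 : 0 ≤ x ^ 2 / (2 * (1 + x)) := by positivity
  have a8 : 2 * decayRate T * (x ^ 2 / (2 * (1 + x))) ≤ (ρ ^ 2).re * (x - Real.log (1 + x)) :=
    mul_le_mul hq a3 a7 hq0
  have a9 : 2 * decayRate T * (x ^ 2 / (2 * (1 + x))) = decayRate T * (x ^ 2 / (1 + x)) := by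
    field_simp
  linarith

lemma Admissible.le_re_centredPhase_neg {T : ℝ} (hT : 0 ≤ T) {β : ℂ} (h : Admissible T β) {x : ℝ}
    (hx : 0 ≤ x) (hx1 : x < 1) : decayRate T * (x ^ 2 / (1 + x)) ≤ (centredPhase β (-x)).re := by
  refine le_trans ?_ (re_sq_le_centredPhase_neg h.norm_le hx hx1)
  have h1 := h.one_add_sq_re hT
  have h2 : x ^ 2 / (1 + x) ≤ x ^ 2 := div_le_self (sq_nonneg x) (by linarith)
  exact mul_le_mul (by linarith) h2 (by positivity) (by linarith [decayRate_pos hT])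

end GenBessel
end

/-! ### Truncated and complete Gaussian moments with complex rate. -/

noncomputable section
namespace GenBessel

open MeasureTheory intervalIntegral in
/-- The Gaussian moment over `[0, 1]`. -/
def truncMoment (j : ℕ) (b : ℂ) : ℂ := ∫ t in (0 : ℝ)..1, (t : ℂ) ^ j * Complex.exp (-b * t ^ 2)

/-- The Gaussian moment over `[0, ∞)`, by its recursion. -/
def gaussMoment : ℕ → ℂ → ℂ
  | 0, b => (Real.pi / b) ^ (1 / 2 : ℂ) / 2
  | 1, b => 1 / (2 * b)
  | j + 2, b => (j + 1) / (2 * b) * gaussMoment j b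

lemma gaussMoment_even (k : ℕ) (b : ℂ) :
    gaussMoment (2 * k) b =
      (ascPochhammer ℂ k).eval (1 / 2 : ℂ) / b ^ k * ((Real.pi / b) ^ (1 / 2 : ℂ) / 2) := by
  induction k with
  | zero => simp [gaussMoment]
  | succ k ih =>
    rw [show 2 * (k + 1) = 2 * k + 2 by ring, gaussMoment, ih, ascPochhammer_succ_eval]
    push_cast
    rcases eq_or_ne b 0 with rfl | hb
    · simp
    · field_simp
      ring

lemma gaussMoment_odd (k : ℕ) (b : ℂ) :
    gaussMoment (2 * k + 1) b = k.factorial / (2 * b ^ (k + 1)) := by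
  induction k with
  | zero => simp [gaussMoment]
  | succ k ih =>
    rw [show 2 * (k + 1) + 1 = (2 * k + 1) + 2 by ring, gaussMoment, ih, Nat.factorial_succ]
    push_cast
    rcases eq_or_ne b 0 with rfl | hb
    · simp
    · field_simp
      ring

lemma hasDerivAt_cexp_neg_mul_sq (b : ℂ) (t : ℝ) :
    HasDerivAt (fun t : ℝ => Complex.exp (-b * (t : ℂ) ^ 2))
      (-2 * b * t * Complex.exp (-b * (t : ℂ) ^ 2)) t := by
  have h1 : HasDerivAt (fun z : ℂ => Complex.exp (-b * z ^ 2))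
      (-2 * b * t * Complex.exp (-b * (t : ℂ) ^ 2)) (t : ℂ) := by
    have := ((hasDerivAt_pow 2 (t : ℂ)).const_mul (-b)).cexp
    convert! this using 1
    push_cast; ring
  exact h1.comp_ofReal

lemma truncMoment_one {b : ℂ} (hb : b ≠ 0) :
    truncMoment 1 b = 1 / (2 * b) - Complex.exp (-b) / (2 * b) := by
  have h := intervalIntegral.integral_eq_sub_of_hasDerivAt (a := 0) (b := 1)
    (f := fun t : ℝ => -1 / (2 * b) * Complex.exp (-b * (t : ℂ) ^ 2))
    (f' := fun t : ℝ => (t : ℂ) ^ 1 * Complex.exp (-b * t ^ 2)) (fun t _ => by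
      have := (hasDerivAt_cexp_neg_mul_sq b t).const_mul (-1 / (2 * b))
      convert! this using 1
      field_simp) (Continuous.intervalIntegrable (by fun_prop) _ _)
  unfold truncMoment
  rw [h]
  simp
  ring

/-- Integration by parts: `gaussMoment` satisfies the same recursion without the boundary term, so
the two differ by exponentially small quantities. -/
lemma truncMoment_add_two {b : ℂ} (hb : b ≠ 0) (j : ℕ) :
    truncMoment (j + 2) b =
      (j + 1) / (2 * b) * truncMoment j b - Complex.exp (-b) / (2 * b) := by
  have h := intervalIntegral.integral_eq_sub_of_hasDerivAt (a := 0) (b := 1)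
    (f := fun t : ℝ => (t : ℂ) ^ (j + 1) * Complex.exp (-b * (t : ℂ) ^ 2))
    (f' := fun t : ℝ => (j + 1) * ((t : ℂ) ^ j * Complex.exp (-b * t ^ 2))
        - 2 * b * ((t : ℂ) ^ (j + 2) * Complex.exp (-b * t ^ 2))) (fun t _ => by
      have h1 : HasDerivAt (fun t : ℝ => (t : ℂ) ^ (j + 1)) ((j + 1) * (t : ℂ) ^ j) t := by
        have := (hasDerivAt_pow (j + 1) (t : ℂ)).comp_ofReal
        simpa using this
      have := h1.mul (hasDerivAt_cexp_neg_mul_sq b t)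
      convert! this using 1
      ring) (Continuous.intervalIntegrable (by fun_prop) _ _)
  rw [intervalIntegral.integral_sub (Continuous.intervalIntegrable (by fun_prop) _ _)
    (Continuous.intervalIntegrable (by fun_prop) _ _), intervalIntegral.integral_const_mul,
    intervalIntegral.integral_const_mul] at h
  change (j + 1) * truncMoment j b - 2 * b * truncMoment (j + 2) b = _ at h
  simp at h
  field_simp
  linear_combination -h

open MeasureTheory Set in
-- The difference is the tail over t > 1, where t² ≥ t and 1 ≤ Re b allow the majorant Re b · e^(-Re
-- b · t), which integrates exactly.
lemma norm_truncMoment_zero_sub_le {b : ℂ} (hb : 1 ≤ b.re) :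
    ‖truncMoment 0 b - gaussMoment 0 b‖ ≤ Real.exp (-b.re) := by
  have hb0 : 0 < b.re := by linarith
  have hint : IntegrableOn (fun t : ℝ => Complex.exp (-b * t ^ 2)) (Ioi 0) :=
    (integrable_cexp_neg_mul_sq hb0).integrableOn
  have hsplit := setIntegral_union (μ := volume) (f := fun t : ℝ => Complex.exp (-b * t ^ 2))
    (Ioc_disjoint_Ioi le_rfl : Disjoint (Ioc (0 : ℝ) 1) (Ioi 1)) measurableSet_Ioi
    (hint.mono_set Ioc_subset_Ioi_self) (hint.mono_set (Ioi_subset_Ioi zero_le_one))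
  rw [Ioc_union_Ioi_eq_Ioi zero_le_one, integral_gaussian_complex_Ioi hb0,
    ← intervalIntegral.integral_of_le zero_le_one] at hsplit
  have e : truncMoment 0 b - gaussMoment 0 b = -∫ t in Ioi (1 : ℝ), Complex.exp (-b * t ^ 2) := by
    simp only [truncMoment, gaussMoment, pow_zero, one_mul]
    rw [hsplit]; ring
  rw [e, norm_neg]
  have hd : ∀ t ∈ Ici (1 : ℝ), HasDerivAt (fun t : ℝ => -Real.exp (-b.re * t))
      (b.re * Real.exp (-b.re * t)) t := by
    intro t _
    have := (((hasDerivAt_id t).const_mul (-b.re)).exp).neg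
    convert! this using 1
    simp; ring
  have hlim : Tendsto (fun t : ℝ => -Real.exp (-b.re * t)) atTop (𝓝 (-0)) := by
    apply Tendsto.neg
    apply Real.tendsto_exp_atBot.comp
    exact Tendsto.const_mul_atTop_of_neg (by linarith) tendsto_id
  have hi := integrableOn_Ioi_deriv_of_nonneg' (g' := fun t => b.re * Real.exp (-b.re * t))
    hd (fun t _ => by positivity) hlim
  have hv := integral_Ioi_of_hasDerivAt_of_nonneg' (g' := fun t => b.re * Real.exp (-b.re * t))
    hd (fun t _ => by positivity) hlim
  calc ‖∫ t in Ioi (1 : ℝ), Complex.exp (-b * t ^ 2)‖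
      ≤ ∫ t in Ioi (1 : ℝ), b.re * Real.exp (-b.re * t) := by
        apply norm_integral_le_of_norm_le hi
        rw [ae_restrict_iff' measurableSet_Ioi]
        filter_upwards with t ht
        have ht' : 1 < t := ht
        rw [Complex.norm_exp]
        have : (-b * (t : ℂ) ^ 2).re = -b.re * t ^ 2 := by
          rw [← Complex.ofReal_pow, Complex.re_mul_ofReal]; simp
        rw [this]
        have h1 : Real.exp (-b.re * t ^ 2) ≤ Real.exp (-b.re * t) := by
          apply Real.exp_le_exp.mpr
          nlinarith [mul_pos hb0 (sub_pos.mpr ht')]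
        nlinarith [Real.exp_pos (-b.re * t)]
    _ = Real.exp (-b.re) := by rw [hv]; simp

lemma exists_norm_truncMoment_sub_le (j : ℕ) :
    ∃ C : ℝ, 0 ≤ C ∧ ∀ b : ℂ, 1 ≤ b.re →
      ‖truncMoment j b - gaussMoment j b‖ ≤ C * Real.exp (-b.re) := by
  have hnb : ∀ b : ℂ, 1 ≤ b.re → 1 ≤ ‖b‖ := fun b hb => hb.trans (Complex.re_le_norm b)
  have hb0 : ∀ b : ℂ, 1 ≤ b.re → b ≠ 0 := fun b hb => by
    rintro rfl; norm_num at hb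
  have hexp : ∀ b : ℂ, 1 ≤ b.re → ‖Complex.exp (-b) / (2 * b)‖ ≤ Real.exp (-b.re) := by
    intro b hb
    rw [norm_div, Complex.norm_exp, norm_mul, Complex.neg_re]
    apply div_le_self (Real.exp_pos _).le
    have := hnb b hb
    simp only [Complex.norm_ofNat]; linarith
  induction j using Nat.twoStepInduction with
  | zero => exact ⟨1, zero_le_one, fun b hb => by simpa using norm_truncMoment_zero_sub_le hb⟩
  | one =>
    refine ⟨1, zero_le_one, fun b hb => ?_⟩
    rw [truncMoment_one (hb0 b hb), gaussMoment, sub_sub_cancel_left, norm_neg, one_mul]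
    exact hexp b hb
  | more j ih _ =>
    obtain ⟨C, hC, ih⟩ := ih
    refine ⟨(j + 1) * C + 1, by positivity, fun b hb => ?_⟩
    rw [truncMoment_add_two (hb0 b hb), gaussMoment]
    have e : (j + 1) / (2 * b) * truncMoment j b - Complex.exp (-b) / (2 * b)
        - (j + 1) / (2 * b) * gaussMoment j b
        = (j + 1) / (2 * b) * (truncMoment j b - gaussMoment j b)
          - Complex.exp (-b) / (2 * b) := by ring
    rw [e]
    refine (norm_sub_le _ _).trans ?_
    rw [norm_mul]
    have h1 : ‖((j : ℂ) + 1) / (2 * b)‖ ≤ j + 1 := by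
      rw [norm_div]
      have : ‖(j : ℂ) + 1‖ = j + 1 := by
        rw [← Nat.cast_succ, Complex.norm_natCast]; simp
      rw [this]
      apply div_le_self (by positivity)
      rw [norm_mul, Complex.norm_ofNat]
      linarith [hnb b hb]
    have h2 := mul_le_mul h1 (ih b hb) (norm_nonneg _) (by positivity)
    linarith [hexp b hb]

/-- A Gaussian moment along a curve issuing from `0` depends only on the endpoint. -/
lemma integral_gauss_curve (j : ℕ) (a : ℂ) {ε : ℝ} (hε : 0 ≤ ε) {W W' : ℝ → ℂ} (hW0 : W 0 = 0)
    (hW : ∀ r ∈ Set.Icc 0 ε, HasDerivAt W (W' r) r) (hW' : ContinuousOn W' (Set.Icc 0 ε)) :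
    ∫ r in (0 : ℝ)..ε, W r ^ j * W' r * Complex.exp (-a * W r ^ 2)
      = W ε ^ (j + 1) * truncMoment j (a * W ε ^ 2) := by
  have hWc : ContinuousOn W (Set.Icc 0 ε) :=
    fun r hr => (hW r hr).continuousAt.continuousWithinAt
  have hdiff : Differentiable ℂ (fun y : ℂ => y ^ j * Complex.exp (-a * y ^ 2)) := by fun_prop
  -- The integrand is entire in y, hence has a primitive; the curve and the straight segment to its
  -- endpoint give the same increment.
  obtain ⟨P, hP⟩ := hdiff.isExactOn_univ
  have h1 : ∫ r in (0 : ℝ)..ε, W r ^ j * W' r * Complex.exp (-a * W r ^ 2) = P (W ε) - P (W 0) := by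
    apply intervalIntegral.integral_eq_sub_of_hasDerivAt (f := fun r => P (W r))
    · intro r hr
      rw [Set.uIcc_of_le hε] at hr
      have := (hP (W r) trivial).comp r (hW r hr)
      convert! this using 1
      ring
    · apply ContinuousOn.intervalIntegrable
      rw [Set.uIcc_of_le hε]
      fun_prop
  have h2 : ∫ t in (0 : ℝ)..1, W ε ^ (j + 1) * ((t : ℂ) ^ j * Complex.exp (-(a * W ε ^ 2) * t ^ 2))
      = P (W ε) - P (W 0) := by
    have := intervalIntegral.integral_eq_sub_of_hasDerivAt (a := 0) (b := 1)
      (f := fun t : ℝ => P (t * W ε))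
      (f' := fun t : ℝ => W ε ^ (j + 1) * ((t : ℂ) ^ j * Complex.exp (-(a * W ε ^ 2) * t ^ 2)))
      (fun t _ => by
        have h3 : HasDerivAt (fun t : ℝ => (t : ℂ) * W ε) (W ε) t := by
          simpa using ((hasDerivAt_id (t : ℂ)).mul_const (W ε)).comp_ofReal
        have := (hP _ trivial).comp t h3
        convert! this using 1
        rw [show -(a * W ε ^ 2) * (t : ℂ) ^ 2 = -a * (t * W ε) ^ 2 by ring]
        ring) (Continuous.intervalIntegrable (by fun_prop) _ _)
    rw [this, hW0]; simp
  rw [h1, ← h2, intervalIntegral.integral_const_mul]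
  rfl

end GenBessel
end

/-! ### Expansion in the local coordinate, with bounds uniform in β. -/

noncomputable section
namespace GenBessel

/-- The successive remainders in the expansion of `h` in the functions `(v H)^i w'`. -/
def remainderFactor (h H w' : ℂ → ℂ) : ℕ → ℂ → ℂ
  | 0 => h
  | j + 1 => dslope (fun v => remainderFactor h H w' j v - remainderFactor h H w' j 0 * H v ^ j * w' v) 0

section Expansion

variable {h H w' : ℂ → ℂ}

/-- Since H(0) = w'(0) = 1, subtracting r_j(0) H^j w' from r_j leaves a function vanishing at 0;
dividing it by v gives r_{j+1}. Iterating yields an exact finite expansion in the functions w^i w'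
with w = vH, without inverting w. -/
lemma eq_sum_add_remainder (hH : H 0 = 1) (hw' : w' 0 = 1) (j : ℕ) (v : ℂ) :
    h v = ∑ i ∈ Finset.range j, remainderFactor h H w' i 0 * ((v * H v) ^ i * w' v)
      + v ^ j * remainderFactor h H w' j v := by
  induction j with
  | zero => simp [remainderFactor]
  | succ j ih =>
    have h1 := sub_smul_dslope
      (fun v => remainderFactor h H w' j v - remainderFactor h H w' j 0 * H v ^ j * w' v) 0 v
    rw [sub_zero, smul_eq_mul] at h1
    simp only [hH, hw', one_pow, mul_one, sub_self, sub_zero] at h1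
    rw [Finset.sum_range_succ, pow_succ, mul_assoc (v ^ j), remainderFactor, h1]
    rw [mul_pow]
    linear_combination ih

lemma differentiableOn_remainderFactor {ε : ℝ} (hε : 0 < ε)
    (dh : DifferentiableOn ℂ h (Metric.ball 0 ε)) (dH : DifferentiableOn ℂ H (Metric.ball 0 ε))
    (dw : DifferentiableOn ℂ w' (Metric.ball 0 ε)) (j : ℕ) :
    DifferentiableOn ℂ (remainderFactor h H w' j) (Metric.ball 0 ε) := by
  induction j with
  | zero => exact dh
  | succ j ih =>
    rw [remainderFactor, Complex.differentiableOn_dslope (Metric.ball_mem_nhds 0 hε)]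
    exact ih.sub (((dH.pow j).const_mul _).mul dw)

/-- A bound for `remainderFactor` in terms of bounds for its data. -/
def remainderBound (M ε : ℝ) : ℕ → ℝ
  | 0 => M
  | j + 1 => (remainderBound M ε j + remainderBound M ε j * M ^ j * M) / ε

/-- Each division by v costs a factor 1/ε by the Schwarz lemma, so the bounds depend only on ε, M
and the order. -/
lemma norm_remainderFactor_le {ε M : ℝ} (hε : 0 < ε) (hH0 : H 0 = 1) (hw0 : w' 0 = 1)
    (dh : DifferentiableOn ℂ h (Metric.ball 0 ε)) (dH : DifferentiableOn ℂ H (Metric.ball 0 ε))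
    (dw : DifferentiableOn ℂ w' (Metric.ball 0 ε))
    (bh : ∀ v ∈ Metric.ball (0 : ℂ) ε, ‖h v‖ ≤ M) (bH : ∀ v ∈ Metric.ball (0 : ℂ) ε, ‖H v‖ ≤ M)
    (bw : ∀ v ∈ Metric.ball (0 : ℂ) ε, ‖w' v‖ ≤ M) (j : ℕ) :
    ∀ v ∈ Metric.ball (0 : ℂ) ε, ‖remainderFactor h H w' j v‖ ≤ remainderBound M ε j := by
  have h0 : (0 : ℂ) ∈ Metric.ball (0 : ℂ) ε := Metric.mem_ball_self hε
  induction j with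
  | zero => exact bh
  | succ j ih =>
    intro v hv
    apply Complex.norm_dslope_le_div_of_mapsTo_ball _ _ hv
    · exact (differentiableOn_remainderFactor hε dh dH dw j).sub
        (((dH.pow j).const_mul _).mul dw)
    · intro x hx
      rw [mem_closedBall_iff_norm]
      simp only [hH0, hw0, one_pow, mul_one, sub_self, sub_zero]
      refine (norm_sub_le _ _).trans (add_le_add (ih x hx) ?_)
      rw [norm_mul, norm_mul, norm_pow]
      have := (norm_nonneg _).trans (ih 0 h0)
      have := (norm_nonneg _).trans (bH 0 h0)
      gcongr
      · exact ih 0 h0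
      · exact bH x hx
      · exact bw x hx

end Expansion

/-- The function `(v - log (1 + v)) / v²`, continued to `0`. -/
def gammaQuot : ℂ → ℂ := dslope (dslope gammaPhase 0) 0

lemma hasDerivAt_gammaPhase {v : ℂ} (hv : 1 + v ∈ Complex.slitPlane) :
    HasDerivAt gammaPhase (v / (1 + v)) v := by
  have h1 : HasDerivAt (fun v : ℂ => 1 + v) 1 v := (hasDerivAt_id v).const_add 1
  have := (hasDerivAt_id v).sub (h1.clog hv)
  convert! this using 1
  have := Complex.slitPlane_ne_zero hv
  field_simp
  ring

lemma one_add_mem_slitPlane {v : ℂ} (hv : ‖v‖ < 1) : 1 + v ∈ Complex.slitPlane := by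
  left
  have := (abs_le.mp ((Complex.abs_re_le_norm v))).1
  simp; linarith

lemma gammaPhase_zero : gammaPhase 0 = 0 := by simp [gammaPhase]

lemma deriv_gammaPhase_zero : deriv gammaPhase 0 = 0 := by
  rw [(hasDerivAt_gammaPhase (one_add_mem_slitPlane (by simp))).deriv]; simp

lemma gammaPhase_eq (v : ℂ) : gammaPhase v = v ^ 2 * gammaQuot v := by
  have h1 := sub_smul_dslope gammaPhase 0 v
  have h2 := sub_smul_dslope (dslope gammaPhase 0) 0 v
  rw [dslope_same, deriv_gammaPhase_zero] at h2
  rw [gammaPhase_zero] at h1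
  simp only [sub_zero, smul_eq_mul] at h1 h2
  rw [gammaQuot, pow_two, mul_assoc, h2, h1]

lemma differentiableOn_gammaQuot : DifferentiableOn ℂ gammaQuot (Metric.ball 0 1) := by
  have hn : Metric.ball (0 : ℂ) 1 ∈ 𝓝 0 := Metric.ball_mem_nhds 0 one_pos
  rw [gammaQuot, Complex.differentiableOn_dslope hn, Complex.differentiableOn_dslope hn]
  intro v hv
  exact (hasDerivAt_gammaPhase
    (one_add_mem_slitPlane (mem_ball_zero_iff.mp hv))).differentiableAt.differentiableWithinAt

/-- A common power of v may be cancelled off 0, and continuity carries the equality to 0. -/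
lemma coeff_eq_of_eventuallyEq {a b : ℂ → ℂ} {n : ℕ} (ha : ContinuousAt a 0) (hb : ContinuousAt b 0)
    (h : ∀ᶠ v in 𝓝 (0 : ℂ), v ^ n * a v = v ^ n * b v) : a 0 = b 0 := by
  have h1 : ∀ᶠ v in 𝓝[≠] (0 : ℂ), a v = b v := by
    filter_upwards [h.filter_mono nhdsWithin_le_nhds, self_mem_nhdsWithin] with v hv hv0
    exact mul_left_cancel₀ (pow_ne_zero n hv0) hv
  exact tendsto_nhds_unique ((ha.tendsto.mono_left nhdsWithin_le_nhds).congr' h1)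
    (hb.tendsto.mono_left nhdsWithin_le_nhds)

lemma analyticAt_gammaQuot {v : ℂ} (hv : ‖v‖ < 1) : AnalyticAt ℂ gammaQuot v :=
  differentiableOn_gammaQuot.analyticAt (Metric.isOpen_ball.mem_nhds (mem_ball_zero_iff.mpr hv))

/-- This is the derivative of g(v) = v²Q(v), with g'(v) = v/(1+v). It determines the Taylor
coefficients of Q. -/
lemma gammaQuot_deriv_eq : ∀ᶠ v in 𝓝 (0 : ℂ),
    v ^ 1 * ((1 + v) * (2 * gammaQuot v + v * deriv gammaQuot v)) = v ^ 1 * 1 := by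
  filter_upwards [Metric.ball_mem_nhds (0 : ℂ) one_pos] with v hv
  have hv1 := mem_ball_zero_iff.mp hv
  have hs := one_add_mem_slitPlane hv1
  have h1 := hasDerivAt_gammaPhase hs
  have h2 := (hasDerivAt_pow 2 v).mul (analyticAt_gammaQuot hv1).differentiableAt.hasDerivAt
  have h3 : gammaPhase = (fun v => v ^ 2) * gammaQuot := funext gammaPhase_eq
  rw [h3] at h1
  have h4 := h1.unique h2
  have := Complex.slitPlane_ne_zero hs
  field_simp at h4
  norm_num at h4
  linear_combination -h4

lemma gammaQuot_zero : gammaQuot 0 = 1 / 2 := by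
  have hG := analyticAt_gammaQuot (v := 0) (by simp)
  have hG1 := hG.continuousAt
  have hG2 := hG.deriv.continuousAt
  have := coeff_eq_of_eventuallyEq (by fun_prop) continuousAt_const gammaQuot_deriv_eq
  simp at this
  rw [eq_div_iff two_ne_zero, mul_comm]; exact this

lemma exists_norm_gammaQuot_sub_le : ∃ C : ℝ, 0 < C ∧ ∀ v : ℂ, ‖v‖ ≤ 1 / 2 →
    ‖gammaQuot v - 1 / 2‖ ≤ C * ‖v‖ := by
  have hn : Metric.ball (0 : ℂ) 1 ∈ 𝓝 0 := Metric.ball_mem_nhds 0 one_pos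
  have hd : DifferentiableOn ℂ (dslope gammaQuot 0) (Metric.ball 0 1) :=
    (Complex.differentiableOn_dslope hn).mpr differentiableOn_gammaQuot
  obtain ⟨C, hC⟩ := (isCompact_closedBall (0 : ℂ) (1 / 2)).exists_bound_of_continuousOn
    (hd.continuousOn.mono (Metric.closedBall_subset_ball (by norm_num)))
  refine ⟨|C| + 1, by positivity, fun v hv => ?_⟩
  have h1 := sub_smul_dslope gammaQuot 0 v
  rw [gammaQuot_zero, sub_zero, smul_eq_mul] at h1
  rw [← h1, norm_mul, mul_comm]
  gcongr
  have := hC v (mem_closedBall_zero_iff.mpr hv)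
  linarith [le_abs_self C]

/-- The normalized quotient `2 ψ(v) / (ψ''(0) v²)`, continued to `0`. -/
def phaseQuot (β v : ℂ) : ℂ := 2 * (gammaQuot v + β ^ 2 * gammaQuot (β * v)) / (1 + β ^ 2)

/-- The factor `w / v` of the local coordinate `w` in which the phase is quadratic. -/
def coordFactor (β v : ℂ) : ℂ := phaseQuot β v ^ (1 / 2 : ℂ)

/-- The local coordinate in which the phase is quadratic. -/
def localCoord (β v : ℂ) : ℂ := v * coordFactor β v

lemma coordFactor_sq (β v : ℂ) : coordFactor β v ^ 2 = phaseQuot β v := by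
  rw [coordFactor, ← Complex.cpow_nat_mul]; norm_num

lemma localCoord_sq {β : ℂ} (hβ : 1 + β ^ 2 ≠ 0) (v : ℂ) :
    (1 + β ^ 2) / 2 * localCoord β v ^ 2 = centredPhase β v := by
  rw [localCoord, mul_pow, coordFactor_sq, phaseQuot, centredPhase, gammaPhase_eq, gammaPhase_eq]
  field_simp

lemma phaseQuot_zero {β : ℂ} (hβ : 1 + β ^ 2 ≠ 0) : phaseQuot β 0 = 1 := by
  rw [phaseQuot, mul_zero, gammaQuot_zero]; field_simp

lemma coordFactor_zero {β : ℂ} (hβ : 1 + β ^ 2 ≠ 0) : coordFactor β 0 = 1 := by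
  rw [coordFactor, phaseQuot_zero hβ, Complex.one_cpow]

lemma Admissible.one_add_sq_ne {T : ℝ} (hT : 0 ≤ T) {β : ℂ} (h : Admissible T β) :
    1 + β ^ 2 ≠ 0 := by
  intro h0
  have := h.one_add_sq_re hT
  rw [h0, Complex.zero_re] at this
  linarith [decayRate_pos hT]

/-- The amplitude of the Bessel polynomial integral, centred at its saddle. -/
def centredAmp (μ β v : ℂ) : ℂ := (1 + v) ^ (μ - 1 / 2) * (1 + β * v) ^ (-1 / 2 : ℂ)

/-- Bounds on a disc for the data of the local expansion. -/
structure LocalBounds (μ : ℂ) (ε M : ℝ) (β : ℂ) : Prop where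
  diff_amp : DifferentiableOn ℂ (centredAmp μ β) (Metric.ball 0 ε)
  diff_factor : DifferentiableOn ℂ (coordFactor β) (Metric.ball 0 ε)
  diff_deriv : DifferentiableOn ℂ (deriv (localCoord β)) (Metric.ball 0 ε)
  hasDerivAt : ∀ v ∈ Metric.ball (0 : ℂ) ε, HasDerivAt (localCoord β) (deriv (localCoord β) v) v
  deriv_zero : deriv (localCoord β) 0 = 1
  amp_le : ∀ v ∈ Metric.ball (0 : ℂ) ε, ‖centredAmp μ β v‖ ≤ M
  factor_le : ∀ v ∈ Metric.ball (0 : ℂ) ε, ‖coordFactor β v‖ ≤ M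
  deriv_le : ∀ v ∈ Metric.ball (0 : ℂ) ε, ‖deriv (localCoord β) v‖ ≤ M

lemma norm_mul_le_of_norm_le_one {β v : ℂ} (hβ : ‖β‖ ≤ 1) : ‖β * v‖ ≤ ‖v‖ := by
  rw [norm_mul]; exact mul_le_of_le_one_left (norm_nonneg v) hβ

lemma differentiableAt_one_add_cpow (s : ℂ) {v : ℂ} (hv : 1 + v ∈ Complex.slitPlane) :
    DifferentiableAt ℂ (fun v : ℂ => (1 + v) ^ s) v :=
  (differentiableAt_id.const_add 1).cpow_const hv

lemma exists_norm_one_add_cpow_le (s : ℂ) : ∃ C : ℝ, 0 ≤ C ∧ ∀ v : ℂ, ‖v‖ ≤ 1 / 2 →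
    ‖(1 + v) ^ s‖ ≤ C := by
  obtain ⟨C, hC⟩ := (isCompact_closedBall (0 : ℂ) (1 / 2)).exists_bound_of_continuousOn
    (f := fun v : ℂ => (1 + v) ^ s) (fun v hv => (differentiableAt_one_add_cpow s
      (one_add_mem_slitPlane (by have := mem_closedBall_zero_iff.mp hv; linarith))).continuousAt.continuousWithinAt)
  exact ⟨|C|, abs_nonneg C, fun v hv =>
    (hC v (mem_closedBall_zero_iff.mpr hv)).trans (le_abs_self C)⟩

lemma differentiableAt_centredAmp (μ : ℂ) {β v : ℂ} (h1 : 1 + v ∈ Complex.slitPlane)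
    (h2 : 1 + β * v ∈ Complex.slitPlane) : DifferentiableAt ℂ (centredAmp μ β) v := by
  apply (differentiableAt_one_add_cpow _ h1).mul
  exact DifferentiableAt.cpow_const (by fun_prop) h2

/-- Because 1+β² is bounded away from 0 on the parameter domain, the normalized quotient
2ψ(v)/((1+β²)v²) stays within 1/2 of 1 on a disc independent of β. Its principal square root is then
analytic there, and all data are bounded by common constants. -/
lemma exists_localBounds {T : ℝ} (hT : 0 ≤ T) (μ : ℂ) : ∃ ε M : ℝ, 0 < ε ∧ ε ≤ 1 / 2 ∧ 1 ≤ M ∧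
    ∀ β, Admissible T β → LocalBounds μ ε M β := by
  obtain ⟨C, hC, hG⟩ := exists_norm_gammaQuot_sub_le
  obtain ⟨C1, hC1, h1⟩ := exists_norm_one_add_cpow_le (μ - 1 / 2)
  obtain ⟨C2, hC2, h2⟩ := exists_norm_one_add_cpow_le (-1 / 2)
  have hc := decayRate_pos hT
  -- With |Q(v) - 1/2| ≤ C|v| and |1+β²| ≥ 2d the quotient differs from 1 by at most 2C|v|/d, which
  -- is at most 1/2 for |v| ≤ d/(4C).
  set ε : ℝ := min (1 / 2) (decayRate T / (4 * C)) with hε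
  have hε0 : 0 < ε := by positivity
  have hε1 : ε ≤ 1 / 2 := min_le_left _ _
  have hε2 : ε * (4 * C) ≤ decayRate T := by
    have : ε ≤ decayRate T / (4 * C) := min_le_right _ _
    rwa [le_div_iff₀ (by positivity)] at this
  -- Halving the radius leaves room for Cauchy's estimate on circles of radius ε/4. Since |w| ≤ 2ε
  -- there, |w'| ≤ 2ε/(ε/4) = 8.
  refine ⟨ε / 2, C1 * C2 + 8, by positivity, by linarith, by nlinarith, fun β hβ => ?_⟩
  have hκ := hβ.one_add_sq_ne hT
  have hκn : 2 * decayRate T ≤ ‖1 + β ^ 2‖ := (hβ.one_add_sq_re hT).trans (Complex.re_le_norm _)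
  have hβn := hβ.norm_le
  have hS : ∀ v ∈ Metric.ball (0 : ℂ) ε, ‖phaseQuot β v - 1‖ ≤ 1 / 2 := by
    intro v hv
    have hv' := mem_ball_zero_iff.mp hv
    have hbv := norm_mul_le_of_norm_le_one (v := v) hβn
    have e : phaseQuot β v - 1 = 2 * ((gammaQuot v - 1 / 2) + β ^ 2 * (gammaQuot (β * v) - 1 / 2))
        / (1 + β ^ 2) := by
      rw [phaseQuot]; field_simp; ring
    rw [e, norm_div, div_le_iff₀ (by linarith), norm_mul, Complex.norm_ofNat]
    have a1 := hG v (by linarith)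
    have a2 := hG (β * v) (by linarith)
    have a3 : ‖β ^ 2 * (gammaQuot (β * v) - 1 / 2)‖ ≤ C * ‖v‖ := by
      rw [norm_mul, norm_pow]
      have b1 : ‖β‖ ^ 2 ≤ 1 := pow_le_one₀ (norm_nonneg _) hβn
      have b2 : C * ‖β * v‖ ≤ C * ‖v‖ := by gcongr
      calc _ ≤ 1 * (C * ‖v‖) := mul_le_mul b1 (a2.trans b2) (norm_nonneg _) zero_le_one
        _ = _ := one_mul _
    have a4 := norm_add_le (gammaQuot v - 1 / 2) (β ^ 2 * (gammaQuot (β * v) - 1 / 2))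
    nlinarith
  have hSs : ∀ v ∈ Metric.ball (0 : ℂ) ε, phaseQuot β v ∈ Complex.slitPlane := by
    intro v hv
    have := one_add_mem_slitPlane ((hS v hv).trans_lt (by norm_num))
    simpa using this
  have hGd : DifferentiableOn ℂ (phaseQuot β) (Metric.ball 0 ε) := by
    intro v hv
    have hv' := mem_ball_zero_iff.mp hv
    have hbv := norm_mul_le_of_norm_le_one (v := v) hβn
    have d1 := (analyticAt_gammaQuot (v := v) (by linarith)).differentiableAt
    have d2 := (analyticAt_gammaQuot (v := β * v) (by linarith)).differentiableAt
    have d3 : DifferentiableAt ℂ (fun v => gammaQuot (β * v)) v :=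
      DifferentiableAt.comp (g := gammaQuot) v d2 (by fun_prop)
    apply DifferentiableAt.differentiableWithinAt
    unfold phaseQuot
    fun_prop
  have hH : DifferentiableOn ℂ (coordFactor β) (Metric.ball 0 ε) :=
    fun v hv => (hGd v hv).cpow_const (hSs v hv)
  have hW : DifferentiableOn ℂ (localCoord β) (Metric.ball 0 ε) := differentiableOn_id.mul hH
  have hHn : ∀ v ∈ Metric.ball (0 : ℂ) ε, ‖coordFactor β v‖ ≤ 2 := by
    intro v hv
    have a1 : ‖coordFactor β v‖ ^ 2 ≤ 3 / 2 := by
      rw [← norm_pow, coordFactor_sq]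
      have := norm_add_le (phaseQuot β v - 1) 1
      rw [sub_add_cancel, norm_one] at this
      linarith [hS v hv]
    nlinarith [norm_nonneg (coordFactor β v)]
  have hsub : Metric.ball (0 : ℂ) (ε / 2) ⊆ Metric.ball 0 ε := Metric.ball_subset_ball (by linarith)
  have hWd : ∀ v ∈ Metric.ball (0 : ℂ) ε, HasDerivAt (localCoord β) (deriv (localCoord β) v) v :=
    fun v hv => (hW.differentiableAt (Metric.isOpen_ball.mem_nhds hv)).hasDerivAt
  have hsl : ∀ v ∈ Metric.ball (0 : ℂ) (ε / 2), ‖v‖ ≤ 1 / 2 ∧ ‖β * v‖ ≤ 1 / 2 := by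
    intro v hv
    have hv' := mem_ball_zero_iff.mp hv
    have hbv := norm_mul_le_of_norm_le_one (v := v) hβn
    constructor <;> linarith
  refine ⟨?_, hH.mono hsub, (hW.deriv Metric.isOpen_ball).mono hsub, fun v hv => hWd v (hsub hv),
    ?_, ?_, ?_, ?_⟩
  · intro v hv
    obtain ⟨a1, a2⟩ := hsl v hv
    exact (differentiableAt_centredAmp μ (one_add_mem_slitPlane (by linarith))
      (one_add_mem_slitPlane (by linarith))).differentiableWithinAt
  · have h0 : (0 : ℂ) ∈ Metric.ball (0 : ℂ) ε := Metric.mem_ball_self hε0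
    have hd := (hasDerivAt_id (0 : ℂ)).mul
      (hH.differentiableAt (Metric.isOpen_ball.mem_nhds h0)).hasDerivAt
    have : deriv (localCoord β) 0 = _ := hd.deriv
    rw [this]
    simp [coordFactor_zero hκ]
  · intro v hv
    obtain ⟨a1, a2⟩ := hsl v hv
    rw [centredAmp, norm_mul]
    have := mul_le_mul (h1 v a1) (h2 _ a2) (norm_nonneg _) hC1
    linarith
  · intro v hv
    have := hHn v (hsub hv)
    nlinarith [mul_nonneg hC1 hC2]
  · intro v hv
    have hv' := mem_ball_zero_iff.mp hv
    have hcb : Metric.closedBall v (ε / 4) ⊆ Metric.ball 0 ε := by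
      apply Metric.closedBall_subset_ball'
      rw [dist_zero_right]; linarith
    have := Complex.norm_deriv_le_of_forall_mem_sphere_norm_le (C := ε * 2) (R := ε / 4) (c := v)
      (f := localCoord β) (by positivity) (hW.diffContOnCl_ball hcb) ?_
    · have e : ε * 2 / (ε / 4) = 8 := by field_simp; norm_num
      rw [e] at this
      nlinarith [mul_nonneg hC1 hC2]
    · intro z hz
      have hz' := hcb (Metric.sphere_subset_closedBall hz)
      rw [localCoord, norm_mul]
      exact mul_le_mul (mem_ball_zero_iff.mp hz').le (hHn z hz') (norm_nonneg _) hε0.le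

/-- The coefficients of the amplitude in the local coordinate. -/
def localCoeff (μ β : ℂ) (j : ℕ) : ℂ :=
  remainderFactor (centredAmp μ β) (coordFactor β) (deriv (localCoord β)) j 0

end GenBessel
end

/-! ### The two rays of the contour: growth of the amplitude against decay of the phase. -/

noncomputable section
namespace GenBessel

/-- The integrand of the contour integral for the Bessel polynomial. -/
def contourIntegrand (μ β : ℂ) (ν : ℝ) (v : ℂ) : ℂ :=
  centredAmp μ β v * Complex.exp (-ν * centredPhase β v)

open MeasureTheory in
/-- The integral along the part of a ray from `0` in direction `ω` with parameters in `S`. -/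
def rayIntegral (μ β : ℂ) (ν : ℝ) (ω : ℂ) (S : Set ℝ) : ℂ :=
  ∫ r in S, contourIntegrand μ β ν (ω * r) * ω

/-- The integral over the contour from `-1` to `0` and on to infinity in direction `ρ`. -/
def contourIntegral (μ β ρ : ℂ) (ν : ℝ) : ℂ :=
  rayIntegral μ β ν ρ (Set.Ioi 0) - rayIntegral μ β ν (-1) (Set.Ioo 0 1)

/-- A half of the contour, with quantitative control of phase and amplitude. -/
structure IsDescentRay (d m C : ℝ) (μ β ω : ℂ) (S : Set ℝ) : Prop where
  norm_eq : ‖ω‖ = 1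
  measurableSet : MeasurableSet S
  pos : ∀ r ∈ S, 0 < r
  mem : ∀ r : ℝ, 0 < r → r < 1 → r ∈ S
  slit : ∀ r ∈ S, 1 + ω * r ∈ Complex.slitPlane ∧ 1 + β * (ω * r) ∈ Complex.slitPlane
  phase_le : ∀ r ∈ S, d * (r ^ 2 / (1 + r)) ≤ (centredPhase β (ω * r)).re
  amp_le : ∀ r ∈ S, ‖centredAmp μ β (ω * r)‖ * Real.exp (-m * (centredPhase β (ω * r)).re) ≤ C

lemma norm_cpow_le (z s : ℂ) (hz : z ≠ 0) :
    ‖z ^ s‖ ≤ ‖z‖ ^ s.re * Real.exp (Real.pi * |s.im|) := by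
  rw [Complex.norm_cpow_of_ne_zero hz, div_eq_mul_inv, ← Real.exp_neg]
  gcongr
  have h1 : |z.arg * s.im| ≤ Real.pi * |s.im| := by
    rw [abs_mul]; gcongr; exact Complex.abs_arg_le_pi z
  linarith [neg_abs_le (z.arg * s.im)]

/-- A fixed part e^(-mψ) of the exponential absorbs the amplitude. On this ray |1+v| ≤ e^r, so the
amplitude grows at most like e^((‖μ‖+1)r), while Re ψ ≥ d(r-1); hence the condition on md. The
factor with 1+βv has modulus at most 1 because Re(1+βv) ≥ 1. -/
lemma exists_isDescentRay_right {T : ℝ} (hT : 0 ≤ T) (μ : ℂ) {m : ℝ}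
    (hm : ‖μ‖ + 1 ≤ m * decayRate T) : ∃ C : ℝ, ∀ β ρ, Admissible T β → IsDescentDir T β ρ →
      IsDescentRay (decayRate T) m C μ β ρ (Set.Ioi 0) := by
  have hd := decayRate_pos hT
  have hm0 : 0 < m := by
    by_contra h
    have := mul_nonpos_of_nonpos_of_nonneg (not_lt.mp h) hd.le
    linarith [norm_nonneg μ]
  refine ⟨Real.exp (Real.pi * |μ.im|) * Real.exp (m * decayRate T), fun β ρ hβ hρ => ?_⟩
  have hre : ∀ r : ℝ, 0 < r → 1 ≤ (1 + ρ * r).re ∧ 1 ≤ (1 + β * (ρ * r)).re := by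
    intro r hr
    rw [← mul_assoc, hρ.mul_eq]
    have := hρ.re_pos
    constructor
    · simp; positivity
    · rw [mul_assoc, Complex.add_re, Complex.re_ofReal_mul, Complex.re_mul_ofReal]
      simp; positivity
  refine ⟨hρ.norm_eq, measurableSet_Ioi, fun r hr => hr, fun r hr _ => hr, ?_, ?_, ?_⟩
  · intro r hr
    obtain ⟨h1, h2⟩ := hre r hr
    exact ⟨Or.inl (by linarith), Or.inl (by linarith)⟩
  · intro r hr
    exact hρ.le_re_centredPhase hT (le_of_lt hr)
  · intro r hr
    have hr0 : 0 < r := hr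
    obtain ⟨h1, h2⟩ := hre r hr
    have hph := hρ.le_re_centredPhase hT hr0.le
    have n1 : 1 ≤ ‖1 + ρ * r‖ := h1.trans (Complex.re_le_norm _)
    have n2 : 1 ≤ ‖1 + β * (ρ * r)‖ := h2.trans (Complex.re_le_norm _)
    have n3 : ‖1 + ρ * r‖ ≤ Real.exp r := by
      have := norm_add_le 1 (ρ * r)
      rw [norm_one, norm_mul, hρ.norm_eq, one_mul, Complex.norm_real, Real.norm_of_nonneg hr0.le] at this
      linarith [Real.add_one_le_exp r]
    have a1 : ‖(1 + ρ * r) ^ (μ - 1 / 2)‖ ≤ Real.exp ((‖μ‖ + 1) * r) * Real.exp (Real.pi * |μ.im|) := by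
      refine (norm_cpow_le _ _ (norm_pos_iff.mp (by linarith))).trans ?_
      have e : (μ - 1 / 2).im = μ.im := by norm_num
      rw [e]
      gcongr
      calc ‖1 + ρ * r‖ ^ (μ - 1 / 2).re ≤ ‖1 + ρ * r‖ ^ (‖μ‖ + 1) := by
            apply Real.rpow_le_rpow_of_exponent_le n1
            have := Complex.re_le_norm μ
            norm_num; linarith
        _ ≤ Real.exp r ^ (‖μ‖ + 1) := by gcongr
        _ = _ := by rw [← Real.exp_mul, mul_comm]
    have a2 : ‖(1 + β * (ρ * r)) ^ (-1 / 2 : ℂ)‖ ≤ 1 := by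
      refine (norm_cpow_le _ _ (norm_pos_iff.mp (by linarith))).trans ?_
      have : ‖1 + β * (ρ * r)‖ ^ (-1 / 2 : ℂ).re ≤ 1 := Real.rpow_le_one_of_one_le_of_nonpos n2 (by norm_num)
      simpa using this
    have a3 : Real.exp (-m * (centredPhase β (ρ * r)).re) ≤ Real.exp (-(‖μ‖ + 1) * r + m * decayRate T) := by
      apply Real.exp_le_exp.mpr
      have e1 : r - 1 ≤ r ^ 2 / (1 + r) := by
        rw [le_div_iff₀ (by linarith)]; nlinarith
      have e2 : decayRate T * (r - 1) ≤ (centredPhase β (ρ * r)).re :=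
        (mul_le_mul_of_nonneg_left e1 hd.le).trans hph
      nlinarith [mul_le_mul_of_nonneg_left e2 hm0.le, mul_le_mul_of_nonneg_right hm hr0.le]
    rw [centredAmp, norm_mul]
    calc _ ≤ (Real.exp ((‖μ‖ + 1) * r) * Real.exp (Real.pi * |μ.im|)) * 1
            * Real.exp (-(‖μ‖ + 1) * r + m * decayRate T) := by gcongr
      _ = Real.exp (Real.pi * |μ.im|) * Real.exp (m * decayRate T) *
          (Real.exp ((‖μ‖ + 1) * r) * Real.exp (-(‖μ‖ + 1) * r)) := by rw [Real.exp_add]; ring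
      _ = _ := by rw [neg_mul, Real.exp_neg, mul_inv_cancel₀ (Real.exp_ne_zero _), mul_one]

/-- The danger is the endpoint v = -1, where the amplitude may blow up like (1-r)^(-‖μ‖-1): the
first factor contributes ‖μ‖+1/2, and the second contributes 1/2 since |1-βr| ≥ 1-r. The logarithm
in the phase gives e^(-m Re ψ) ≤ const·(1-r)^m, which compensates when m ≥ ‖μ‖+1. -/
lemma exists_isDescentRay_left {T : ℝ} (hT : 0 ≤ T) (μ : ℂ) {m : ℝ} (hm : ‖μ‖ + 1 ≤ m) :
    ∃ C : ℝ, ∀ β, Admissible T β → IsDescentRay (decayRate T) m C μ β (-1) (Set.Ioo 0 1) := by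
  have hm0 : 0 < m := by linarith [norm_nonneg μ]
  refine ⟨Real.exp (Real.pi * |μ.im|) * Real.exp (m * (2 + Real.log 2)), fun β hβ => ?_⟩
  have hv : ∀ r : ℝ, (-1 : ℂ) * r = -r := fun r => by ring
  have hbr : ∀ r : ℝ, 0 < r → ‖β * (-r : ℂ)‖ ≤ r := by
    intro r hr
    refine (norm_mul_le_of_norm_le_one hβ.norm_le).trans ?_
    rw [norm_neg, Complex.norm_real, Real.norm_of_nonneg hr.le]
  refine ⟨by simp, measurableSet_Ioo, fun r hr => hr.1, fun r h1 h2 => ⟨h1, h2⟩, ?_, ?_, ?_⟩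
  · intro r hr
    rw [hv]
    refine ⟨one_add_mem_slitPlane ?_, one_add_mem_slitPlane ((hbr r hr.1).trans_lt hr.2)⟩
    rw [norm_neg, Complex.norm_real, Real.norm_of_nonneg hr.1.le]; exact hr.2
  · intro r hr
    rw [hv]
    exact hβ.le_re_centredPhase_neg hT hr.1.le hr.2
  · intro r hr
    have hr0 : 0 < r := hr.1
    have hr1 : 0 < 1 - r := sub_pos.mpr hr.2
    rw [hv]
    set L := Real.log (1 - r) with hL
    have hL0 : L ≤ 0 := Real.log_nonpos hr1.le (by linarith)
    have hexp : 1 - r = Real.exp L := (Real.exp_log hr1).symm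
    have n0 : ‖(1 : ℂ) + -r‖ = 1 - r := by
      rw [← sub_eq_add_neg, ← Complex.ofReal_one, ← Complex.ofReal_sub, Complex.norm_real,
        Real.norm_of_nonneg hr1.le]
    have n1 : 1 - r ≤ ‖1 + β * (-r : ℂ)‖ := by
      have := norm_sub_norm_le 1 (-(β * (-r : ℂ)))
      rw [norm_one, norm_neg, sub_neg_eq_add] at this
      linarith [hbr r hr0]
    have n2 : ‖1 + β * (-r : ℂ)‖ ≤ 2 := by
      have := norm_add_le 1 (β * (-r : ℂ))
      rw [norm_one] at this
      linarith [hbr r hr0]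
    have a1 : ‖(1 + (-r : ℂ)) ^ (μ - 1 / 2)‖ ≤ Real.exp (-(‖μ‖ + 1 / 2) * L) * Real.exp (Real.pi * |μ.im|) := by
      refine (norm_cpow_le _ _ (norm_pos_iff.mp (by linarith))).trans ?_
      have e : (μ - 1 / 2).im = μ.im := by norm_num
      rw [e, n0, hexp, ← Real.exp_mul]
      refine mul_le_mul_of_nonneg_right (Real.exp_le_exp.mpr ?_) (Real.exp_pos _).le
      have := (abs_le.mp (Complex.abs_re_le_norm μ)).1
      have e2 : (μ - 1 / 2).re = μ.re - 1 / 2 := by norm_num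
      rw [e2]
      nlinarith
    have a2 : ‖(1 + β * (-r : ℂ)) ^ (-1 / 2 : ℂ)‖ ≤ Real.exp (-(1 / 2) * L) := by
      refine (norm_cpow_le _ _ (norm_pos_iff.mp (by linarith))).trans ?_
      have : ‖1 + β * (-r : ℂ)‖ ^ (-1 / 2 : ℂ).re ≤ (1 - r) ^ (-1 / 2 : ℂ).re :=
        Real.rpow_le_rpow_of_nonpos hr1 n1 (by norm_num)
      rw [hexp, ← Real.exp_mul] at this
      have e3 : L * (-1 / 2 : ℂ).re = -(1 / 2) * L := by norm_num; ring
      rw [e3] at this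
      simpa using this
    have a3 : Real.exp (-m * (centredPhase β (-r)).re) ≤ Real.exp (m * (2 + Real.log 2) + m * L) := by
      apply Real.exp_le_exp.mpr
      have e1 : (centredPhase β (-r)).re = -r - L + ((β * (-r : ℂ)).re - Real.log ‖1 + β * (-r : ℂ)‖) := by
        rw [centredPhase, gammaPhase, gammaPhase, Complex.add_re, Complex.sub_re, Complex.sub_re,
          Complex.log_re, Complex.log_re, n0, Complex.neg_re, Complex.ofReal_re]
      have e2 : -r ≤ (β * (-r : ℂ)).re := by
        have := (abs_le.mp (Complex.abs_re_le_norm (β * (-r : ℂ)))).1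
        linarith [hbr r hr0]
      have e3 : Real.log ‖1 + β * (-r : ℂ)‖ ≤ Real.log 2 := Real.log_le_log (by linarith) n2
      have e4 : -(2 + Real.log 2) - L ≤ (centredPhase β (-r)).re := by
        rw [e1]; linarith [hr.2]
      nlinarith
    rw [centredAmp, norm_mul]
    calc _ ≤ (Real.exp (-(‖μ‖ + 1 / 2) * L) * Real.exp (Real.pi * |μ.im|)) * Real.exp (-(1 / 2) * L)
            * Real.exp (m * (2 + Real.log 2) + m * L) := by gcongr
      _ = Real.exp (Real.pi * |μ.im|) * Real.exp (m * (2 + Real.log 2)) *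
          (Real.exp (-(‖μ‖ + 1 / 2) * L) * Real.exp (-(1 / 2) * L) * Real.exp (m * L)) := by
            rw [Real.exp_add]; ring
      _ ≤ _ := by
        apply mul_le_of_le_one_right (by positivity)
        rw [← Real.exp_add, ← Real.exp_add]
        apply Real.exp_le_one_iff.mpr
        nlinarith

lemma IsDescentRay.mono {d m C C' : ℝ} {μ β ω : ℂ} {S : Set ℝ} (h : IsDescentRay d m C μ β ω S)
    (hC : C ≤ C') : IsDescentRay d m C' μ β ω S :=
  { h with amp_le := fun r hr => (h.amp_le r hr).trans hC }

lemma norm_exp_neg_mul (ν : ℝ) (z : ℂ) : ‖Complex.exp (-ν * z)‖ = Real.exp (-ν * z.re) := by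
  rw [Complex.norm_exp, ← Complex.ofReal_neg, Complex.re_ofReal_mul]

lemma IsDescentRay.norm_integrand_le {d m C : ℝ} {μ β ω : ℂ} {S : Set ℝ}
    (h : IsDescentRay d m C μ β ω S) {ν : ℝ} (hν : m ≤ ν) {r : ℝ} (hr : r ∈ S) :
    ‖contourIntegrand μ β ν (ω * r) * ω‖ ≤ C * Real.exp (-(ν - m) * (d * (r ^ 2 / (1 + r)))) := by
  rw [norm_mul, h.norm_eq, mul_one, contourIntegrand, norm_mul, norm_exp_neg_mul]
  have e : Real.exp (-ν * (centredPhase β (ω * r)).re)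
      = Real.exp (-m * (centredPhase β (ω * r)).re) * Real.exp (-(ν - m) * (centredPhase β (ω * r)).re) := by
    rw [← Real.exp_add]; ring_nf
  rw [e, ← mul_assoc]
  have h1 := h.amp_le r hr
  have h2 : 0 ≤ C := le_trans (by positivity) h1
  refine mul_le_mul h1 (Real.exp_le_exp.mpr ?_) (Real.exp_pos _).le h2
  have h3 := mul_le_mul_of_nonneg_left (h.phase_le r hr) (sub_nonneg.mpr hν)
  linarith

lemma IsDescentRay.continuousOn {d m C : ℝ} {μ β ω : ℂ} {S : Set ℝ}
    (h : IsDescentRay d m C μ β ω S) (ν : ℝ) :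
    ContinuousOn (fun r : ℝ => contourIntegrand μ β ν (ω * r) * ω) S := by
  intro r hr
  obtain ⟨h1, h2⟩ := h.slit r hr
  have d1 := (differentiableAt_centredAmp μ h1 h2).continuousAt
  have d2 : ContinuousAt (centredPhase β) (ω * r) := by
    have e1 := (hasDerivAt_gammaPhase h1).continuousAt
    have e2 : ContinuousAt (fun v => gammaPhase (β * v)) (ω * r) :=
      ContinuousAt.comp (g := gammaPhase) (hasDerivAt_gammaPhase h2).continuousAt (by fun_prop)
    exact e1.add e2
  have d3 : ContinuousAt (contourIntegrand μ β ν) (ω * r) :=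
    d1.mul ((continuousAt_const.mul d2).cexp)
  apply ContinuousAt.continuousWithinAt
  exact (ContinuousAt.comp (g := contourIntegrand μ β ν) (f := fun r : ℝ => ω * r) d3 (by fun_prop)).mul
    continuousAt_const

end GenBessel
end

/-! ### Laplace's method on a single ray, uniformly in the parameters. -/

noncomputable section
namespace GenBessel

/-- Exponential decay beats any power. -/
lemma exists_exp_neg_le {c : ℝ} (hc : 0 < c) (K : ℕ) : ∃ C : ℝ, 0 ≤ C ∧ ∀ ν : ℝ, 1 ≤ ν →
    Real.exp (-(c * ν)) ≤ C * ν ^ (-(K + 1 / 2) : ℝ) := by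
  refine ⟨(K + 1).factorial / c ^ (K + 1), by positivity, fun ν hν => ?_⟩
  have h1 := Real.pow_div_factorial_le_exp (c * ν) (by positivity) (K + 1)
  have h2 : ν ^ (-(K + 1 : ℕ) : ℝ) ≤ ν ^ (-(K + 1 / 2) : ℝ) := by
    apply Real.rpow_le_rpow_of_exponent_le hν
    push_cast; linarith
  rw [Real.exp_neg]
  calc (Real.exp (c * ν))⁻¹ ≤ ((c * ν) ^ (K + 1) / (K + 1).factorial)⁻¹ :=
        inv_anti₀ (by positivity) h1
    _ = (K + 1).factorial / c ^ (K + 1) * ν ^ (-(K + 1 : ℕ) : ℝ) := by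
        rw [Real.rpow_neg (by positivity), Real.rpow_natCast, mul_pow, inv_div]
        field_simp
    _ ≤ _ := by gcongr

open MeasureTheory Set

lemma integrableOn_pow_mul_gauss {b : ℝ} (hb : 0 < b) (n : ℕ) :
    IntegrableOn (fun r : ℝ => r ^ n * Real.exp (-b * r ^ 2)) (Ioi 0) := by
  have := integrableOn_rpow_mul_exp_neg_mul_sq hb (s := n) (by
    have : (0 : ℝ) ≤ n := n.cast_nonneg
    linarith)
  simpa using this

lemma integral_pow_mul_gauss {b : ℝ} (hb : 0 < b) (K : ℕ) :
    ∫ r in Ioi (0 : ℝ), r ^ (2 * K) * Real.exp (-b * r ^ 2)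
      = b ^ (-(K + 1 / 2) : ℝ) * (1 / 2 * Real.Gamma (K + 1 / 2)) := by
  have h := integral_rpow_mul_exp_neg_mul_rpow (p := 2) (q := (2 * K : ℕ)) (b := b) (by norm_num)
    (by have : (0 : ℝ) ≤ (2 * K : ℕ) := Nat.cast_nonneg _
        linarith) hb
  simp only [Real.rpow_natCast, Real.rpow_two] at h
  rw [h, mul_assoc]
  congr 2
  · push_cast; ring
  · congr 1; push_cast; ring_nf

/-- The local expansion of a ray integral, uniformly in all parameters. -/
lemma exists_norm_rayIntegral_sub_le {d m C ε M : ℝ} (hd : 0 < d) (hm : 0 ≤ m) (hε : 0 < ε)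
    (hε2 : ε ≤ 1 / 2) (K : ℕ) :
    ∃ B N : ℝ, ∀ (μ β ω : ℂ) (S : Set ℝ), 1 + β ^ 2 ≠ 0 → LocalBounds μ ε M β →
      IsDescentRay d m C μ β ω S → ∀ ν : ℝ, N ≤ ν →
      ‖rayIntegral μ β ν ω S - ∑ j ∈ Finset.range (2 * K), localCoeff μ β j *
        (localCoord β (ω * ↑(ε / 2)) ^ (j + 1) *
          truncMoment j (ν * centredPhase β (ω * ↑(ε / 2))))‖ ≤ B * ν ^ (-(K + 1 / 2) : ℝ) := by
  set e : ℝ := ε / 2 with he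
  have he0 : 0 < e := by positivity
  have he1 : e < 1 := by rw [he]; linarith
  -- For r > e one has r²/(1+r) ≥ r·e/(1+e), so beyond e the phase grows at least linearly with
  -- slope d'.
  set d' : ℝ := d * (e / (1 + e)) with hd'
  have hd'0 : 0 < d' := by positivity
  obtain ⟨B1, hB1, hexp⟩ := exists_exp_neg_le (c := d' * e / 2) (by positivity) K
  set G : ℝ := |remainderBound M ε (2 * K)| * ((d / 2) ^ (-(K + 1 / 2) : ℝ) * (1 / 2 * Real.Gamma (K + 1 / 2)))
    with hG
  -- The first constant bounds the local remainder and the second the tail. The threshold 2m+1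
  -- ensures ν - m ≥ ν/2 after m has been spent on the amplitude.
  refine ⟨G + |C| * (2 / d' * B1), 2 * m + 1, fun μ β ω S hκ hloc hray ν hν => ?_⟩
  have hν1 : 1 ≤ ν := by linarith
  have hνm : m ≤ ν := by linarith
  have hνm2 : ν / 2 ≤ ν - m := by linarith
  set f : ℝ → ℂ := fun r => contourIntegrand μ β ν (ω * r) * ω with hf
  have hsubS : Ioc 0 e ⊆ S := fun r hr => hray.mem r hr.1 (hr.2.trans_lt he1)
  have hC0 : ∀ r ∈ S, 0 ≤ C := fun r hr => le_trans (by positivity) (hray.amp_le r hr)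
  have hS : S = Ioc 0 e ∪ S \ Ioc 0 e := (union_sdiff_cancel hsubS).symm
  have hmeasT : MeasurableSet (S \ Ioc 0 e) := hray.measurableSet.diff measurableSet_Ioc
  -- the tail
  have htail_sub : S \ Ioc 0 e ⊆ Ioi e := by
    intro r hr
    by_contra h
    exact hr.2 ⟨hray.pos r hr.1, not_lt.mp h⟩
  have htail_bd : ∀ r ∈ S \ Ioc 0 e, ‖f r‖ ≤ |C| * Real.exp (-(d' * (ν / 2)) * r) := by
    intro r hr
    have hre : e < r := htail_sub hr
    have hr0 : 0 < r := he0.trans hre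
    refine (hray.norm_integrand_le hνm hr.1).trans ?_
    refine mul_le_mul (le_abs_self C) (Real.exp_le_exp.mpr ?_) (Real.exp_pos _).le (abs_nonneg C)
    have h1 : e / (1 + e) * r ≤ r ^ 2 / (1 + r) := by
      rw [div_mul_eq_mul_div, div_le_div_iff₀ (by positivity) (by positivity)]
      nlinarith [mul_pos he0 hr0]
    have h2 : d' * r ≤ d * (r ^ 2 / (1 + r)) := by
      rw [hd', mul_assoc]; gcongr
    have h3 := mul_le_mul hνm2 h2 (by positivity) (by linarith)
    linarith
  have hexp_int : IntegrableOn (fun r => |C| * Real.exp (-(d' * (ν / 2)) * r)) (Ioi e) :=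
    (integrableOn_exp_mul_Ioi (by
      have : 0 < d' * (ν / 2) := by positivity
      linarith) e).const_mul _
  have hfc : ContinuousOn f S := hray.continuousOn ν
  have hftail : IntegrableOn f (S \ Ioc 0 e) := by
    refine Integrable.mono' (hexp_int.mono_set htail_sub)
      ((hfc.mono sdiff_subset).aestronglyMeasurable hmeasT) ?_
    rw [ae_restrict_iff' hmeasT]
    exact ae_of_all _ htail_bd
  have htail : ‖∫ r in S \ Ioc 0 e, f r‖ ≤ |C| * (2 / d' * B1) * ν ^ (-(K + 1 / 2) : ℝ) := by
    calc ‖∫ r in S \ Ioc 0 e, f r‖ ≤ ∫ r in S \ Ioc 0 e, |C| * Real.exp (-(d' * (ν / 2)) * r) := by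
          apply norm_integral_le_of_norm_le (hexp_int.mono_set htail_sub)
          rw [ae_restrict_iff' hmeasT]
          exact ae_of_all _ htail_bd
      _ ≤ ∫ r in Ioi e, |C| * Real.exp (-(d' * (ν / 2)) * r) := by
          apply setIntegral_mono_set hexp_int (ae_of_all _ fun r => by positivity)
          exact htail_sub.eventuallyLE
      _ = |C| * (Real.exp (-(d' * e / 2 * ν)) / (d' * (ν / 2))) := by
          rw [integral_const_mul, integral_exp_mul_Ioi (by
            have : 0 < d' * (ν / 2) := by positivity
            linarith)]
          rw [neg_div_neg_eq]
          congr 3; ring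
      _ ≤ |C| * (2 / d' * (B1 * ν ^ (-(K + 1 / 2) : ℝ))) := by
          have h1 : Real.exp (-(d' * e / 2 * ν)) / (d' * (ν / 2)) ≤ 2 / d' * Real.exp (-(d' * e / 2 * ν)) := by
            rw [div_le_iff₀ (by positivity)]
            have : 2 / d' * Real.exp (-(d' * e / 2 * ν)) * (d' * (ν / 2)) = Real.exp (-(d' * e / 2 * ν)) * ν := by
              field_simp
            rw [this]
            exact le_mul_of_one_le_right (Real.exp_pos _).le hν1
          have h2 := hexp ν hν1
          have h3 : 0 ≤ 2 / d' := by positivity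
          exact mul_le_mul_of_nonneg_left (h1.trans (mul_le_mul_of_nonneg_left h2 h3)) (abs_nonneg C)
      _ = _ := by ring
  -- the local part
  have hmemball : ∀ r ∈ Icc 0 e, ω * (r : ℂ) ∈ Metric.ball (0 : ℂ) ε := by
    intro r hr
    rw [mem_ball_zero_iff, norm_mul, hray.norm_eq, one_mul, Complex.norm_real,
      Real.norm_of_nonneg hr.1]
    rw [he] at hr; linarith [hr.2]
  have hωr : ContinuousOn (fun r : ℝ => ω * (r : ℂ)) (Icc 0 e) := by fun_prop
  have hW'c : ContinuousOn (fun r : ℝ => deriv (localCoord β) (ω * r) * ω) (Icc 0 e) :=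
    (hloc.diff_deriv.continuousOn.comp hωr hmemball).mul continuousOn_const
  have hWd : ∀ r ∈ Icc (0 : ℝ) e, HasDerivAt (fun r : ℝ => localCoord β (ω * r))
      (deriv (localCoord β) (ω * r) * ω) r := by
    intro r hr
    have h3 : HasDerivAt (fun t : ℝ => ω * (t : ℂ)) ω r := by
      simpa using ((hasDerivAt_id (r : ℂ)).const_mul ω).comp_ofReal
    exact (hloc.hasDerivAt _ (hmemball r hr)).comp r h3
  have hWc : ContinuousOn (fun r : ℝ => localCoord β (ω * r)) (Icc 0 e) :=
    fun r hr => (hWd r hr).continuousAt.continuousWithinAt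
  set a : ℂ := ν * ((1 + β ^ 2) / 2) with ha
  have hgauss : ∀ j : ℕ, ∫ r in (0 : ℝ)..e, localCoord β (ω * r) ^ j * (deriv (localCoord β) (ω * r) * ω)
      * Complex.exp (-a * localCoord β (ω * r) ^ 2)
      = localCoord β (ω * e) ^ (j + 1) * truncMoment j (ν * centredPhase β (ω * e)) := by
    intro j
    have := integral_gauss_curve j a he0.le (W := fun r : ℝ => localCoord β (ω * r))
      (W' := fun r : ℝ => deriv (localCoord β) (ω * r) * ω) (by simp [localCoord]) hWd hW'c
    rw [this]
    congr 2
    rw [← localCoord_sq hκ, ha]; ring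
  set R : ℂ → ℂ := remainderFactor (centredAmp μ β) (coordFactor β) (deriv (localCoord β)) (2 * K)
    with hR
  -- The expansion goes to order 2K, odd terms included: these cancel only when both rays are
  -- combined. The remainder carries r^(2K), which against the Gaussian yields ν^(-K-1/2).
  have hdec : ∀ r ∈ Icc (0 : ℝ) e, f r = ∑ j ∈ Finset.range (2 * K), localCoeff μ β j *
      (localCoord β (ω * r) ^ j * (deriv (localCoord β) (ω * r) * ω)
        * Complex.exp (-a * localCoord β (ω * r) ^ 2))
      + (ω * r) ^ (2 * K) * R (ω * r) * Complex.exp (-ν * centredPhase β (ω * r)) * ω := by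
    intro r hr
    have h1 := eq_sum_add_remainder (h := centredAmp μ β) (coordFactor_zero hκ) hloc.deriv_zero
      (2 * K) (ω * r)
    have h2 : -a * localCoord β (ω * r) ^ 2 = -ν * centredPhase β (ω * r) := by
      rw [← localCoord_sq hκ, ha]; ring
    rw [hf]
    simp only [contourIntegrand, h2]
    rw [h1, add_mul, add_mul, Finset.sum_mul, Finset.sum_mul]
    congr 1
    apply Finset.sum_congr rfl
    intro j _
    rw [localCoeff, localCoord]; ring
  have hsum_int : ∀ j ∈ Finset.range (2 * K), IntervalIntegrable (fun r : ℝ => localCoeff μ β j *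
      (localCoord β (ω * r) ^ j * (deriv (localCoord β) (ω * r) * ω)
        * Complex.exp (-a * localCoord β (ω * r) ^ 2))) volume 0 e := by
    intro j _
    apply ContinuousOn.intervalIntegrable
    rw [uIcc_of_le he0.le]
    fun_prop
  have hRc : ContinuousOn (fun r : ℝ => R (ω * r)) (Icc 0 e) :=
    (differentiableOn_remainderFactor hε hloc.diff_amp hloc.diff_factor hloc.diff_deriv
      (2 * K)).continuousOn.comp hωr hmemball
  have hremc : ContinuousOn (fun r : ℝ => (ω * r) ^ (2 * K) * R (ω * r)
      * Complex.exp (-ν * centredPhase β (ω * r)) * ω) (Icc 0 e) := by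
    have : ContinuousOn (fun r : ℝ => centredPhase β (ω * r)) (Icc 0 e) := by
      simp_rw [← localCoord_sq hκ]
      fun_prop
    exact (((hωr.pow _).mul hRc).mul (continuousOn_const.mul this).cexp).mul continuousOn_const
  have hrem_int : IntervalIntegrable (fun r : ℝ => (ω * r) ^ (2 * K) * R (ω * r)
      * Complex.exp (-ν * centredPhase β (ω * r)) * ω) volume 0 e := by
    apply ContinuousOn.intervalIntegrable
    rwa [uIcc_of_le he0.le]
  have hsum_int' : IntervalIntegrable (fun r : ℝ => ∑ j ∈ Finset.range (2 * K), localCoeff μ β j *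
      (localCoord β (ω * r) ^ j * (deriv (localCoord β) (ω * r) * ω)
        * Complex.exp (-a * localCoord β (ω * r) ^ 2))) volume 0 e := by
    have := IntervalIntegrable.sum _ hsum_int
    rwa [Finset.sum_fn] at this
  have hloc_eq : ∫ r in (0 : ℝ)..e, f r = ∑ j ∈ Finset.range (2 * K), localCoeff μ β j *
        (localCoord β (ω * e) ^ (j + 1) * truncMoment j (ν * centredPhase β (ω * e)))
      + ∫ r in (0 : ℝ)..e, (ω * r) ^ (2 * K) * R (ω * r)
          * Complex.exp (-ν * centredPhase β (ω * r)) * ω := by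
    rw [intervalIntegral.integral_congr (g := fun r : ℝ => ∑ j ∈ Finset.range (2 * K), localCoeff μ β j *
      (localCoord β (ω * r) ^ j * (deriv (localCoord β) (ω * r) * ω)
        * Complex.exp (-a * localCoord β (ω * r) ^ 2))
      + (ω * r) ^ (2 * K) * R (ω * r) * Complex.exp (-ν * centredPhase β (ω * r)) * ω)
      (fun r hr => hdec r (by rwa [uIcc_of_le he0.le] at hr)),
      intervalIntegral.integral_add hsum_int' hrem_int,
      intervalIntegral.integral_finsetSum hsum_int]
    congr 1
    apply Finset.sum_congr rfl
    intro j _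
    rw [intervalIntegral.integral_const_mul, hgauss]
  have hrem : ‖∫ r in (0 : ℝ)..e, (ω * r) ^ (2 * K) * R (ω * r)
      * Complex.exp (-ν * centredPhase β (ω * r)) * ω‖ ≤ G * ν ^ (-(K + 1 / 2) : ℝ) := by
    have hb : 0 < d / 2 * ν := by positivity
    rw [intervalIntegral.integral_of_le he0.le]
    have hgi := (integrableOn_pow_mul_gauss hb (2 * K)).const_mul |remainderBound M ε (2 * K)|
    calc _ ≤ ∫ r in Ioc 0 e, |remainderBound M ε (2 * K)| * (r ^ (2 * K) * Real.exp (-(d / 2 * ν) * r ^ 2)) := by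
          apply norm_integral_le_of_norm_le
          · exact hgi.mono_measure (Measure.restrict_mono Ioc_subset_Ioi_self le_rfl)
          · rw [ae_restrict_iff' measurableSet_Ioc]
            refine ae_of_all _ fun r hr => ?_
            have hb := norm_remainderFactor_le hε (coordFactor_zero hκ) hloc.deriv_zero hloc.diff_amp
              hloc.diff_factor hloc.diff_deriv hloc.amp_le hloc.factor_le hloc.deriv_le (2 * K) _
              (hmemball r ⟨hr.1.le, hr.2⟩)
            rw [norm_mul, norm_mul, norm_mul, norm_pow, norm_mul, hray.norm_eq, one_mul, mul_one,
              Complex.norm_real, Real.norm_of_nonneg hr.1.le, norm_exp_neg_mul, mul_comm (r ^ (2 * K)),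
              mul_assoc]
            have h1 := hray.phase_le r (hsubS hr)
            -- On the local part r ≤ e < 1, so the phase bound is genuinely quadratic.
            have h2 : r ^ 2 / 2 ≤ r ^ 2 / (1 + r) := by
              have := hr.2; have := hr.1
              gcongr; linarith
            have h3 : Real.exp (-ν * (centredPhase β (ω * r)).re) ≤ Real.exp (-(d / 2 * ν) * r ^ 2) := by
              apply Real.exp_le_exp.mpr
              have h4 : d * (r ^ 2 / 2) ≤ (centredPhase β (ω * r)).re :=
                (mul_le_mul_of_nonneg_left h2 hd.le).trans h1
              nlinarith
            have := hr.1
            exact mul_le_mul (hb.trans (le_abs_self _)) (mul_le_mul_of_nonneg_left h3 (by positivity))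
              (by positivity) (abs_nonneg _)
      _ ≤ ∫ r in Ioi 0, |remainderBound M ε (2 * K)| * (r ^ (2 * K) * Real.exp (-(d / 2 * ν) * r ^ 2)) := by
          apply setIntegral_mono_set hgi
          · rw [Filter.EventuallyLE, ae_restrict_iff' measurableSet_Ioi]
            refine ae_of_all _ fun r hr => ?_
            have : 0 < r := hr
            simp only [Pi.zero_apply]; positivity
          · exact Ioc_subset_Ioi_self.eventuallyLE
      _ = G * ν ^ (-(K + 1 / 2) : ℝ) := by
          rw [integral_const_mul, integral_pow_mul_gauss hb, Real.mul_rpow (by positivity) (by positivity), hG]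
          ring
  have hfloc : IntegrableOn f (Ioc 0 e) := by
    have h1 : IntervalIntegrable f volume 0 e := by
      refine IntervalIntegrable.congr ?_ (hsum_int'.add hrem_int)
      intro r hr
      rw [uIoc_of_le he0.le] at hr
      rw [hdec r ⟨hr.1.le, hr.2⟩]
    rwa [intervalIntegrable_iff_integrableOn_Ioc_of_le he0.le] at h1
  have htot : rayIntegral μ β ν ω S = (∫ r in (0 : ℝ)..e, f r) + ∫ r in S \ Ioc 0 e, f r := by
    rw [intervalIntegral.integral_of_le he0.le,
      ← setIntegral_union disjoint_sdiff_right hmeasT hfloc hftail, ← hS]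
    rfl
  rw [htot, hloc_eq, add_assoc, add_sub_cancel_left]
  refine (norm_add_le _ _).trans ?_
  rw [add_mul]
  exact add_le_add hrem htail

end GenBessel
end

/-! ### Branches of square roots and the sum of the Gaussian contributions. -/

noncomputable section
namespace GenBessel

/-- The square root of the second derivative of the phase. -/
def hessRoot (β : ℂ) : ℂ := (1 + β ^ 2) ^ (1 / 2 : ℂ)

lemma hessRoot_sq (β : ℂ) : hessRoot β ^ 2 = 1 + β ^ 2 := by
  rw [hessRoot, ← Complex.cpow_nat_mul]; norm_num

lemma cpow_half_re_pos {z : ℂ} (hz : z ∈ Complex.slitPlane) : 0 < (z ^ (1 / 2 : ℂ)).re := by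
  rw [Complex.cpow_def_of_ne_zero (Complex.slitPlane_ne_zero hz), Complex.exp_re]
  apply mul_pos (Real.exp_pos _)
  apply Real.cos_pos_of_mem_Ioo
  have : (Complex.log z * (1 / 2)).im = z.arg / 2 := by
    rw [← Complex.log_im]
    simp [Complex.mul_im]; ring
  rw [this]
  have h1 := Complex.neg_pi_lt_arg z
  have h2 := Complex.arg_le_pi z
  have h3 := Complex.slitPlane_arg_ne_pi hz
  constructor
  · linarith
  · have := lt_of_le_of_ne h2 h3; linarith

lemma cpow_half_of_sq_eq {u z : ℂ} (hu : 0 < u.re) (h : u ^ 2 = z) : z ^ (1 / 2 : ℂ) = u := by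
  rw [← h, one_div]
  exact Complex.sq_cpow_two_inv hu

/-- Both arguments are smaller than π/4 in modulus, so their sum is smaller than π/2. This is what
identifies products of principal roots. -/
lemma re_mul_pos_of_sq {p q : ℂ} (hp : 0 < p.re) (hq : 0 < q.re) (hp2 : 0 < (p ^ 2).re)
    (hq2 : 0 < (q ^ 2).re) : 0 < (p * q).re := by
  simp only [pow_two, Complex.mul_re] at *
  have h1 : |p.im| < p.re := abs_lt_of_sq_lt_sq (by nlinarith) hp.le
  have h2 : |q.im| < q.re := abs_lt_of_sq_lt_sq (by nlinarith) hq.le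
  have h3 : p.im * q.im ≤ |p.im| * |q.im| := (le_abs_self _).trans (abs_mul _ _).le
  have h4 : |p.im| * |q.im| < p.re * q.re :=
    mul_lt_mul'' h1 h2 (abs_nonneg _) (abs_nonneg _)
  linarith

lemma Admissible.hessRoot_re_pos {T : ℝ} (hT : 0 ≤ T) {β : ℂ} (h : Admissible T β) :
    0 < (hessRoot β).re :=
  cpow_half_re_pos (Or.inl (by linarith [h.one_add_sq_re hT, decayRate_pos hT]))

lemma Admissible.norm_hessRoot_le {T : ℝ} {β : ℂ} (h : Admissible T β) : ‖hessRoot β‖ ≤ 2 := by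
  have h1 : ‖hessRoot β‖ ^ 2 ≤ 2 := by
    rw [← norm_pow, hessRoot_sq]
    refine (norm_add_le _ _).trans ?_
    rw [norm_one, norm_pow]
    nlinarith [pow_le_one₀ (n := 2) (norm_nonneg β) h.norm_le]
  nlinarith [norm_nonneg (hessRoot β)]

/-- Along a descent ray the coordinate stays in the half plane in which it starts. -/
lemma localCoord_re_pos {μ β ω q : ℂ} {d m C ε M : ℝ} {S : Set ℝ} (hd : 0 < d)
    (hε : 0 < ε) (hε2 : ε ≤ 1 / 2) (hκ : 1 + β ^ 2 ≠ 0)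
    (hloc : LocalBounds μ ε M β) (hray : IsDescentRay d m C μ β ω S) (hq2 : q ^ 2 = 1 + β ^ 2)
    (hq : 0 < (q * ω).re) : 0 < (q * localCoord β (ω * ↑(ε / 2))).re := by
  set F : ℝ → ℝ := fun r => (q * ω * coordFactor β (ω * r)).re with hF
  have hF0 : 0 < F 0 := by simpa [hF, coordFactor_zero hκ] using hq
  have hmem : ∀ r ∈ Set.Icc (0 : ℝ) (ε / 2), ω * (r : ℂ) ∈ Metric.ball (0 : ℂ) ε := by
    intro r hr
    rw [mem_ball_zero_iff, norm_mul, hray.norm_eq, one_mul, Complex.norm_real,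
      Real.norm_of_nonneg hr.1]
    linarith [hr.2]
  have hc : ContinuousOn F (Set.Icc 0 (ε / 2)) := by
    have : ContinuousOn (fun r : ℝ => coordFactor β (ω * r)) (Set.Icc 0 (ε / 2)) :=
      hloc.diff_factor.continuousOn.comp (by fun_prop) hmem
    exact Complex.continuous_re.comp_continuousOn (continuousOn_const.mul this)
  have hsq : ∀ r : ℝ, (q * ω * coordFactor β (ω * r) * r) ^ 2 = 2 * centredPhase β (ω * r) := by
    intro r
    rw [← localCoord_sq hκ, localCoord, ← hq2]; ring
  -- If the real part vanished at some r > 0, the square of q·w would have nonpositive real part;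
  -- but this square is 2ψ, whose real part is positive on a descent ray. Continuity then keeps the
  -- sign it has at 0.
  have hne : ∀ r ∈ Set.Icc (0 : ℝ) (ε / 2), F r ≠ 0 := by
    intro r hr h0
    rcases eq_or_lt_of_le hr.1 with h | h
    · rw [← h] at h0; exact hF0.ne' h0
    · have h1 := hray.phase_le r (hray.mem r h (by linarith [hr.2]))
      have h2 : 0 < d * (r ^ 2 / (1 + r)) := by positivity
      have h3 := congrArg Complex.re (hsq r)
      have h4 : (q * ω * coordFactor β (ω * r) * r).re = 0 := by
        rw [Complex.re_mul_ofReal]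
        simp only [hF] at h0
        rw [h0, zero_mul]
      rw [pow_two, Complex.mul_re, h4] at h3
      simp at h3
      nlinarith [mul_self_nonneg (q * ω * coordFactor β (ω * r) * r).im]
  have hpos : 0 < F (ε / 2) := by
    by_contra h
    obtain ⟨r, hr, h0⟩ := intermediate_value_Icc' (by positivity) hc ⟨not_lt.mp h, hF0.le⟩
    exact hne r hr h0
  have e : q * localCoord β (ω * ↑(ε / 2)) = q * ω * coordFactor β (ω * ↑(ε / 2)) * ↑(ε / 2) := by
    rw [localCoord]; ring
  rw [e, Complex.re_mul_ofReal]
  exact mul_pos hpos (by positivity)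

/-- The hypothesis Re(qy) > 0 selects the branch: the principal root of π/b is √(2π/ν)/(qy). All
powers of y then cancel, so the result does not depend on where the ray was cut. -/
lemma pow_mul_gaussMoment_even {ν : ℝ} (hν : 0 < ν) {q y : ℂ} (hy : 0 < (q * y).re) (k : ℕ) :
    y ^ (2 * k + 1) * gaussMoment (2 * k) (ν * (q ^ 2 / 2 * y ^ 2)) =
      (ascPochhammer ℂ k).eval (1 / 2 : ℂ) * (2 ^ k / (q ^ 2) ^ k) / ν ^ k
        * (Real.sqrt (2 * Real.pi / ν) / (2 * q)) := by
  have hqy : q * y ≠ 0 := fun h => by simp [h] at hy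
  have hq : q ≠ 0 := left_ne_zero_of_mul hqy
  have hy0 : y ≠ 0 := right_ne_zero_of_mul hqy
  have hν0 : (ν : ℂ) ≠ 0 := by exact_mod_cast hν.ne'
  have hroot : (Real.pi / (ν * (q ^ 2 / 2 * y ^ 2)) : ℂ) ^ (1 / 2 : ℂ)
      = Real.sqrt (2 * Real.pi / ν) / (q * y) := by
    apply cpow_half_of_sq_eq
    · rw [div_eq_mul_inv, Complex.re_ofReal_mul, Complex.inv_re]
      have := Complex.normSq_pos.mpr hqy
      have : 0 < 2 * Real.pi / ν := by positivity
      positivity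
    · rw [div_pow, ← Complex.ofReal_pow, Real.sq_sqrt (by positivity)]
      push_cast
      field_simp
  have hpow : ((ν : ℂ) * (q ^ 2 / 2 * y ^ 2)) ^ k = ν ^ k * (q ^ 2) ^ k * y ^ (2 * k) / 2 ^ k := by
    rw [mul_pow, mul_pow, div_pow, pow_mul y]; ring
  rw [gaussMoment_even, hroot, hpow]
  field_simp
  ring

/-- No square root occurs, so the value is the same for both rays and drops out of their difference.
-/
lemma pow_mul_gaussMoment_odd (ν : ℝ) {κ y : ℂ} (hy : y ≠ 0) (k : ℕ) :
    y ^ (2 * k + 1 + 1) * gaussMoment (2 * k + 1) (ν * (κ / 2 * y ^ 2)) =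
      k.factorial / (2 * (ν * (κ / 2)) ^ (k + 1)) := by
  rw [gaussMoment_odd, ← mul_assoc (ν : ℂ), mul_pow _ (y ^ 2), ← pow_mul]
  rw [show 2 * k + 1 + 1 = 2 * (k + 1) by ring]
  have : y ^ (2 * (k + 1)) ≠ 0 := pow_ne_zero _ hy
  rw [← mul_assoc 2, ← div_div, mul_div_assoc', mul_comm (y ^ _), mul_div_assoc, div_self this, mul_one]

lemma sum_range_two_mul {E : Type*} [AddCommMonoid E] (f : ℕ → E) (K : ℕ) :
    ∑ j ∈ Finset.range (2 * K), f j = ∑ k ∈ Finset.range K, (f (2 * k) + f (2 * k + 1)) := by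
  induction K with
  | zero => simp
  | succ K ih =>
    rw [show 2 * (K + 1) = 2 * K + 1 + 1 by ring, Finset.sum_range_succ, Finset.sum_range_succ, ih,
      Finset.sum_range_succ, add_assoc]

/-- The coefficients of the expansion of the normalized contour integral. -/
def saddleCoeff (μ β : ℂ) (k : ℕ) : ℂ :=
  (ascPochhammer ℂ k).eval (1 / 2 : ℂ) * (2 ^ k / (1 + β ^ 2) ^ k) * localCoeff μ β (2 * k)

/-- The Gaussian contributions of the two halves of the contour add up for even order, cancel for odd. -/
lemma sum_gaussMoment_sub {ν : ℝ} (hν : 0 < ν) {μ β q y y' : ℂ} (hq : q ^ 2 = 1 + β ^ 2)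
    (hy : 0 < (q * y).re) (hy' : 0 < (-q * y').re) (K : ℕ) :
    ∑ j ∈ Finset.range (2 * K), localCoeff μ β j *
      (y ^ (j + 1) * gaussMoment j (ν * ((1 + β ^ 2) / 2 * y ^ 2))
        - y' ^ (j + 1) * gaussMoment j (ν * ((1 + β ^ 2) / 2 * y' ^ 2)))
      = (∑ k ∈ Finset.range K, saddleCoeff μ β k / ν ^ k) * (Real.sqrt (2 * Real.pi / ν) / q) := by
  have hy0 : y ≠ 0 := fun h => by simp [h] at hy
  have hy0' : y' ≠ 0 := fun h => by simp [h] at hy'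
  have hq0 : q ≠ 0 := fun h => by simp [h] at hy
  rw [sum_range_two_mul, Finset.sum_mul]
  apply Finset.sum_congr rfl
  intro k _
  have h1 := pow_mul_gaussMoment_even hν hy k
  -- On the left ray it is -y' that lies on the correct side. The odd exponent 2k+1 turns this into
  -- a sign, which makes the even terms of the two rays add.
  have h2 := pow_mul_gaussMoment_even hν (q := q) (y := -y') (by simpa using hy') k
  rw [neg_sq, Odd.neg_pow ⟨k, rfl⟩, neg_mul] at h2
  have h3 := neg_eq_iff_eq_neg.mp h2
  rw [pow_mul_gaussMoment_odd ν hy0, pow_mul_gaussMoment_odd ν hy0', sub_self, mul_zero, add_zero,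
    ← hq, h1, h3, saddleCoeff, ← hq]
  field_simp
  ring

end GenBessel
end

/-! ### The uniform Laplace expansion of the contour integral. -/

noncomputable section
namespace GenBessel

/-- The local coefficients are bounded uniformly over the parameter domain. -/
lemma LocalBounds.norm_localCoeff_le {μ β : ℂ} {ε M : ℝ} (hε : 0 < ε) (hκ : 1 + β ^ 2 ≠ 0)
    (h : LocalBounds μ ε M β) (j : ℕ) : ‖localCoeff μ β j‖ ≤ remainderBound M ε j :=
  norm_remainderFactor_le hε (coordFactor_zero hκ) h.deriv_zero h.diff_amp
    h.diff_factor h.diff_deriv h.amp_le h.factor_le h.deriv_le j 0 (Metric.mem_ball_self hε)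

lemma exists_norm_saddleCoeff_le {T : ℝ} (hT : 0 ≤ T) (μ : ℂ) (k : ℕ) :
    ∃ C : ℝ, ∀ β, Admissible T β → ‖saddleCoeff μ β k‖ ≤ C := by
  obtain ⟨ε, M, hε, -, -, hloc⟩ := exists_localBounds hT μ
  have hd := decayRate_pos hT
  refine ⟨‖(ascPochhammer ℂ k).eval (1 / 2 : ℂ)‖ * (2 ^ k / (2 * decayRate T) ^ k)
    * remainderBound M ε (2 * k), fun β hβ => ?_⟩
  have h1 : 2 * decayRate T ≤ ‖1 + β ^ 2‖ := (hβ.one_add_sq_re hT).trans (Complex.re_le_norm _)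
  rw [saddleCoeff, norm_mul, norm_mul, norm_div, norm_pow, norm_pow, Complex.norm_ofNat]
  have h2 := (hloc β hβ).norm_localCoeff_le hε (hβ.one_add_sq_ne hT) (2 * k)
  gcongr

/-- The Laplace expansion of the contour integral, uniformly over the parameter domain. -/
theorem exists_norm_contourIntegral_sub_le {T : ℝ} (hT : 0 ≤ T) (μ : ℂ) (K : ℕ) :
    ∃ C N : ℝ, ∀ β ρ, Admissible T β → IsDescentDir T β ρ → ∀ ν : ℝ, N ≤ ν →
      ‖contourIntegral μ β ρ ν * (Real.sqrt (ν / (2 * Real.pi)) * hessRoot β)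
        - ∑ k ∈ Finset.range K, saddleCoeff μ β k / ν ^ k‖ ≤ C / ν ^ K := by
  obtain ⟨ε, M, hε, hε2, hM, hloc⟩ := exists_localBounds hT μ
  have hd := decayRate_pos hT
  set d := decayRate T with hd_def
  -- The two summands serve the left ray (m ≥ ‖μ‖+1) and the right ray (md ≥ ‖μ‖+1).
  set m : ℝ := ‖μ‖ + 1 + (‖μ‖ + 1) / d with hm
  have hm1 : ‖μ‖ + 1 ≤ m := by rw [hm]; have : 0 ≤ (‖μ‖ + 1) / d := by positivity
                               linarith
  have hm2 : ‖μ‖ + 1 ≤ m * d := by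
    rw [hm, add_mul, div_mul_cancel₀ _ hd.ne']
    have : 0 ≤ (‖μ‖ + 1) * d := by positivity
    linarith
  have hm0 : 0 ≤ m := by linarith [norm_nonneg μ]
  obtain ⟨C1, hC1⟩ := exists_isDescentRay_right hT μ hm2
  obtain ⟨C2, hC2⟩ := exists_isDescentRay_left hT μ hm1
  set C := max C1 C2
  obtain ⟨B, N, hB⟩ := exists_norm_rayIntegral_sub_le (C := C) (M := M) hd hm0 hε hε2 K
  choose D hD0 hD using exists_norm_truncMoment_sub_le
  set e : ℝ := ε / 2 with he
  have he0 : 0 < e := by positivity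
  have he1 : e ≤ 1 := by rw [he]; linarith
  set c : ℝ := d * (e ^ 2 / (1 + e)) with hc
  have hc0 : 0 < c := by positivity
  obtain ⟨B1, hB1, hexp⟩ := exists_exp_neg_le hc0 K
  set E : ℝ := ∑ j ∈ Finset.range (2 * K), |remainderBound M ε j| * (M ^ (j + 1) * (D j * B1)) with hE
  -- B and E bound the local error and the truncation of the moments on each of the two rays; the
  -- outer 2 bounds `hessRoot`. The condition ν ≥ 1/c makes the real part of the Gaussian rate at
  -- least 1.
  refine ⟨2 * (2 * B + 2 * E), max N (max 1 (1 / c)), fun β ρ hβ hρ ν hν => ?_⟩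
  have hνN : N ≤ ν := (le_max_left _ _).trans hν
  have hν1 : 1 ≤ ν := ((le_max_left _ _).trans (le_max_right _ _)).trans hν
  have hνc : 1 ≤ c * ν := by
    have : 1 / c ≤ ν := ((le_max_right _ _).trans (le_max_right _ _)).trans hν
    rw [div_le_iff₀ hc0] at this; linarith
  have hν0 : 0 < ν := by linarith
  have hκ := hβ.one_add_sq_ne hT
  have hl := hloc β hβ
  have rayR := (hC1 β ρ hβ hρ).mono (le_max_left C1 C2)
  have rayL := (hC2 β hβ).mono (le_max_right C1 C2)
  have hR := hB μ β ρ _ hκ hl rayR ν hνN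
  have hL := hB μ β (-1) _ hκ hl rayL ν hνN
  set P : ℝ := ν ^ (-(K + 1 / 2) : ℝ) with hP
  have hP0 : 0 < P := by positivity
  set q := hessRoot β with hq
  have hq2 : q ^ 2 = 1 + β ^ 2 := hessRoot_sq β
  have hqre : 0 < q.re := hβ.hessRoot_re_pos hT
  have hyR : 0 < (q * localCoord β (ρ * ↑e)).re := by
    apply localCoord_re_pos hd hε hε2 hκ hl rayR hq2
    refine re_mul_pos_of_sq hqre hρ.re_pos ?_ ?_
    · rw [hq2]; linarith [hβ.one_add_sq_re hT]
    · linarith [hρ.sq_re]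
  have hyL : 0 < (-q * localCoord β (-1 * ↑e)).re := by
    apply localCoord_re_pos hd hε hε2 hκ hl rayL
    · rw [neg_sq, hq2]
    · simpa using hqre
  have hmain := sum_gaussMoment_sub (μ := μ) hν0 hq2 hyR hyL K
  -- replacing truncated by complete Gaussian moments on one ray
  have hcut : ∀ (ω : ℂ) (S : Set ℝ), IsDescentRay d m C μ β ω S →
      ‖∑ j ∈ Finset.range (2 * K), localCoeff μ β j *
        (localCoord β (ω * ↑e) ^ (j + 1) * truncMoment j (ν * centredPhase β (ω * ↑e)))
        - ∑ j ∈ Finset.range (2 * K), localCoeff μ β j *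
        (localCoord β (ω * ↑e) ^ (j + 1) *
          gaussMoment j (ν * ((1 + β ^ 2) / 2 * localCoord β (ω * ↑e) ^ 2)))‖ ≤ E * P := by
    intro ω S hray
    rw [localCoord_sq hκ, ← Finset.sum_sub_distrib, hE, Finset.sum_mul]
    refine norm_sum_le_of_le _ fun j _ => ?_
    have hmem : ω * (e : ℂ) ∈ Metric.ball (0 : ℂ) ε := by
      rw [mem_ball_zero_iff, norm_mul, hray.norm_eq, one_mul, Complex.norm_real,
        Real.norm_of_nonneg he0.le]
      rw [he]; linarith
    have hy : ‖localCoord β (ω * ↑e)‖ ≤ M := by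
      rw [localCoord, norm_mul, norm_mul, hray.norm_eq, one_mul, Complex.norm_real,
        Real.norm_of_nonneg he0.le]
      have := hl.factor_le _ hmem
      calc _ ≤ 1 * M := mul_le_mul he1 this (norm_nonneg _) zero_le_one
        _ = M := one_mul M
    have hph := hray.phase_le e (hray.mem e he0 (by rw [he]; linarith))
    have hre : c * ν ≤ (ν * centredPhase β (ω * ↑e)).re := by
      rw [Complex.re_ofReal_mul, mul_comm]
      exact mul_le_mul_of_nonneg_left hph hν0.le
    have hd1 : ‖truncMoment j (ν * centredPhase β (ω * ↑e)) - gaussMoment j (ν * centredPhase β (ω * ↑e))‖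
        ≤ D j * (B1 * P) := by
      refine (hD j _ (hνc.trans hre)).trans (mul_le_mul_of_nonneg_left ?_ (hD0 j))
      exact (Real.exp_le_exp.mpr (neg_le_neg hre)).trans (hexp ν hν1)
    rw [← mul_sub, ← mul_sub, norm_mul, norm_mul, norm_pow]
    have hcf := (hl.norm_localCoeff_le hε hκ j).trans (le_abs_self _)
    have : 0 ≤ D j := hD0 j
    calc _ ≤ |remainderBound M ε j| * (M ^ (j + 1) * (D j * (B1 * P))) := by gcongr
      _ = _ := by ring
  have hJ : ‖contourIntegral μ β ρ ν
      - (∑ k ∈ Finset.range K, saddleCoeff μ β k / ν ^ k) * (Real.sqrt (2 * Real.pi / ν) / q)‖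
      ≤ (2 * B + 2 * E) * P := by
    rw [← hmain]
    simp_rw [mul_sub]
    rw [Finset.sum_sub_distrib, contourIntegral]
    have h1 := hcut ρ _ rayR
    have h2 := hcut (-1) _ rayL
    rw [norm_sub_rev] at hL h2
    have := norm_add_le_of_le (norm_add_le_of_le hR h1) (norm_add_le_of_le hL h2)
    refine le_trans (le_of_eq ?_) (this.trans (le_of_eq ?_))
    · congr 1; ring
    · ring
  have hq0 : q ≠ 0 := fun h => by simp [h] at hqre
  have hsq : Real.sqrt (2 * Real.pi / ν) * Real.sqrt (ν / (2 * Real.pi)) = 1 := by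
    rw [← Real.sqrt_mul (by positivity), div_mul_div_cancel₀ (by positivity), div_self (by positivity),
      Real.sqrt_one]
  have hsqc : (Real.sqrt (2 * Real.pi / ν) : ℂ) * Real.sqrt (ν / (2 * Real.pi)) = 1 := by
    exact_mod_cast hsq
  have hfac : ∀ X : ℂ, contourIntegral μ β ρ ν * (Real.sqrt (ν / (2 * Real.pi)) * q) - X
      = (contourIntegral μ β ρ ν - X * (Real.sqrt (2 * Real.pi / ν) / q))
        * (Real.sqrt (ν / (2 * Real.pi)) * q) := by
    intro X
    field_simp
    linear_combination X * hsqc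
  rw [hfac, norm_mul, norm_mul, Complex.norm_real, Real.norm_of_nonneg (Real.sqrt_nonneg _)]
  have hs : Real.sqrt (ν / (2 * Real.pi)) ≤ ν ^ (1 / 2 : ℝ) := by
    rw [← Real.sqrt_eq_rpow]
    apply Real.sqrt_le_sqrt
    apply div_le_self hν0.le
    linarith [Real.pi_gt_three]
  -- The half power lost to the normalization by √ν is the one gained in the error ν^(-K-1/2).
  have hPK : P * ν ^ (1 / 2 : ℝ) = 1 / ν ^ K := by
    rw [hP, ← Real.rpow_add hν0, show (-(K + 1 / 2) + 1 / 2 : ℝ) = -K by ring,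
      Real.rpow_neg hν0.le, Real.rpow_natCast, one_div]
  have hBE : 0 ≤ 2 * B + 2 * E := by
    by_contra h
    exact absurd ((norm_nonneg _).trans hJ) (not_le.mpr (mul_neg_of_neg_of_pos (not_le.mp h) hP0))
  calc _ ≤ ((2 * B + 2 * E) * P) * (ν ^ (1 / 2 : ℝ) * 2) := by
        gcongr
        exact hβ.norm_hessRoot_le
    _ = 2 * (2 * B + 2 * E) * (P * ν ^ (1 / 2 : ℝ)) := by ring
    _ = _ := by rw [hPK, mul_one_div]

end GenBessel
end

/-! ### The Gamma integral with complex rate along the bent contour. -/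

noncomputable section
namespace GenBessel

open MeasureTheory Set

/-- Half of the exponential rate absorbs the power. The constant is uniform in the direction q, as
is needed on the chord joining two rays. -/
lemma exists_norm_cpow_mul_exp_le (a c : ℂ) {c₀ : ℝ} (hc₀ : 0 < c₀) :
    ∃ C : ℝ, ∀ q : ℂ, 0 ≤ q.re → ‖q‖ ≤ 1 → c₀ ≤ (c * q).re → ∀ r : ℝ, 0 ≤ r →
      ‖(1 + q * r) ^ a * Complex.exp (-c * (1 + q * r))‖ ≤ C * Real.exp (-(c₀ / 2) * r) := by
  set n := ⌈|a.re|⌉₊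
  set δ := c₀ / 2 with hδ
  have hδ0 : 0 < δ := by positivity
  refine ⟨n.factorial / δ ^ n * Real.exp δ * Real.exp (Real.pi * |a.im|) * Real.exp (-c.re),
    fun q hq hq1 hcq r hr => ?_⟩
  have h1 : 1 ≤ ‖1 + q * r‖ := by
    refine le_trans ?_ (Complex.re_le_norm _)
    rw [Complex.add_re, Complex.re_mul_ofReal, Complex.one_re]
    have := mul_nonneg hq hr
    linarith
  have h2 : ‖1 + q * r‖ ≤ 1 + r := by
    refine (norm_add_le _ _).trans ?_
    rw [norm_one, norm_mul, Complex.norm_real, Real.norm_of_nonneg hr]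
    nlinarith
  have h3 : ‖1 + q * r‖ ^ a.re ≤ n.factorial / δ ^ n * Real.exp (δ * (1 + r)) := by
    calc ‖1 + q * r‖ ^ a.re ≤ ‖1 + q * r‖ ^ (n : ℝ) :=
          Real.rpow_le_rpow_of_exponent_le h1 ((le_abs_self _).trans (Nat.le_ceil _))
      _ ≤ (1 + r) ^ (n : ℝ) := by gcongr
      _ ≤ _ := by
        rw [Real.rpow_natCast, div_mul_eq_mul_div, le_div_iff₀ (by positivity)]
        have := Real.pow_div_factorial_le_exp (δ * (1 + r)) (by positivity) n
        rw [div_le_iff₀ (by positivity), mul_pow] at this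
        linarith
  have h4 := norm_cpow_le (1 + q * r) a (norm_pos_iff.mp (by linarith))
  have h5 : ‖Complex.exp (-c * (1 + q * r))‖ ≤ Real.exp (-c.re) * Real.exp (-c₀ * r) := by
    rw [Complex.norm_exp, ← Real.exp_add]
    apply Real.exp_le_exp.mpr
    have : (-c * (1 + q * r)).re = -c.re - (c * q).re * r := by
      rw [← Complex.re_mul_ofReal, ← Complex.neg_re, ← Complex.sub_re]; ring_nf
    rw [this]
    nlinarith
  rw [norm_mul]
  calc _ ≤ ((n.factorial / δ ^ n * Real.exp (δ * (1 + r))) * Real.exp (Real.pi * |a.im|))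
        * (Real.exp (-c.re) * Real.exp (-c₀ * r)) := by
        refine mul_le_mul (h4.trans ?_) h5 (norm_nonneg _) (by positivity)
        gcongr
    _ = n.factorial / δ ^ n * Real.exp (Real.pi * |a.im|) * Real.exp (-c.re)
        * (Real.exp (δ * (1 + r)) * Real.exp (-c₀ * r)) := by ring
    _ = n.factorial / δ ^ n * Real.exp (Real.pi * |a.im|) * Real.exp (-c.re)
        * (Real.exp δ * Real.exp (-δ * r)) := by
        rw [← Real.exp_add, ← Real.exp_add]; congr 2; rw [hδ]; ring
    _ = _ := by ring

lemma one_add_mul_re_pos {q : ℂ} (hq : 0 ≤ q.re) {r : ℝ} (hr : 0 ≤ r) : 1 ≤ (1 + q * r).re := by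
  rw [Complex.add_re, Complex.re_mul_ofReal, Complex.one_re]
  linarith [mul_nonneg hq hr]

lemma differentiableAt_cpow_mul_exp (a c : ℂ) {u : ℂ} (hu : 0 < u.re) :
    DifferentiableAt ℂ (fun u => u ^ a * Complex.exp (-c * u)) u :=
  (differentiableAt_id.cpow_const (Or.inl hu)).mul (by fun_prop)

lemma continuousOn_ray_cpow_mul_exp (a c : ℂ) {q : ℂ} (hq : 0 ≤ q.re) :
    ContinuousOn (fun r : ℝ => (1 + q * r) ^ a * Complex.exp (-c * (1 + q * r))) (Ici 0) := by
  intro r hr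
  apply ContinuousAt.continuousWithinAt
  have := (differentiableAt_cpow_mul_exp a c
    (lt_of_lt_of_le one_pos (one_add_mul_re_pos hq hr))).continuousAt
  exact ContinuousAt.comp (g := fun u : ℂ => u ^ a * Complex.exp (-c * u))
    (f := fun r : ℝ => 1 + q * (r : ℂ)) this (by fun_prop)

lemma integrableOn_ray_cpow_mul_exp (a : ℂ) {c q : ℂ} (hq : 0 ≤ q.re) (hq1 : ‖q‖ ≤ 1)
    (hcq : 0 < (c * q).re) :
    IntegrableOn (fun r : ℝ => (1 + q * r) ^ a * Complex.exp (-c * (1 + q * r))) (Ioi 0) := by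
  obtain ⟨C, hC⟩ := exists_norm_cpow_mul_exp_le a c hcq
  refine Integrable.mono' ((integrableOn_exp_mul_Ioi (by linarith : -((c * q).re / 2) < 0) 0).const_mul C)
    (((continuousOn_ray_cpow_mul_exp a c hq).mono Ioi_subset_Ici_self).aestronglyMeasurable
      measurableSet_Ioi) ?_
  rw [ae_restrict_iff' measurableSet_Ioi]
  exact ae_of_all _ fun r hr => hC q hq hq1 le_rfl r (le_of_lt hr)

/-- Rotation of a ray of integration about `1`. -/
lemma integral_ray_eq (a : ℂ) {c ρ : ℂ} (hc : 0 < c.re) (hρ : 0 ≤ ρ.re) (hρ1 : ‖ρ‖ ≤ 1)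
    (hcρ : 0 < (c * ρ).re) :
    ∫ r in Ioi (0 : ℝ), (1 + ρ * r) ^ a * Complex.exp (-c * (1 + ρ * r)) * ρ
      = ∫ r in Ioi (0 : ℝ), (1 + (1 : ℂ) * r) ^ a * Complex.exp (-c * (1 + (1 : ℂ) * r)) := by
  set F : ℂ → ℂ := fun u => u ^ a * Complex.exp (-c * u) with hF
  set c₀ := min c.re (c * ρ).re with hc₀
  have hc₀0 : 0 < c₀ := lt_min hc hcρ
  obtain ⟨C, hC⟩ := exists_norm_cpow_mul_exp_le a c hc₀0
  have i1 := (integrableOn_ray_cpow_mul_exp a hρ hρ1 hcρ).mul_const ρ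
  have i2 := integrableOn_ray_cpow_mul_exp a (c := c) (q := 1) (by simp) (by simp) (by simpa using hc)
  have t1 := intervalIntegral_tendsto_integral_Ioi 0 i1 tendsto_id
  have t2 := intervalIntegral_tendsto_integral_Ioi 0 i2 tendsto_id
  have t3 : Tendsto (fun R : ℝ => ‖C‖ * (2 * (R * Real.exp (-(c₀ / 2) * R)))) atTop (𝓝 (‖C‖ * (2 * 0))) := by
    apply Tendsto.const_mul
    apply Tendsto.const_mul
    have := tendsto_rpow_mul_exp_neg_mul_atTop_nhds_zero 1 (c₀ / 2) (by positivity)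
    simpa using this
  rw [mul_zero, mul_zero] at t3
  have key : Tendsto (fun R : ℝ => (∫ r in (0 : ℝ)..R, (1 + ρ * r) ^ a * Complex.exp (-c * (1 + ρ * r)) * ρ)
      - ∫ r in (0 : ℝ)..R, (1 + (1 : ℂ) * r) ^ a * Complex.exp (-c * (1 + (1 : ℂ) * r))) atTop (𝓝 0) := by
    refine squeeze_zero_norm' ?_ t3
    filter_upwards [eventually_gt_atTop 0] with R hR
    -- A disc so large and so placed contains both rays up to R and the chord between their ends,
    -- yet stays in Re u > 1/4. The integrand therefore has a primitive on a set containing the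
    -- whole triangle.
    set L : ℝ := (1 + R) ^ 2 with hL
    have hball : ∀ u : ℂ, 1 ≤ u.re → ‖u‖ ≤ 1 + R → u ∈ Metric.ball (L : ℂ) (L - 1 / 4) := by
      intro u hu hun
      rw [mem_ball_iff_norm]
      apply lt_of_pow_lt_pow_left₀ 2 (by rw [hL]; nlinarith)
      have h1 : ‖u - L‖ ^ 2 = ‖u‖ ^ 2 - 2 * L * u.re + L ^ 2 := by
        rw [Complex.sq_norm, Complex.sq_norm, Complex.normSq_apply, Complex.normSq_apply]
        simp; ring
      rw [h1]
      have h2 : ‖u‖ ^ 2 ≤ L := pow_le_pow_left₀ (norm_nonneg u) hun 2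
      nlinarith [mul_le_mul_of_nonneg_left hu (by positivity : 0 ≤ L)]
    have hdiff : DifferentiableOn ℂ F (Metric.ball (L : ℂ) (L - 1 / 4)) := by
      intro u hu
      apply DifferentiableAt.differentiableWithinAt
      apply differentiableAt_cpow_mul_exp
      rw [mem_ball_iff_norm] at hu
      have := (Complex.abs_re_le_norm (u - L)).trans_lt hu
      rw [Complex.sub_re, Complex.ofReal_re, abs_lt] at this
      linarith [this.1]
    obtain ⟨P, hP⟩ := hdiff.isExactOn_ball
    have hray : ∀ q : ℂ, 0 ≤ q.re → ‖q‖ ≤ 1 → ∫ r in (0 : ℝ)..R, F (1 + q * r) * q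
        = P (1 + q * R) - P 1 := by
      intro q hq hq1
      have := intervalIntegral.integral_eq_sub_of_hasDerivAt (a := 0) (b := R)
        (f := fun r : ℝ => P (1 + q * r)) (f' := fun r : ℝ => F (1 + q * r) * q) ?_ ?_
      · rw [this]; simp
      · intro r hr
        rw [uIcc_of_le hR.le] at hr
        have h3 : HasDerivAt (fun t : ℝ => 1 + q * (t : ℂ)) q r := by
          simpa using (((hasDerivAt_id (r : ℂ)).const_mul q).const_add 1).comp_ofReal
        refine (hP _ (hball _ (one_add_mul_re_pos hq hr.1) ?_)).comp r h3
        refine (norm_add_le _ _).trans ?_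
        rw [norm_one, norm_mul, Complex.norm_real, Real.norm_of_nonneg hr.1]
        nlinarith [hr.1, hr.2, norm_nonneg q]
      · apply ContinuousOn.intervalIntegrable
        rw [uIcc_of_le hR.le]
        exact ((continuousOn_ray_cpow_mul_exp a c hq).mono Icc_subset_Ici_self).mul continuousOn_const
    have e1 := hray ρ hρ hρ1
    have e2 := hray 1 (by simp) (by simp)
    have hq : ∀ s ∈ Icc (0 : ℝ) 1, 0 ≤ (1 + s * (ρ - 1)).re ∧ ‖1 + s * (ρ - 1)‖ ≤ 1
        ∧ c₀ ≤ (c * (1 + s * (ρ - 1))).re := by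
      intro s hs
      have es : (1 : ℂ) + s * (ρ - 1) = ((1 - s : ℝ) : ℂ) + (s : ℝ) * ρ := by push_cast; ring
      rw [es]
      refine ⟨?_, ?_, ?_⟩
      · rw [Complex.add_re, Complex.ofReal_re, Complex.re_ofReal_mul]
        nlinarith [hs.1, hs.2, mul_nonneg hs.1 hρ]
      · refine (norm_add_le _ _).trans ?_
        rw [norm_mul, Complex.norm_real, Complex.norm_real, Real.norm_of_nonneg hs.1,
          Real.norm_of_nonneg (by linarith [hs.2])]
        nlinarith [hs.1]
      · have : c * (((1 - s : ℝ) : ℂ) + (s : ℝ) * ρ) = ((1 - s : ℝ) : ℂ) * c + (s : ℝ) * (c * ρ) := by ring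
        rw [this, Complex.add_re, Complex.re_ofReal_mul, Complex.re_ofReal_mul]
        have h1 : c₀ ≤ c.re := min_le_left _ _
        have h2 : c₀ ≤ (c * ρ).re := min_le_right _ _
        nlinarith [mul_le_mul_of_nonneg_left h1 (sub_nonneg.mpr hs.2), mul_le_mul_of_nonneg_left h2 hs.1]
    -- The difference of the two truncated integrals is the integral over the chord, of length at
    -- most 2R, where the integrand is O(e^(-c₀R/2)).
    have e3 : P (1 + ρ * R) - P (1 + 1 * R)
        = ∫ s in (0 : ℝ)..1, F (1 + (1 + s * (ρ - 1)) * R) * ((ρ - 1) * R) := by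
      have := intervalIntegral.integral_eq_sub_of_hasDerivAt (a := 0) (b := 1)
        (f := fun s : ℝ => P (1 + (1 + s * (ρ - 1)) * R))
        (f' := fun s : ℝ => F (1 + (1 + s * (ρ - 1)) * R) * ((ρ - 1) * R)) ?_ ?_
      · rw [this]; simp
      · intro s hs
        rw [uIcc_of_le zero_le_one] at hs
        obtain ⟨q1, q2, -⟩ := hq s hs
        have h3 : HasDerivAt (fun s : ℝ => 1 + (1 + (s : ℂ) * (ρ - 1)) * R) ((ρ - 1) * R) s := by
          simpa using (((((hasDerivAt_id (s : ℂ)).mul_const (ρ - 1)).const_add 1).mul_const (R : ℂ)).const_add 1).comp_ofReal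
        refine (hP _ (hball _ (one_add_mul_re_pos q1 hR.le) ?_)).comp s h3
        refine (norm_add_le _ _).trans ?_
        rw [norm_one, norm_mul, Complex.norm_real, Real.norm_of_nonneg hR.le]
        nlinarith
      · apply ContinuousOn.intervalIntegrable
        rw [uIcc_of_le zero_le_one]
        intro s hs
        obtain ⟨q1, q2, -⟩ := hq s hs
        apply ContinuousAt.continuousWithinAt
        have := (differentiableAt_cpow_mul_exp a c
          (lt_of_lt_of_le one_pos (one_add_mul_re_pos q1 hR.le))).continuousAt
        exact (ContinuousAt.comp (g := F) (f := fun s : ℝ => 1 + (1 + (s : ℂ) * (ρ - 1)) * R)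
          this (by fun_prop)).mul continuousAt_const
    have e4 : (∫ r in (0 : ℝ)..R, (1 + ρ * r) ^ a * Complex.exp (-c * (1 + ρ * r)) * ρ)
      - (∫ r in (0 : ℝ)..R, (1 + (1 : ℂ) * r) ^ a * Complex.exp (-c * (1 + (1 : ℂ) * r)))
      = P (1 + ρ * R) - P (1 + 1 * R) := by
      simp only [mul_one] at e2
      simp only [hF] at e1 e2
      rw [e1, e2]; ring
    rw [e4, e3]
    have := intervalIntegral.norm_integral_le_of_norm_le_const (a := 0) (b := 1)
      (f := fun s : ℝ => F (1 + (1 + s * (ρ - 1)) * R) * ((ρ - 1) * R))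
      (C := ‖C‖ * (2 * (R * Real.exp (-(c₀ / 2) * R)))) ?_
    · simpa using this
    · intro s hs
      rw [uIoc_of_le zero_le_one] at hs
      obtain ⟨q1, q2, q3⟩ := hq s ⟨hs.1.le, hs.2⟩
      have hb := hC _ q1 q2 q3 R hR.le
      have hρ2 : ‖ρ - 1‖ ≤ 2 := (norm_sub_le _ _).trans (by rw [norm_one]; linarith)
      have hρR : ‖(ρ - 1) * (R : ℂ)‖ ≤ 2 * R := by
        rw [norm_mul, Complex.norm_real, Real.norm_of_nonneg hR.le]; gcongr
      rw [norm_mul (F _)]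
      calc _ ≤ (‖C‖ * Real.exp (-(c₀ / 2) * R)) * (2 * R) := by
            refine mul_le_mul (hb.trans ?_) hρR (by positivity) (by positivity)
            gcongr
            exact Real.le_norm_self C
        _ = _ := by ring
  have t4 := t1.sub t2
  exact sub_eq_zero.mp (tendsto_nhds_unique t4 key)

lemma norm_cpow_mul_exp_eq (s c : ℂ) {t : ℝ} (ht : 0 < t) :
    ‖(t : ℂ) ^ s * Complex.exp (-c * t)‖ = t ^ s.re * Real.exp (-c.re * t) := by
  rw [norm_mul, Complex.norm_cpow_eq_rpow_re_of_pos ht, Complex.norm_exp, Complex.re_mul_ofReal,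
    Complex.neg_re]

lemma integrableOn_rpow_mul_exp {s b : ℝ} (hs : -1 < s) (hb : 0 < b) :
    IntegrableOn (fun t : ℝ => t ^ s * Real.exp (-b * t)) (Ioi 0) := by
  have := integrableOn_rpow_mul_exp_neg_mul_rpow (p := 1) hs one_pos hb
  simpa using this

lemma aestronglyMeasurable_cpow_mul_exp (s c : ℂ) :
    AEStronglyMeasurable (fun t : ℝ => (t : ℂ) ^ s * Complex.exp (-c * t)) (volume.restrict (Ioi 0)) := by
  refine ContinuousOn.aestronglyMeasurable (fun t ht => ?_) measurableSet_Ioi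
  have ht' : (t : ℂ) ∈ Complex.slitPlane := Or.inl (by simpa using ht)
  apply ContinuousAt.continuousWithinAt
  exact (Complex.continuous_ofReal.continuousAt.cpow continuousAt_const ht').mul (by fun_prop)

lemma integrableOn_cpow_mul_exp {s c : ℂ} (hs : -1 < s.re) (hc : 0 < c.re) :
    IntegrableOn (fun t : ℝ => (t : ℂ) ^ s * Complex.exp (-c * t)) (Ioi 0) := by
  refine Integrable.mono' (integrableOn_rpow_mul_exp hs hc) (aestronglyMeasurable_cpow_mul_exp s c) ?_
  rw [ae_restrict_iff' measurableSet_Ioi]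
  exact ae_of_all _ fun t ht => (norm_cpow_mul_exp_eq s c ht).le

lemma hasDerivAt_laplace_cpow {s c : ℂ} (hs : -1 < s.re) (hc : 0 < c.re) :
    HasDerivAt (fun c : ℂ => ∫ t in Ioi (0 : ℝ), (t : ℂ) ^ s * Complex.exp (-c * t))
      (∫ t in Ioi (0 : ℝ), -((t : ℂ) ^ (s + 1) * Complex.exp (-c * t))) c := by
  have hball : ∀ x ∈ Metric.ball c (c.re / 2), c.re / 2 ≤ x.re := by
    intro x hx
    have := (Complex.abs_re_le_norm (x - c)).trans_lt (mem_ball_iff_norm.mp hx)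
    rw [Complex.sub_re, abs_lt] at this
    linarith [this.1]
  refine (hasDerivAt_integral_of_dominated_loc_of_deriv_le
    (F := fun (c : ℂ) (t : ℝ) => (t : ℂ) ^ s * Complex.exp (-c * t))
    (F' := fun (c : ℂ) (t : ℝ) => -((t : ℂ) ^ (s + 1) * Complex.exp (-c * t)))
    (bound := fun t : ℝ => t ^ (s.re + 1) * Real.exp (-(c.re / 2) * t))
    (Metric.ball_mem_nhds c (half_pos hc)) ?_ (integrableOn_cpow_mul_exp hs hc) ?_ ?_ ?_ ?_).2
  · exact Eventually.of_forall fun x => aestronglyMeasurable_cpow_mul_exp s x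
  · exact (aestronglyMeasurable_cpow_mul_exp (s + 1) c).neg
  · rw [ae_restrict_iff' measurableSet_Ioi]
    refine ae_of_all _ fun t ht x hx => ?_
    have ht' : 0 < t := ht
    rw [norm_neg, norm_cpow_mul_exp_eq _ _ ht', Complex.add_re, Complex.one_re]
    gcongr
    nlinarith [hball x hx]
  · exact integrableOn_rpow_mul_exp (by linarith) (by linarith)
  · rw [ae_restrict_iff' measurableSet_Ioi]
    refine ae_of_all _ fun t ht x hx => ?_
    have ht' : (t : ℂ) ≠ 0 := by exact_mod_cast (ne_of_gt ht)
    have h1 : HasDerivAt (fun x : ℂ => Complex.exp (-x * t)) (-t * Complex.exp (-x * t)) x := by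
      have := (((hasDerivAt_id x).neg).mul_const (t : ℂ)).cexp
      convert! this using 1
      simp; ring
    have := h1.const_mul ((t : ℂ) ^ s)
    convert! this using 1
    rw [Complex.cpow_add _ _ ht', Complex.cpow_one]
    ring

/-- Integration by parts; the boundary term at 0 vanishes because Re(s+1) > 0, although t^s itself
may be unbounded there. -/
lemma mul_laplace_cpow_add_one {s c : ℂ} (hs : -1 < s.re) (hc : 0 < c.re) :
    c * ∫ t in Ioi (0 : ℝ), (t : ℂ) ^ (s + 1) * Complex.exp (-c * t)
      = (s + 1) * ∫ t in Ioi (0 : ℝ), (t : ℂ) ^ s * Complex.exp (-c * t) := by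
  have hs1 : s + 1 ≠ 0 := fun h => by
    have := congrArg Complex.re h
    simp at this; linarith
  have i1 := (integrableOn_cpow_mul_exp hs hc).const_mul (s + 1)
  have i2 := (integrableOn_cpow_mul_exp (s := s + 1) (by simp; linarith) hc).const_mul c
  have hd : ∀ t ∈ Ioi (0 : ℝ), HasDerivAt (fun t : ℝ => (t : ℂ) ^ (s + 1) * Complex.exp (-c * t))
      ((s + 1) * ((t : ℂ) ^ s * Complex.exp (-c * t)) - c * ((t : ℂ) ^ (s + 1) * Complex.exp (-c * t))) t := by
    intro t ht
    have h1 : HasDerivAt (fun t : ℝ => (t : ℂ) ^ (s + 1)) ((s + 1) * (t : ℂ) ^ s) t := by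
      have h2 := ((hasDerivAt_id (t : ℂ)).cpow_const (c := s + 1) (Or.inl (by simpa using ht))).comp_ofReal
      simpa using h2
    have h3 : HasDerivAt (fun t : ℝ => Complex.exp (-c * t)) (-c * Complex.exp (-c * t)) t := by
      have := ((hasDerivAt_id (t : ℂ)).const_mul (-c)).cexp.comp_ofReal
      convert! this using 1
      simp; ring
    have := h1.mul h3
    convert! this using 1
    ring
  have hf0 : ((0 : ℝ) : ℂ) ^ (s + 1) * Complex.exp (-c * (0 : ℝ)) = 0 := by
    rw [Complex.ofReal_zero, Complex.zero_cpow hs1, zero_mul]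
  have hn : ∀ᶠ t : ℝ in 𝓝[≥] (0 : ℝ), ‖(t : ℂ) ^ (s + 1) * Complex.exp (-c * t)‖ ≤ t ^ (s.re + 1) := by
    filter_upwards [self_mem_nhdsWithin] with t ht
    rcases eq_or_lt_of_le (show 0 ≤ t from ht) with h | ht'
    · rw [← h, hf0, norm_zero]; positivity
    rw [norm_cpow_mul_exp_eq _ _ ht', Complex.add_re, Complex.one_re]
    apply mul_le_of_le_one_right (by positivity)
    apply Real.exp_le_one_iff.mpr
    nlinarith
  have l0 : ContinuousWithinAt (fun t : ℝ => (t : ℂ) ^ (s + 1) * Complex.exp (-c * t)) (Ici 0) 0 := by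
    rw [ContinuousWithinAt, hf0]
    refine squeeze_zero_norm' hn ?_
    have : Tendsto (fun t : ℝ => t ^ (s.re + 1)) (𝓝 0) (𝓝 (0 ^ (s.re + 1))) :=
      (Real.continuousAt_rpow_const 0 (s.re + 1) (Or.inr (by linarith))).tendsto
    rw [Real.zero_rpow (by linarith)] at this
    exact this.mono_left nhdsWithin_le_nhds
  have linf : Tendsto (fun t : ℝ => (t : ℂ) ^ (s + 1) * Complex.exp (-c * t)) atTop (𝓝 0) := by
    rw [tendsto_zero_iff_norm_tendsto_zero]
    refine (tendsto_rpow_mul_exp_neg_mul_atTop_nhds_zero (s.re + 1) c.re hc).congr' ?_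
    filter_upwards [eventually_gt_atTop 0] with t ht
    rw [norm_cpow_mul_exp_eq _ _ ht]; simp
  have h := integral_Ioi_of_hasDerivAt_of_tendsto l0 hd (i1.sub i2) linf
  rw [integral_sub i1 i2, integral_const_mul, integral_const_mul, hf0, sub_zero] at h
  exact (sub_eq_zero.mp h).symm

/-- The Laplace transform of a power, for complex rate. -/
lemma cpow_mul_laplace_cpow {s c : ℂ} (hs : -1 < s.re) (hc : 0 < c.re) :
    c ^ (s + 1) * ∫ t in Ioi (0 : ℝ), (t : ℂ) ^ s * Complex.exp (-c * t) = Complex.Gamma (s + 1) := by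
  set G : ℂ → ℂ := fun c => c ^ (s + 1) * ∫ t in Ioi (0 : ℝ), (t : ℂ) ^ s * Complex.exp (-c * t)
    with hG
  have hopen : IsOpen {c : ℂ | 0 < c.re} := isOpen_lt continuous_const Complex.continuous_re
  have hconv : Convex ℝ {c : ℂ | 0 < c.re} := convex_halfSpace_re_gt 0
  -- Differentiating under the integral and integrating by parts shows that G is locally constant.
  -- The half plane is connected, so its value is the one at c = 1, Euler's integral.
  have hGd : ∀ c ∈ {c : ℂ | 0 < c.re}, HasDerivAt G 0 c := by
    intro c hc
    have hc' : 0 < c.re := hc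
    have hc0 : c ≠ 0 := fun h => by simp [h] at hc'
    have h1 := ((hasDerivAt_id c).cpow_const (c := s + 1) (Or.inl hc')).mul (hasDerivAt_laplace_cpow hs hc')
    convert! h1 using 1
    rw [integral_neg]
    have h2 := mul_laplace_cpow_add_one hs hc'
    have h3 : c ^ (s + 1) = c ^ s * c := by rw [Complex.cpow_add _ _ hc0, Complex.cpow_one]
    simp only [id_eq, mul_one, add_sub_cancel_right, h3]
    linear_combination c ^ s * h2
  have h1 : G c = G 1 := by
    apply hopen.is_const_of_deriv_eq_zero hconv.isPreconnected
      (fun x hx => (hGd x hx).differentiableAt.differentiableWithinAt)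
      (fun x hx => (hGd x hx).deriv) hc
    simp
  change G c = _
  rw [h1, hG, Complex.Gamma_eq_integral (by simp; linarith), Complex.GammaIntegral]
  simp only [Complex.one_cpow, one_mul]
  apply setIntegral_congr_fun measurableSet_Ioi
  intro t _
  simp [mul_comm]

/-- The Gamma integral along the bent contour. -/
lemma gamma_contour {a c ρ : ℂ} (ha : -1 < a.re) (hc : 0 < c.re) (hρ : 0 ≤ ρ.re) (hρ1 : ‖ρ‖ ≤ 1)
    (hcρ : 0 < (c * ρ).re) :
    c ^ (a + 1) * ((∫ r in Ioi (0 : ℝ), (1 + ρ * r) ^ a * Complex.exp (-c * (1 + ρ * r)) * ρ)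
      - ∫ r in Ioo (0 : ℝ) 1, (1 + -1 * (r : ℂ)) ^ a * Complex.exp (-c * (1 + -1 * r)) * -1)
      = Complex.Gamma (a + 1) := by
  rw [← cpow_mul_laplace_cpow ha hc, integral_ray_eq a hc hρ hρ1 hcρ]
  congr 1
  have hi := integrableOn_cpow_mul_exp ha hc
  have e0 := setIntegral_union (μ := volume) (Ioc_disjoint_Ioi le_rfl) measurableSet_Ioi
    (hi.mono_set (show Ioc (0 : ℝ) 1 ⊆ Ioi 0 from Ioc_subset_Ioi_self)) (hi.mono_set (Ioi_subset_Ioi zero_le_one))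
  rw [Ioc_union_Ioi_eq_Ioi zero_le_one] at e0
  have e1 : ∫ r in Ioi (0 : ℝ), (1 + (1 : ℂ) * r) ^ a * Complex.exp (-c * (1 + (1 : ℂ) * r))
      = ∫ t in Ioi (1 : ℝ), (t : ℂ) ^ a * Complex.exp (-c * t) := by
    have := (measurePreserving_add_left (volume : Measure ℝ) 1).setIntegral_preimage_emb
      (measurableEmbedding_addLeft 1) (fun t : ℝ => (t : ℂ) ^ a * Complex.exp (-c * t)) (Ioi 1)
    rw [preimage_const_add_Ioi, sub_self] at this
    rw [← this]
    simp
  have e2 : ∫ r in Ioo (0 : ℝ) 1, (1 + -1 * (r : ℂ)) ^ a * Complex.exp (-c * (1 + -1 * r)) * -1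
      = -∫ t in Ioc (0 : ℝ) 1, (t : ℂ) ^ a * Complex.exp (-c * t) := by
    rw [← integral_Ioc_eq_integral_Ioo, ← intervalIntegral.integral_of_le zero_le_one,
      ← intervalIntegral.integral_of_le zero_le_one]
    have := intervalIntegral.integral_comp_sub_left (a := 0) (b := 1)
      (fun t : ℝ => (t : ℂ) ^ a * Complex.exp (-c * t)) 1
    rw [sub_self, sub_zero] at this
    rw [← this, ← intervalIntegral.integral_neg]
    apply intervalIntegral.integral_congr
    intro r _
    simp [sub_eq_add_neg]
  rw [e0, e1, e2]
  ring

end GenBessel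
end

/-! ### The parameter β and the evaluation of the contour integral as a Bessel polynomial. -/

noncomputable section
namespace GenBessel

/-- The parameter `β = √(1+z²) - z`. -/
def betaVar (z : ℂ) : ℂ := root z - z

lemma root_sq (z : ℂ) : root z ^ 2 = 1 + z ^ 2 := by
  rw [root, ← Complex.cpow_nat_mul]; norm_num

lemma one_add_sq_mem_slitPlane {z : ℂ} (hz : 0 < z.re) : 1 + z ^ 2 ∈ Complex.slitPlane := by
  rw [Complex.mem_slitPlane_iff]
  by_contra h
  push Not at h
  obtain ⟨h1, h2⟩ := h
  have e1 : (1 + z ^ 2).re = 1 + z.re ^ 2 - z.im ^ 2 := by simp [pow_two]; ring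
  have e2 : (1 + z ^ 2).im = 2 * (z.re * z.im) := by simp [pow_two]; ring
  rw [e2] at h2
  have h3 : z.im = 0 := by
    rcases mul_eq_zero.mp (by linarith : z.re * z.im = 0) with h | h
    · exact absurd h hz.ne'
    · exact h
  rw [e1, h3] at h1
  nlinarith [sq_nonneg z.re]

lemma root_re_pos {z : ℂ} (hz : 0 < z.re) : 0 < (root z).re :=
  cpow_half_re_pos (one_add_sq_mem_slitPlane hz)

lemma betaVar_mul (z : ℂ) : betaVar z * (root z + z) = 1 := by
  rw [betaVar]; linear_combination root_sq z

lemma betaVar_ne_zero (z : ℂ) : betaVar z ≠ 0 := left_ne_zero_of_mul_eq_one (betaVar_mul z)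

lemma eq_of_betaVar (z : ℂ) : z = (1 - betaVar z ^ 2) / (2 * betaVar z) := by
  have h := betaVar_ne_zero z
  have := betaVar_mul z
  rw [eq_div_iff (by simpa using h)]
  have e : root z = betaVar z + z := by rw [betaVar]; ring
  rw [e] at this
  linear_combination this

lemma root_eq_of_betaVar (z : ℂ) : root z = (1 + betaVar z ^ 2) / (2 * betaVar z) := by
  have h := betaVar_ne_zero z
  have e : root z = betaVar z + z := by rw [betaVar]; ring
  rw [e]
  nth_rewrite 2 [eq_of_betaVar z]
  field_simp
  ring

lemma betaVar_re_pos {z : ℂ} (hz : 0 < z.re) : 0 < (betaVar z).re := by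
  have h : betaVar z = (root z + z)⁻¹ := eq_inv_of_mul_eq_one_left (betaVar_mul z)
  rw [h, Complex.inv_re]
  have hr := root_re_pos hz
  have h1 : 0 < (root z + z).re := by rw [Complex.add_re]; linarith
  have h2 : root z + z ≠ 0 := fun h => by simp [h] at h1
  have := Complex.normSq_pos.mpr h2
  positivity

/-- This is 2βz = 1 - β² multiplied by conj β. Its real and imaginary parts are 2|β|² Re z = Re β
(1-|β|²) and 2|β|² Im z = -Im β (1+|β|²), which control the position of β. -/
lemma two_mul_normSq_mul (z : ℂ) : (2 * Complex.normSq (betaVar z) : ℝ) * z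
    = (starRingEnd ℂ) (betaVar z) - betaVar z * Complex.normSq (betaVar z) := by
  have h := betaVar_ne_zero z
  have h1 := Complex.mul_conj (betaVar z)
  have h2 := eq_of_betaVar z
  rw [eq_div_iff (by simpa using h)] at h2
  push_cast
  rw [← h1]
  linear_combination (starRingEnd ℂ) (betaVar z) * h2

lemma betaVar_norm_lt {z : ℂ} (hz : 0 < z.re) : ‖betaVar z‖ < 1 := by
  have h1 := congrArg Complex.re (two_mul_normSq_mul z)
  rw [Complex.re_ofReal_mul, Complex.sub_re, Complex.conj_re, Complex.re_mul_ofReal] at h1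
  have h2 := betaVar_re_pos hz
  have h3 := Complex.normSq_pos.mpr (betaVar_ne_zero z)
  have h4 : Complex.normSq (betaVar z) < 1 := by
    by_contra h
    have : 0 < 2 * Complex.normSq (betaVar z) * z.re := by positivity
    nlinarith
  rw [Complex.normSq_eq_norm_sq] at h4
  nlinarith [norm_nonneg (betaVar z)]

/-- From the two component identities, |Im β|(1+|β|²) ≤ T Re β (1-|β|²). Thus β obeys the same slope
bound as z, with the same T. -/
lemma admissible_betaVar {T : ℝ} {z : ℂ} (hz : 0 < z.re) (hT : |z.im| ≤ T * z.re) :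
    Admissible T (betaVar z) := by
  have hre := betaVar_re_pos hz
  refine ⟨(betaVar_norm_lt hz).le, hre.le, ?_⟩
  have h := two_mul_normSq_mul z
  have h1 := congrArg Complex.re h
  have h2 := congrArg Complex.im h
  rw [Complex.re_ofReal_mul, Complex.sub_re, Complex.conj_re, Complex.re_mul_ofReal] at h1
  rw [Complex.im_ofReal_mul, Complex.sub_im, Complex.conj_im, Complex.im_mul_ofReal] at h2
  set s := Complex.normSq (betaVar z)
  have hs : 0 < s := Complex.normSq_pos.mpr (betaVar_ne_zero z)
  have hT0 : 0 ≤ T := by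
    by_contra hneg
    nlinarith [abs_nonneg z.im]
  have h3 : |(betaVar z).im| * (1 + s) = 2 * s * |z.im| := by
    have h4 : |(betaVar z).im * (1 + s)| = |2 * s * z.im| := by
      rw [h2, ← abs_neg]; congr 1; ring
    rwa [abs_mul, abs_mul, abs_of_pos (by positivity : 0 < 1 + s),
      abs_of_pos (by positivity : 0 < 2 * s)] at h4
  nlinarith [mul_le_mul_of_nonneg_left hT (by positivity : 0 ≤ 2 * s),
    mul_nonneg hT0 (mul_nonneg hs.le hre.le), abs_nonneg (betaVar z).im]

lemma exp_mul_log {u : ℂ} (hu : u ≠ 0) (s : ℂ) : Complex.exp (s * Complex.log u) = u ^ s := by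
  rw [Complex.cpow_def_of_ne_zero hu, mul_comm]

/-- At ν = n+1/2 the half powers of the amplitude merge with the exponential: the exponents become
n+μ for 1+v and the integer n for 1+βv. Writing 1+βv = β(1+v) + (1-β), the binomial theorem leaves
only Gamma integrands. -/
lemma contourIntegrand_eq {μ β v : ℂ} (n : ℕ) (h1 : 1 + v ∈ Complex.slitPlane)
    (h2 : 1 + β * v ∈ Complex.slitPlane) :
    contourIntegrand μ β (n + 1 / 2) v =
      ∑ k ∈ Finset.range (n + 1), (Complex.exp ((n + 1 / 2) * (1 + β))
        * (β ^ k * (1 - β) ^ (n - k) * n.choose k)) *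
        ((1 + v) ^ (n + μ + k : ℂ) * Complex.exp (-((n + 1 / 2) * (1 + β)) * (1 + v))) := by
  have h10 := Complex.slitPlane_ne_zero h1
  have h20 := Complex.slitPlane_ne_zero h2
  have e1 : contourIntegrand μ β (n + 1 / 2) v =
      (1 + v) ^ (n + μ : ℂ) * (1 + β * v) ^ n * Complex.exp (-((n + 1 / 2) * (1 + β)) * v) := by
    rw [← Complex.cpow_natCast, contourIntegrand, centredAmp, centredPhase, gammaPhase, gammaPhase,
      ← exp_mul_log h10, ← exp_mul_log h20, ← exp_mul_log h10, ← exp_mul_log h20, ← Complex.exp_add,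
      ← Complex.exp_add, ← Complex.exp_add, ← Complex.exp_add]
    congr 1; push_cast; ring
  have e2 : (1 + β * v) ^ n = ∑ k ∈ Finset.range (n + 1),
      (β * (1 + v)) ^ k * (1 - β) ^ (n - k) * n.choose k := by
    rw [← add_pow]; congr 1; ring
  have e3 : Complex.exp (-((n + 1 / 2) * (1 + β)) * v) = Complex.exp ((n + 1 / 2) * (1 + β)) *
      Complex.exp (-((n + 1 / 2) * (1 + β)) * (1 + v)) := by
    rw [← Complex.exp_add]; ring_nf
  rw [e1, e2, e3, Finset.mul_sum, Finset.sum_mul]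
  apply Finset.sum_congr rfl
  intro k _
  rw [Complex.cpow_add (n + μ : ℂ) (k : ℂ) h10, Complex.cpow_natCast, mul_pow]
  ring

open MeasureTheory Set

lemma integrableOn_left_cpow_mul_exp {a c : ℂ} (ha : -1 < a.re) (hc : 0 < c.re) :
    IntegrableOn (fun r : ℝ => (1 + -1 * (r : ℂ)) ^ a * Complex.exp (-c * (1 + -1 * r))) (Ioo 0 1) := by
  have h1 : IntervalIntegrable (fun t : ℝ => (t : ℂ) ^ a * Complex.exp (-c * t)) volume 0 1 := by
    rw [intervalIntegrable_iff_integrableOn_Ioc_of_le zero_le_one]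
    exact (integrableOn_cpow_mul_exp ha hc).mono_set Ioc_subset_Ioi_self
  have h2 := (h1.comp_sub_left 1).symm
  rw [sub_self, sub_zero, intervalIntegrable_iff_integrableOn_Ioc_of_le zero_le_one] at h2
  refine (h2.mono_set Ioo_subset_Ioc_self).congr_fun (fun r _ => ?_) measurableSet_Ioo
  simp [sub_eq_add_neg]

lemma IsDescentDir.slit {T : ℝ} {β ρ : ℂ} (h : IsDescentDir T β ρ) {r : ℝ} (hr : 0 < r) :
    1 + ρ * r ∈ Complex.slitPlane ∧ 1 + β * (ρ * r) ∈ Complex.slitPlane := by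
  have h1 := one_add_mul_re_pos h.re_pos.le hr.le
  have h2 : 1 ≤ (1 + β * ρ * r).re := by
    apply one_add_mul_re_pos _ hr.le
    rw [h.mul_eq, Complex.re_ofReal_mul, Complex.conj_re]
    have := h.re_pos
    positivity
  rw [mul_assoc] at h2
  exact ⟨Or.inl (by linarith), Or.inl (by linarith)⟩

lemma slit_left {β : ℂ} (hβ : ‖β‖ ≤ 1) {r : ℝ} (hr : r ∈ Ioo (0 : ℝ) 1) :
    1 + -1 * (r : ℂ) ∈ Complex.slitPlane ∧ 1 + β * (-1 * (r : ℂ)) ∈ Complex.slitPlane := by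
  have h1 : ‖-1 * (r : ℂ)‖ < 1 := by
    rw [norm_mul, norm_neg, norm_one, one_mul, Complex.norm_real, Real.norm_of_nonneg hr.1.le]
    exact hr.2
  exact ⟨one_add_mem_slitPlane h1,
    one_add_mem_slitPlane ((norm_mul_le_of_norm_le_one hβ).trans_lt h1)⟩

/-- Since (1+β)ρ = ρ + |β| conj ρ, its real part is positive. Hence the Gamma integrals of rate
ν(1+β) converge on the descent ray and may be rotated to the real one. -/
lemma IsDescentDir.rate_pos {T : ℝ} {β ρ : ℂ} (h : IsDescentDir T β ρ) (hβ : 0 ≤ β.re) {ν : ℝ}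
    (hν : 0 < ν) : 0 < ((ν : ℂ) * (1 + β)).re ∧ 0 < ((ν : ℂ) * (1 + β) * ρ).re := by
  have := h.re_pos
  constructor
  · rw [Complex.re_ofReal_mul, Complex.add_re, Complex.one_re]; positivity
  · rw [mul_assoc, add_mul, one_mul, h.mul_eq, Complex.re_ofReal_mul, Complex.add_re,
      Complex.re_ofReal_mul, Complex.conj_re]
    positivity

/-- The contour integral is an elementary multiple of a terminating sum. -/
lemma contourIntegral_mul_eq {T : ℝ} {μ β ρ : ℂ} (hβ : Admissible T β) (hρ : IsDescentDir T β ρ)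
    (hβ1 : β ≠ 1) (n : ℕ) (hn : -1 < (n + μ).re) :
    contourIntegral μ β ρ (n + 1 / 2) * ((n + 1 / 2) * (1 + β)) ^ (n + μ + 1) =
      Complex.exp ((n + 1 / 2) * (1 + β)) * (1 - β) ^ n * Complex.Gamma (n + μ + 1) *
      ∑ k ∈ Finset.range (n + 1), (n.choose k : ℂ) * (ascPochhammer ℂ k).eval (n + μ + 1)
        * (β / ((1 - β) * ((n + 1 / 2) * (1 + β)))) ^ k := by
  set c : ℂ := (n + 1 / 2) * (1 + β) with hc_def
  have hν : (0 : ℝ) < n + 1 / 2 := by positivity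
  have hcast : (((n + 1 / 2 : ℝ) : ℝ) : ℂ) * (1 + β) = c := by rw [hc_def]; push_cast; ring
  obtain ⟨hc, hcρ⟩ := hρ.rate_pos hβ.re_nonneg hν
  rw [hcast] at hc hcρ
  have hc0 : c ≠ 0 := fun h => by simp [h] at hc
  have hak : ∀ k : ℕ, -1 < ((n : ℂ) + μ + k).re := fun k => by
    rw [Complex.add_re, Complex.natCast_re]
    have : (0 : ℝ) ≤ k := k.cast_nonneg
    linarith
  set b : ℕ → ℂ := fun k => Complex.exp c * (β ^ k * (1 - β) ^ (n - k) * n.choose k) with hb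
  have hR : rayIntegral μ β (n + 1 / 2) ρ (Ioi 0) = ∑ k ∈ Finset.range (n + 1), b k *
      ∫ r in Ioi (0 : ℝ), (1 + ρ * r) ^ (n + μ + k : ℂ) * Complex.exp (-c * (1 + ρ * r)) * ρ := by
    rw [rayIntegral]
    simp_rw [← integral_const_mul]
    rw [← integral_finsetSum _ (fun k _ =>
      ((integrableOn_ray_cpow_mul_exp _ hρ.re_pos.le hρ.norm_eq.le hcρ).mul_const ρ).const_mul _)]
    apply setIntegral_congr_fun measurableSet_Ioi
    intro r hr
    obtain ⟨h1, h2⟩ := hρ.slit hr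
    simp only
    rw [contourIntegrand_eq n h1 h2, Finset.sum_mul]
    apply Finset.sum_congr rfl
    intro k _
    rw [hb]; ring
  have hL : rayIntegral μ β (n + 1 / 2) (-1) (Ioo 0 1) = ∑ k ∈ Finset.range (n + 1), b k *
      ∫ r in Ioo (0 : ℝ) 1, (1 + -1 * (r : ℂ)) ^ (n + μ + k : ℂ) * Complex.exp (-c * (1 + -1 * r)) * -1 := by
    rw [rayIntegral]
    simp_rw [← integral_const_mul]
    rw [← integral_finsetSum _ (fun k _ =>
      ((integrableOn_left_cpow_mul_exp (hak k) hc).mul_const (-1)).const_mul _)]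
    apply setIntegral_congr_fun measurableSet_Ioo
    intro r hr
    obtain ⟨h1, h2⟩ := slit_left hβ.norm_le hr
    simp only
    rw [contourIntegrand_eq n h1 h2, Finset.sum_mul]
    apply Finset.sum_congr rfl
    intro k _
    rw [hb]; ring
  rw [contourIntegral, hR, hL, ← Finset.sum_sub_distrib, Finset.sum_mul, Finset.mul_sum]
  apply Finset.sum_congr rfl
  intro k hk
  have hg := gamma_contour (hak k) hc hρ.re_pos.le hρ.norm_eq.le hcρ
  -- The k-th term is Γ(n+μ+1+k); its quotient by Γ(n+μ+1) is the rising factorial of the Bessel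
  -- polynomial.
  have hG := Complex.Gamma_add_nat_div_Gamma_eq (n := k) (n + μ + 1) (fun m hm => by
    have h := congrArg Complex.re hm
    rw [Complex.add_re, Complex.one_re, Complex.neg_re, Complex.natCast_re] at h
    have : (0 : ℝ) ≤ m := m.cast_nonneg
    linarith)
  have hG0 : Complex.Gamma (n + μ + 1) ≠ 0 := Complex.Gamma_ne_zero_of_re_pos (by
    rw [Complex.add_re, Complex.one_re]; linarith)
  rw [div_eq_iff hG0] at hG
  rw [show (n + μ + k + 1 : ℂ) = n + μ + 1 + k by ring, hG, Complex.cpow_add _ _ hc0,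
    Complex.cpow_natCast] at hg
  have hβ1' : 1 - β ≠ 0 := sub_ne_zero.mpr hβ1.symm
  have hpow : (1 - β) ^ n = (1 - β) ^ (n - k) * (1 - β) ^ k := by
    rw [← pow_add, Nat.sub_add_cancel (Nat.lt_succ_iff.mp (Finset.mem_range.mp hk))]
  rw [← mul_sub, hpow, div_pow, mul_pow, hb]
  clear_value c
  generalize ((∫ r in Ioi (0 : ℝ), (1 + ρ * r) ^ (n + μ + k : ℂ) * Complex.exp (-c * (1 + ρ * r)) * ρ) -
    ∫ r in Ioo (0 : ℝ) 1, (1 + -1 * (r : ℂ)) ^ (n + μ + k : ℂ) * Complex.exp (-c * (1 + -1 * r)) * -1)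
    = X at hg ⊢
  clear hR hL hb
  field_simp
  linear_combination hg * (n.choose k) * β ^ k

end GenBessel
end

/-! ### The exact representation by a quotient of contour integrals. -/

noncomputable section
namespace GenBessel

open MeasureTheory Set

/-- At the vertex of the parameter domain the contour integral is a Gamma function. -/
lemma contourIntegral_zero_mul {T : ℝ} {μ ρ : ℂ} (hρ : IsDescentDir T 0 ρ) {ν : ℝ} (hν : 0 < ν)
    (hμ : -1 < (ν + μ - 1 / 2 : ℂ).re) :
    contourIntegral μ 0 ρ ν * (ν : ℂ) ^ (ν + μ + 1 / 2 : ℂ) =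
      Complex.exp ν * Complex.Gamma (ν + μ + 1 / 2) := by
  have hI : ∀ v : ℂ, 1 + v ∈ Complex.slitPlane → contourIntegrand μ 0 ν v =
      Complex.exp ν * ((1 + v) ^ (ν + μ - 1 / 2 : ℂ) * Complex.exp (-ν * (1 + v))) := by
    intro v hv
    have h0 := Complex.slitPlane_ne_zero hv
    rw [contourIntegrand, centredAmp, centredPhase, zero_mul, gammaPhase_zero, gammaPhase,
      add_zero, add_zero, Complex.one_cpow, mul_one, ← exp_mul_log h0, ← exp_mul_log h0,
      ← Complex.exp_add, ← Complex.exp_add, ← Complex.exp_add]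
    congr 1; ring
  have hc : 0 < (ν : ℂ).re := by simpa using hν
  have hcρ : 0 < ((ν : ℂ) * ρ).re := by
    rw [Complex.re_ofReal_mul]; exact mul_pos hν hρ.re_pos
  have hR : rayIntegral μ 0 ν ρ (Ioi 0) = Complex.exp ν *
      ∫ r in Ioi (0 : ℝ), (1 + ρ * r) ^ (ν + μ - 1 / 2 : ℂ) * Complex.exp (-ν * (1 + ρ * r)) * ρ := by
    rw [rayIntegral, ← integral_const_mul]
    apply setIntegral_congr_fun measurableSet_Ioi
    intro r hr
    simp only
    rw [hI _ (hρ.slit hr).1]; ring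
  have hL : rayIntegral μ 0 ν (-1) (Ioo 0 1) = Complex.exp ν *
      ∫ r in Ioo (0 : ℝ) 1,
        (1 + -1 * (r : ℂ)) ^ (ν + μ - 1 / 2 : ℂ) * Complex.exp (-ν * (1 + -1 * r)) * -1 := by
    rw [rayIntegral, ← integral_const_mul]
    apply setIntegral_congr_fun measurableSet_Ioo
    intro r hr
    simp only
    rw [hI _ (slit_left (β := 0) (by simp) hr).1]; ring
  have hg := gamma_contour hμ hc hρ.re_pos.le hρ.norm_eq.le hcρ
  rw [show (ν + μ - 1 / 2 + 1 : ℂ) = ν + μ + 1 / 2 by ring] at hg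
  rw [contourIntegral, hR, hL, ← hg]
  ring

lemma cpow_quarter_re_pos {z : ℂ} (hz : z ∈ Complex.slitPlane) : 0 < (z ^ (1 / 4 : ℂ)).re := by
  rw [Complex.cpow_def_of_ne_zero (Complex.slitPlane_ne_zero hz), Complex.exp_re]
  apply mul_pos (Real.exp_pos _)
  apply Real.cos_pos_of_mem_Ioo
  have : (Complex.log z * (1 / 4)).im = z.arg / 4 := by
    rw [← Complex.log_im]
    simp [Complex.mul_im]; ring
  rw [this]
  have h1 := Complex.neg_pi_lt_arg z
  have h2 := Complex.arg_le_pi z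
  have := Real.pi_pos
  constructor <;> linarith

lemma betaVar_re_lt {z : ℂ} (hz : 0 < z.re) :
    0 < (1 + betaVar z).re ∧ 0 < (1 - betaVar z).re ∧ 0 < (1 - betaVar z ^ 2).re := by
  have h1 := betaVar_norm_lt hz
  have h2 := Complex.abs_re_le_norm (betaVar z)
  have h3 := Complex.abs_re_le_norm (betaVar z ^ 2)
  rw [norm_pow] at h3
  have h4 : ‖betaVar z‖ ^ 2 < 1 := pow_lt_one₀ (norm_nonneg _) h1 two_ne_zero
  have h5 := abs_le.mp h2
  have h6 := abs_le.mp h3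
  simp only [Complex.add_re, Complex.sub_re, Complex.one_re]
  exact ⟨by linarith, by linarith, by linarith⟩

/-- Both sides have the same square because z(1+β²) = (1-β²)√(1+z²). Both have positive real part,
by pairing factors whose squares lie in the right half plane, so both are the principal root of that
square. -/
lemma sqrt_mul_hessRoot {z : ℂ} (hz : 0 < z.re) : z ^ (1 / 2 : ℂ) * hessRoot (betaVar z) =
    (1 + betaVar z) ^ (1 / 2 : ℂ) * (1 - betaVar z) ^ (1 / 2 : ℂ) * (1 + z ^ 2) ^ (1 / 4 : ℂ) := by
  obtain ⟨h1, h2, h3⟩ := betaVar_re_lt hz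
  have hT : 0 ≤ |z.im| / z.re := by positivity
  have hadm : Admissible (|z.im| / z.re) (betaVar z) :=
    admissible_betaVar hz (by rw [div_mul_cancel₀ _ hz.ne'])
  have sq : ∀ w : ℂ, (w ^ (1 / 2 : ℂ)) ^ 2 = w := fun w => by
    rw [← Complex.cpow_nat_mul]; norm_num
  have sq4 : ((1 + z ^ 2) ^ (1 / 4 : ℂ)) ^ 2 = root z := by
    rw [← Complex.cpow_nat_mul, root]; norm_num
  have hs := one_add_sq_mem_slitPlane hz
  have e1 : 0 < (z ^ (1 / 2 : ℂ) * hessRoot (betaVar z)).re := by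
    apply re_mul_pos_of_sq (cpow_half_re_pos (Or.inl hz)) (hadm.hessRoot_re_pos hT)
    · rwa [sq]
    · rw [hessRoot_sq]; linarith [hadm.one_add_sq_re hT, decayRate_pos hT]
  have e2 : 0 < ((1 + betaVar z) ^ (1 / 2 : ℂ) * (1 - betaVar z) ^ (1 / 2 : ℂ)).re := by
    apply re_mul_pos_of_sq (cpow_half_re_pos (Or.inl h1)) (cpow_half_re_pos (Or.inl h2))
    · rwa [sq]
    · rwa [sq]
  have e3 : 0 < ((1 + betaVar z) ^ (1 / 2 : ℂ) * (1 - betaVar z) ^ (1 / 2 : ℂ)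
      * (1 + z ^ 2) ^ (1 / 4 : ℂ)).re := by
    apply re_mul_pos_of_sq e2 (cpow_quarter_re_pos hs)
    · rw [mul_pow, sq, sq]; convert! h3 using 2; ring
    · rw [sq4]; exact root_re_pos hz
  rw [← cpow_half_of_sq_eq e1 rfl, ← cpow_half_of_sq_eq e3 rfl, mul_pow, mul_pow, mul_pow, sq, sq,
    sq, sq4, hessRoot_sq, root_eq_of_betaVar]
  congr 1
  nth_rewrite 1 [eq_of_betaVar z]
  ring

/-- The quotient equals (1-β)/(1+β). The arguments of numerator and denominator lie in (-π/2, π/2),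
so no multiple of 2πi arises. -/
lemma log_quot {z : ℂ} (hz : 0 < z.re) : Complex.log (z / (1 + root z)) =
    Complex.log (1 - betaVar z) - Complex.log (1 + betaVar z) := by
  obtain ⟨h1, h2, -⟩ := betaVar_re_lt hz
  have hb := betaVar_ne_zero z
  have n1 : 1 + betaVar z ≠ 0 := fun h => by simp [h] at h1
  have n2 : 1 - betaVar z ≠ 0 := fun h => by simp [h] at h2
  have e : z / (1 + root z) = (1 - betaVar z) / (1 + betaVar z) := by
    have n3 : 1 + root z ≠ 0 := fun h => by
      have h4 := congrArg Complex.re h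
      rw [Complex.add_re, Complex.one_re, Complex.zero_re] at h4
      linarith [root_re_pos hz]
    rw [div_eq_div_iff n3 n1, root_eq_of_betaVar]
    nth_rewrite 1 [eq_of_betaVar z]
    field_simp
    ring
  have a1 := abs_lt.mp (Complex.abs_arg_lt_pi_div_two_iff.mpr (Or.inl h1))
  have a2 := abs_lt.mp (Complex.abs_arg_lt_pi_div_two_iff.mpr (Or.inl h2))
  have a3 : (1 + betaVar z).arg ≠ Real.pi := by
    have := Real.pi_pos
    intro h; linarith
  rw [e, div_eq_mul_inv, Complex.log_mul n2 (inv_ne_zero n1), Complex.log_inv _ a3, ← sub_eq_add_neg]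
  rw [Complex.arg_inv, if_neg a3]
  constructor <;> linarith

/-- The ratio of the contour integrals represents the Bessel polynomial exactly. -/
lemma besselPoly_mul_contourIntegral {T : ℝ} {μ z ρ ρ₀ : ℂ} (hz : 0 < z.re)
    (hβ : Admissible T (betaVar z)) (hρ : IsDescentDir T (betaVar z) ρ)
    (hρ₀ : IsDescentDir T 0 ρ₀) (n : ℕ) (hn : -1 < (n + μ).re) {ν : ℝ} (hν : ν = n + 1 / 2) :
    besselPoly n μ (1 / (ν * z)) * contourIntegral μ 0 ρ₀ ν =
      frontFactor μ z ν * (hessRoot (betaVar z) * contourIntegral μ (betaVar z) ρ ν) := by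
  obtain ⟨h1, h2, -⟩ := betaVar_re_lt hz
  have hb := betaVar_ne_zero z
  have n1 : 1 + betaVar z ≠ 0 := fun h => by simp [h] at h1
  have n2 : 1 - betaVar z ≠ 0 := fun h => by simp [h] at h2
  have hz0 : z ≠ 0 := fun h => by simp [h] at hz
  have hν0 : 0 < ν := by rw [hν]; positivity
  have hνc : (ν : ℂ) = n + 1 / 2 := by rw [hν]; push_cast; ring
  have hνc0 : (ν : ℂ) ≠ 0 := by exact_mod_cast hν0.ne'
  have hJ := contourIntegral_mul_eq hβ hρ (fun h => n2 (by rw [h, sub_self])) n hn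
  rw [← hν, ← hνc] at hJ
  have hJ0 := contourIntegral_zero_mul (μ := μ) hρ₀ hν0
    (by rw [hνc]; convert! hn using 2; ring)
  have hs : (ν + μ + 1 / 2 : ℂ) = n + μ + 1 := by rw [hνc]; ring
  rw [hs] at hJ0
  have hY : ∑ k ∈ Finset.range (n + 1), (n.choose k : ℂ) * (ascPochhammer ℂ k).eval (n + μ + 1)
        * (betaVar z / ((1 - betaVar z) * (ν * (1 + betaVar z)))) ^ k
      = besselPoly n μ (1 / (ν * z)) := by
    rw [besselPoly]
    apply Finset.sum_congr rfl
    intro k _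
    congr 2
    conv_rhs => rw [eq_of_betaVar z]
    have n3 : 1 - betaVar z ^ 2 ≠ 0 := by
      rw [show 1 - betaVar z ^ 2 = (1 - betaVar z) * (1 + betaVar z) by ring]
      exact mul_ne_zero n2 n1
    field_simp
    ring
  rw [hY] at hJ
  set Y := besselPoly n μ (1 / (ν * z))
  set J := contourIntegral μ (betaVar z) ρ ν
  set J₀ := contourIntegral μ 0 ρ₀ ν
  set β := betaVar z with hβ_def
  have hsplit : ((ν : ℂ) * (1 + β)) ^ (n + μ + 1 : ℂ) =
      (ν : ℂ) ^ (n + μ + 1 : ℂ) * (1 + β) ^ (n + μ + 1 : ℂ) := by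
    rw [← exp_mul_log (mul_ne_zero hνc0 n1), Complex.log_ofReal_mul hν0 n1, mul_add, Complex.exp_add,
      exp_mul_log n1, Complex.ofReal_log hν0.le, exp_mul_log hνc0]
  have hν1 : (ν : ℂ) ^ (n + μ + 1 : ℂ) ≠ 0 := by simp [Complex.cpow_eq_zero_iff, hνc0]
  -- Dividing the two evaluations eliminates Γ(n+μ+1) and the powers of ν; what remains is
  -- elementary in β and is matched with the front factor next.
  have hkey : J * (1 + β) ^ (n + μ + 1 : ℂ) =
      J₀ * Y * (Complex.exp (ν * β) * (1 - β) ^ n) := by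
    apply mul_left_cancel₀ hν1
    have e : Complex.exp (ν * (1 + β)) = Complex.exp ν * Complex.exp (ν * β) := by
      rw [← Complex.exp_add]; ring_nf
    rw [hsplit, e] at hJ
    linear_combination hJ - Complex.exp (ν * β) * (1 - β) ^ n * Y * hJ0
  have hq : (1 + z ^ 2) ^ (1 / 4 : ℂ) ≠ 0 := by
    have := cpow_quarter_re_pos (one_add_sq_mem_slitPlane hz)
    intro h; rw [h] at this; simp at this
  have hfront : frontFactor μ z ν * hessRoot β * (Complex.exp (ν * β) * (1 - β) ^ n)
      = (1 + β) ^ (n + μ + 1 : ℂ) := by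
    have e1 : 1 - z + root z = 1 + β := by rw [hβ_def, betaVar]; ring
    have e2 : (ν : ℂ) * z - ν * etaVar z = -(ν * β) - ν * Complex.log (1 - β)
        + ν * Complex.log (1 + β) := by
      rw [etaVar, log_quot hz, ← hβ_def]
      rw [hβ_def, betaVar]; ring
    have e3 : (1 - β) ^ n = Complex.exp (n * Complex.log (1 - β)) := by
      rw [exp_mul_log n2, Complex.cpow_natCast]
    have e4 := sqrt_mul_hessRoot hz
    rw [← hβ_def] at e4
    have e5 : frontFactor μ z ν * hessRoot β = (1 + β) ^ μ * ((1 + β) ^ (1 / 2 : ℂ)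
        * (1 - β) ^ (1 / 2 : ℂ)) * Complex.exp (ν * z - ν * etaVar z) := by
      rw [frontFactor, e1, div_mul_eq_mul_div, div_mul_eq_mul_div, div_eq_iff hq]
      linear_combination (1 + β) ^ μ * Complex.exp (ν * z - ν * etaVar z) * e4
    rw [e5, e2, e3, ← exp_mul_log n1, ← exp_mul_log n1, ← exp_mul_log n1, ← exp_mul_log n2,
      ← Complex.exp_add, ← Complex.exp_add, ← Complex.exp_add, ← Complex.exp_add, ← Complex.exp_add,
      hνc]
    congr 1; ring
  have hE : Complex.exp (ν * β) * (1 - β) ^ n ≠ 0 :=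
    mul_ne_zero (Complex.exp_ne_zero _) (pow_ne_zero _ n2)
  apply mul_right_cancel₀ hE
  linear_combination -hkey - J * hfront

end GenBessel
end

/-! ### The saddle map and the identification of its Taylor coefficients. -/

noncomputable section
namespace GenBessel

/-- A remainder w^N k(w) with k analytic has vanishing derivatives of order below N at 0, so
coefficients of a finite expansion are Taylor coefficients. -/
lemma iteratedDeriv_div_factorial_eq {f k : ℂ → ℂ} {c : ℕ → ℂ} {N j : ℕ} (hk : AnalyticAt ℂ k 0)
    (h : ∀ᶠ w in 𝓝 (0 : ℂ), f w = ∑ i ∈ Finset.range N, c i * w ^ i + w ^ N * k w) (hj : j < N) :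
    iteratedDeriv j f 0 / j.factorial = c j := by
  have hr : AnalyticAt ℂ (fun w => w ^ N * k w) 0 := by fun_prop
  have hp : ∀ i : ℕ, ContDiffAt ℂ j (fun w : ℂ => c i * w ^ i) 0 := fun i => by fun_prop
  have h0 : iteratedDeriv j (fun w => w ^ N * k w) 0 = 0 := by
    refine (natCast_le_analyticOrderAt_iff_iteratedDeriv_eq_zero hr).mp ?_ j hj
    exact (natCast_le_analyticOrderAt hr).mpr ⟨k, hk, Eventually.of_forall fun w => by simp⟩
  have h1 : iteratedDeriv j (fun w => ∑ i ∈ Finset.range N, c i * w ^ i) 0 = c j * j.factorial := by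
    rw [iteratedDeriv_fun_sum fun i _ => hp i, Finset.sum_eq_single_of_mem j (Finset.mem_range.mpr hj)]
    · rw [iteratedDeriv_const_mul_field, iteratedDeriv_fun_pow_zero, if_pos rfl]
    · intro i _ hi
      rw [iteratedDeriv_const_mul_field, iteratedDeriv_fun_pow_zero, if_neg hi.symm, Nat.cast_zero, mul_zero]
  have h2 := EventuallyEq.iteratedDeriv_eq (g := (fun w => ∑ i ∈ Finset.range N, c i * w ^ i)
    + fun w => w ^ N * k w) j h
  have hs : ContDiffAt ℂ j (fun w => ∑ i ∈ Finset.range N, c i * w ^ i) 0 := by fun_prop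
  rw [h2, iteratedDeriv_add hs hr.contDiffAt, h0, h1, add_zero, mul_div_assoc, div_self, mul_one]
  exact_mod_cast j.factorial_ne_zero

lemma analyticAt_dslope {f : ℂ → ℂ} {x : ℂ} (hf : AnalyticAt ℂ f x) : AnalyticAt ℂ (dslope f x) x := by
  obtain ⟨U, hU, hfU⟩ := hf.exists_mem_nhds_analyticOnNhd
  exact ((Complex.differentiableOn_dslope hU).mpr hfU.differentiableOn).analyticAt hU

lemma analyticAt_localCoord {T : ℝ} (hT : 0 ≤ T) {β : ℂ} (hβ : Admissible T β) :
    AnalyticAt ℂ (localCoord β) 0 ∧ deriv (localCoord β) 0 = 1 := by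
  obtain ⟨ε, M, hε, -, -, h⟩ := exists_localBounds hT 0
  have hd : DifferentiableOn ℂ (localCoord β) (Metric.ball 0 ε) := fun v hv =>
    ((h β hβ).hasDerivAt v hv).differentiableAt.differentiableWithinAt
  exact ⟨hd.analyticAt (Metric.ball_mem_nhds 0 hε), (h β hβ).deriv_zero⟩

/-- The analytic inverse of the local coordinate. -/
lemma exists_localCoord_inverse {T : ℝ} (hT : 0 ≤ T) {β : ℂ} (hβ : Admissible T β) :
    ∃ V : ℂ → ℂ, AnalyticAt ℂ V 0 ∧ V 0 = 0 ∧ deriv V 0 = 1 ∧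
      ∀ᶠ y in 𝓝 (0 : ℂ), localCoord β (V y) = y := by
  obtain ⟨ha, hd⟩ := analyticAt_localCoord hT hβ
  have hd0 : deriv (localCoord β) 0 ≠ 0 := by rw [hd]; exact one_ne_zero
  have h0 : localCoord β 0 = 0 := by rw [localCoord, zero_mul]
  refine ⟨ha.hasStrictDerivAt.localInverse _ _ _ hd0, ?_, ?_, ?_, ?_⟩
  · have := ha.analyticAt_localInverse hd0
    rwa [h0] at this
  · have : ha.hasStrictDerivAt.localInverse _ _ _ hd0 (localCoord β 0) = 0 :=
      HasStrictFDerivAt.localInverse_apply_image ..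
    rwa [h0] at this
  · have := ha.hasStrictDerivAt.to_localInverse hd0
    rw [h0] at this
    rw [this.hasDerivAt.deriv, hd, inv_one]
  · have : ∀ᶠ x in 𝓝 (localCoord β 0), localCoord β (ha.hasStrictDerivAt.localInverse _ _ _ hd0 x) = x :=
      HasStrictDerivAt.eventually_right_inverse ..
    rwa [h0] at this

/-- The argument of a is strictly inside (-π, π), so adding the small argument of u causes no jump.
-/
lemma eventually_log_mul {a : ℂ} (ha : a ∈ Complex.slitPlane) :
    ∀ᶠ u in 𝓝 (1 : ℂ), u ≠ 0 ∧ Complex.log (a * u) = Complex.log a + Complex.log u := by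
  have h1 : Tendsto (fun u => a.arg + Complex.arg u) (𝓝 1) (𝓝 (a.arg + 0)) := by
    have := (Complex.continuousAt_arg Complex.one_mem_slitPlane).tendsto
    rw [Complex.arg_one] at this
    exact tendsto_const_nhds.add this
  have h2 := h1.eventually (Ioo_mem_nhds (a := -Real.pi) (b := Real.pi)
    (by linarith [Complex.neg_pi_lt_arg a]) (by
      have := lt_of_le_of_ne (Complex.arg_le_pi a) (Complex.slitPlane_arg_ne_pi ha); linarith))
  filter_upwards [h2, isOpen_ne.mem_nhds (one_ne_zero : (1 : ℂ) ≠ 0)] with u hu hu0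
  exact ⟨hu0, Complex.log_mul (Complex.slitPlane_ne_zero ha) hu0 ⟨hu.1, hu.2.le⟩⟩

lemma mul_cpow_of_log {a u : ℂ} (s : ℂ) (ha : a ≠ 0) (hu : u ≠ 0)
    (h : Complex.log (a * u) = Complex.log a + Complex.log u) : (a * u) ^ s = a ^ s * u ^ s := by
  rw [← exp_mul_log (mul_ne_zero ha hu), h, mul_add, Complex.exp_add, exp_mul_log ha, exp_mul_log hu]

section Saddle

variable {z : ℂ}

lemma one_sub_betaVar_ne {z : ℂ} (hz : 0 < z.re) : 1 - betaVar z ≠ 0 := fun h => by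
  have := (betaVar_re_lt hz).2.1
  simp [h] at this

lemma saddle_eq (hz : 0 < z.re) : saddle z = betaVar z / (1 - betaVar z) := by
  have n1 := one_sub_betaVar_ne hz
  have n3 : z ≠ 0 := fun h => by simp [h] at hz
  rw [saddle, div_eq_div_iff (by simpa using n3) n1]
  have e : root z = betaVar z + z := by rw [betaVar]; ring
  have h := betaVar_mul z
  rw [e] at h ⊢
  linear_combination -h

lemma one_add_saddle (hz : 0 < z.re) : 1 + saddle z = 1 / (1 - betaVar z) := by
  have n1 := one_sub_betaVar_ne hz
  rw [saddle_eq hz]; field_simp; ring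

lemma saddle_ne_zero (hz : 0 < z.re) : saddle z ≠ 0 := by
  rw [saddle_eq hz]; exact div_ne_zero (betaVar_ne_zero z) (one_sub_betaVar_ne hz)

lemma one_add_saddle_mem_slitPlane (hz : 0 < z.re) : 1 + saddle z ∈ Complex.slitPlane := by
  left
  rw [one_add_saddle hz, one_div, Complex.inv_re]
  exact div_pos (betaVar_re_lt hz).2.1 (Complex.normSq_pos.mpr (one_sub_betaVar_ne hz))

/-- If s₊ were real and nonpositive, then 1+s₊ would be real and positive, and s₊ = β(1+s₊) with Re
β > 0 would force Re s₊ > 0. -/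
lemma saddle_mem_slitPlane (hz : 0 < z.re) : saddle z ∈ Complex.slitPlane := by
  have h1 : saddle z = betaVar z * (1 + saddle z) := by
    rw [one_add_saddle hz, saddle_eq hz]; ring
  rw [Complex.mem_slitPlane_iff]
  by_contra h
  push Not at h
  obtain ⟨h2, h3⟩ := h
  have h4 := congrArg Complex.re h1
  rw [Complex.mul_re, Complex.add_re, Complex.add_im, Complex.one_im, h3] at h4
  have h5 : 0 < (1 + saddle z).re := by
    rcases one_add_saddle_mem_slitPlane hz with h | h
    · exact h
    · rw [Complex.add_im, Complex.one_im, h3] at h; simp at h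
  rw [Complex.add_re] at h5
  have := mul_pos (betaVar_re_pos hz) h5
  linarith

/-- The second derivative is s₊⁻² + (1+s₊)⁻², and s₊/(1+s₊) = β. -/
lemma phaseSecond_eq (hz : 0 < z.re) :
    phaseSecond z = (1 + betaVar z ^ 2) / saddle z ^ 2 := by
  have hs1 := saddle_mem_slitPlane hz
  have hs2 := one_add_saddle_mem_slitPlane hz
  have hd : ∀ᶠ s in 𝓝 (saddle z), deriv (phase z) s = 2 * z - s⁻¹ - (1 + s)⁻¹ := by
    have c : ContinuousAt (fun s : ℂ => 1 + s) (saddle z) := by fun_prop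
    filter_upwards [Complex.isOpen_slitPlane.mem_nhds hs1,
      c.eventually_mem (Complex.isOpen_slitPlane.mem_nhds hs2)] with s h1 h2
    have d1 : HasDerivAt (fun s : ℂ => 1 + s) 1 s := (hasDerivAt_id s).const_add 1
    have := (((hasDerivAt_id s).const_mul (2 * z)).sub (Complex.hasDerivAt_log h1)).sub (d1.clog h2)
    refine HasDerivAt.deriv ?_
    convert! this using 1
    simp
  have n1 := Complex.slitPlane_ne_zero hs1
  have n2 := Complex.slitPlane_ne_zero hs2
  rw [phaseSecond, iteratedDeriv_succ, iteratedDeriv_one, EventuallyEq.deriv_eq hd]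
  have d1 : HasDerivAt (fun s : ℂ => 1 + s) 1 (saddle z) := (hasDerivAt_id _).const_add 1
  have := (((hasDerivAt_inv n1).const_sub (2 * z))).sub (d1.inv n2)
  have e : deriv (fun s => 2 * z - s⁻¹ - (1 + s)⁻¹) (saddle z) = _ := this.deriv
  rw [e, one_add_saddle hz, saddle_eq hz]
  have n3 := one_sub_betaVar_ne hz
  have n4 := betaVar_ne_zero z
  field_simp
  ring

/-- Near the saddle the phase is the centred phase in the variable `s / s₊ - 1`. -/
lemma eventually_phase_eq (hz : 0 < z.re) : ∀ᶠ v in 𝓝 (0 : ℂ),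
    phase z (saddle z * (1 + v)) - phase z (saddle z) = centredPhase (betaVar z) v ∧
    ∀ μ, amplitude μ (saddle z * (1 + v)) = amplitude μ (saddle z) * centredAmp μ (betaVar z) v := by
  have c1 : Tendsto (fun v : ℂ => 1 + v) (𝓝 0) (𝓝 1) := Continuous.tendsto' (by fun_prop) _ _ (by simp)
  have c2 : Tendsto (fun v : ℂ => 1 + betaVar z * v) (𝓝 0) (𝓝 1) :=
    Continuous.tendsto' (by fun_prop) _ _ (by simp)
  have hs1 := saddle_mem_slitPlane hz
  have hs2 := one_add_saddle_mem_slitPlane hz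
  have n1 := Complex.slitPlane_ne_zero hs1
  have n2 := Complex.slitPlane_ne_zero hs2
  have hprod : saddle z = betaVar z * (1 + saddle z) := by
    rw [one_add_saddle hz, saddle_eq hz]; ring
  filter_upwards [c1.eventually (eventually_log_mul hs1), c2.eventually (eventually_log_mul hs2)]
    with v h1 h2
  have e : 1 + saddle z * (1 + v) = (1 + saddle z) * (1 + betaVar z * v) := by
    linear_combination v * hprod
  constructor
  · rw [phase, phase, e, h1.2, h2.2, centredPhase, gammaPhase, gammaPhase]
    have hz0 : z ≠ 0 := fun h => by simp [h] at hz
    have h3 : 2 * z * saddle z = 1 + betaVar z := by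
      rw [saddle, betaVar]; field_simp; ring
    linear_combination v * h3
  · intro μ
    have h3 : (1 + v) ^ (μ - 1 / 2) = (1 + v) ^ μ / (1 + v) ^ (1 / 2 : ℂ) := Complex.cpow_sub _ _ h1.1
    have h4 : (1 + betaVar z * v) ^ (-1 / 2 : ℂ) = ((1 + betaVar z * v) ^ (1 / 2 : ℂ))⁻¹ := by
      rw [← Complex.cpow_neg]; norm_num
    rw [amplitude, amplitude, centredAmp, e, mul_cpow_of_log _ n1 h1.1 h1.2,
      mul_cpow_of_log _ n1 h1.1 h1.2, mul_cpow_of_log _ n2 h2.1 h2.2, h3, h4]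
    simp only [div_eq_mul_inv, mul_inv]
    ring

lemma amplitude_saddle_ne_zero (μ : ℂ) (hz : 0 < z.re) : amplitude μ (saddle z) ≠ 0 := by
  have n1 := saddle_ne_zero hz
  have n2 := Complex.slitPlane_ne_zero (one_add_saddle_mem_slitPlane hz)
  simp [amplitude, Complex.cpow_eq_zero_iff, n1, n2]

/-- The saddle map exists, and its Taylor coefficients are those of the local coordinate. -/
lemma exists_saddleMap {T : ℝ} (hT : 0 ≤ T) (hz : 0 < z.re) (hβ : Admissible T (betaVar z)) :
    ∃ s, IsSaddleMap z s ∧ ∀ μ j, taylorCoeff μ s j =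
      amplitude μ (saddle z) / saddle z ^ j * localCoeff μ (betaVar z) j := by
  obtain ⟨V, hVa, hV0, hV1, hV⟩ := exists_localCoord_inverse hT hβ
  have hκ := hβ.one_add_sq_ne hT
  have n1 := saddle_ne_zero hz
  have hy : Tendsto (fun w : ℂ => w / saddle z) (𝓝 0) (𝓝 0) :=
    Continuous.tendsto' (by fun_prop) _ _ (by simp)
  have hVt : Tendsto V (𝓝 0) (𝓝 0) := by
    have := hVa.continuousAt.tendsto
    rwa [hV0] at this
  have hVy : AnalyticAt ℂ (fun w => V (w / saddle z)) 0 :=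
    AnalyticAt.fun_comp (f := fun w => w / saddle z) (by rwa [zero_div]) (by fun_prop)
  have hds : ∀ᶠ w in 𝓝 (0 : ℂ), deriv (fun w => saddle z * (1 + V (w / saddle z))) w
      = deriv V (w / saddle z) := by
    filter_upwards [hy.eventually hVa.eventually_analyticAt] with w hw
    have d1 : HasDerivAt (fun w : ℂ => w / saddle z) (1 / saddle z) w := (hasDerivAt_id w).div_const _
    have d2 := ((hw.differentiableAt.hasDerivAt.comp w d1).const_add 1).const_mul (saddle z)
    have : deriv (fun w => saddle z * (1 + V (w / saddle z))) w = _ := d2.deriv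
    rw [this]
    field_simp
  -- With V the local inverse of the centred coordinate, rescaling by s₊ turns (1+β²)/2 · (w/s₊)²
  -- into ½φ''(s₊)w² and keeps the derivative at 0 equal to 1.
  refine ⟨fun w => saddle z * (1 + V (w / saddle z)), ⟨analyticAt_const.mul (analyticAt_const.add hVy),
    by simp [hV0], ?_, ?_⟩, ?_⟩
  · rw [hds.self_of_nhds, zero_div, hV1]
  · filter_upwards [hy.eventually (hVt.eventually (eventually_phase_eq hz)), hy.eventually hV]
      with w h1 h2
    rw [h1.1, ← localCoord_sq hκ, h2, phaseSecond_eq hz]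
    field_simp
  · intro μ j
    obtain ⟨ε, M, hε, -, -, hloc⟩ := exists_localBounds hT μ
    have hl := hloc _ hβ
    set β := betaVar z
    set N := j + 1 with hN
    set R := remainderFactor (centredAmp μ β) (coordFactor β) (deriv (localCoord β)) N
    have hRa : AnalyticAt ℂ R 0 := (differentiableOn_remainderFactor hε hl.diff_amp hl.diff_factor
      hl.diff_deriv N).analyticAt (Metric.ball_mem_nhds 0 hε)
    have hda := analyticAt_dslope hVa
    have hVd : ∀ y, V y = y * dslope V 0 y := fun y => by
      have := sub_smul_dslope V 0 y
      rw [hV0, sub_zero, sub_zero, smul_eq_mul] at this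
      exact this.symm
    have hinv : ∀ᶠ y in 𝓝 (0 : ℂ), deriv (localCoord β) (V y) * deriv V y = 1 := by
      filter_upwards [hV.eventually_nhds, hVa.eventually_analyticAt,
        hVt.eventually (Metric.ball_mem_nhds (0 : ℂ) hε)] with y h1 h2 h3
      have d1 := (hl.hasDerivAt _ h3).comp y h2.differentiableAt.hasDerivAt
      have d2 : HasDerivAt (localCoord β ∘ V) 1 y := (hasDerivAt_id y).congr_of_eventuallyEq h1
      exact d1.unique d2
    -- Composed with V, the functions w^i w' become y^i after multiplication by V', since
    -- w'(V(y))V'(y) = 1. The expansion in the local coordinate is thus a Taylor expansion in y.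
    have hexp : ∀ᶠ y in 𝓝 (0 : ℂ), centredAmp μ β (V y) * deriv V y =
        ∑ i ∈ Finset.range N, localCoeff μ β i * y ^ i
          + y ^ N * (dslope V 0 y ^ N * R (V y) * deriv V y) := by
      filter_upwards [hinv, hV] with y h1 h2
      rw [eq_sum_add_remainder (h := centredAmp μ β) (coordFactor_zero hκ) hl.deriv_zero N (V y)]
      have h3 : V y * coordFactor β (V y) = y := h2
      rw [h3, add_mul, Finset.sum_mul]
      congr 1
      · apply Finset.sum_congr rfl
        intro i _
        rw [localCoeff]
        linear_combination remainderFactor (centredAmp μ β) (coordFactor β) (deriv (localCoord β)) i 0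
          * y ^ i * h1
      · rw [show V y ^ N = y ^ N * dslope V 0 y ^ N by rw [← mul_pow, ← hVd]]
        ring
    have hk : AnalyticAt ℂ (fun y => dslope V 0 y ^ N * R (V y) * deriv V y) 0 := by
      have : AnalyticAt ℂ (fun y => R (V y)) 0 := AnalyticAt.fun_comp (by rwa [hV0]) hVa
      exact ((hda.pow N).mul this).mul hVa.deriv
    have hkw : AnalyticAt ℂ (fun w => amplitude μ (saddle z) / saddle z ^ N *
        ((fun y => dslope V 0 y ^ N * R (V y) * deriv V y) (w / saddle z))) 0 := by
      apply analyticAt_const.mul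
      exact AnalyticAt.fun_comp (f := fun w => w / saddle z) (by rwa [zero_div]) (by fun_prop)
    rw [taylorCoeff]
    refine iteratedDeriv_div_factorial_eq
      (c := fun j => amplitude μ (saddle z) / saddle z ^ j * localCoeff μ β j) hkw ?_ (Nat.lt_succ_self j)
    filter_upwards [hds, hy.eventually (hVt.eventually (eventually_phase_eq hz)), hy.eventually hexp]
      with w h1 h2 h3
    rw [h1, h2.2, mul_assoc, h3, mul_add, Finset.mul_sum]
    congr 1
    · apply Finset.sum_congr rfl
      intro i _
      rw [div_pow]
      field_simp
    · rw [div_pow, Nat.succ_eq_add_one, ← hN]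
      field_simp

lemma localCoeff_zero (μ β : ℂ) : localCoeff μ β 0 = 1 := by
  simp [localCoeff, remainderFactor, centredAmp]

lemma saddleCoeff_zero (μ β : ℂ) : saddleCoeff μ β 0 = 1 := by
  simp [saddleCoeff, localCoeff_zero]

/-- The amplitude at the saddle cancels in f_{2k}/f_0, and s₊^(2k) cancels against the same power
contained in φ''(s₊)^k. -/
lemma exists_saddleMap_laplaceCoeff (hz : 0 < z.re) :
    ∃ s, IsSaddleMap z s ∧ ∀ μ k, laplaceCoeff μ z s k = saddleCoeff μ (betaVar z) k := by
  have hT : 0 ≤ |z.im| / z.re := by positivity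
  have hβ : Admissible (|z.im| / z.re) (betaVar z) :=
    admissible_betaVar hz (by rw [div_mul_cancel₀ _ hz.ne'])
  obtain ⟨s, hs, h⟩ := exists_saddleMap hT hz hβ
  refine ⟨s, hs, fun μ k => ?_⟩
  have n1 := saddle_ne_zero hz
  have n2 := amplitude_saddle_ne_zero μ hz
  have n3 := hβ.one_add_sq_ne hT
  rw [laplaceCoeff, h, h, localCoeff_zero, phaseSecond_eq hz, saddleCoeff, pow_mul (saddle z),
    div_pow]
  field_simp

end Saddle

end GenBessel
end

/-! ### Division of asymptotic series and the uniform expansion. -/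

noncomputable section
namespace GenBessel

/-- The quotient of the formal series with coefficients `f` by that with coefficients `g`, `g 0 = 1`. -/
def quotCoeff (f g : ℕ → ℂ) (k : ℕ) : ℂ := f k - ∑ j : Fin k, quotCoeff f g j * g (k - j)
termination_by k
decreasing_by exact j.2

lemma quotCoeff_eq (f g : ℕ → ℂ) (k : ℕ) :
    quotCoeff f g k = f k - ∑ j ∈ Finset.range k, quotCoeff f g j * g (k - j) := by
  rw [quotCoeff, ← Fin.sum_univ_eq_sum_range (fun j => quotCoeff f g j * g (k - j))]

lemma sum_mul_quotCoeff {f g : ℕ → ℂ} (hg : g 0 = 1) (x : ℂ) (K : ℕ) :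
    ∑ k ∈ Finset.range K, f k * x ^ k = ∑ j ∈ Finset.range K,
      ∑ i ∈ Finset.range (K - j), quotCoeff f g j * x ^ j * (g i * x ^ i) := by
  rw [← Finset.sum_range_diag_flip K fun j i => quotCoeff f g j * x ^ j * (g i * x ^ i)]
  apply Finset.sum_congr rfl
  intro k _
  have h : f k = ∑ j ∈ Finset.range (k + 1), quotCoeff f g j * g (k - j) := by
    rw [Finset.sum_range_succ, Nat.sub_self, hg, mul_one, quotCoeff_eq f g k]; ring
  rw [h, Finset.sum_mul]
  apply Finset.sum_congr rfl
  intro j hj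
  have : x ^ k = x ^ j * x ^ (k - j) := by
    rw [← pow_add, Nat.add_sub_cancel' (Nat.lt_succ_iff.mp (Finset.mem_range.mp hj))]
  rw [this]; ring

/-- By the Cauchy product, F - G∑A_k x^k is the remainder of F minus the sum of A_j x^j times the
remainder of G of order K-j. No division by G is made, but the expansion of G is needed at every
order up to K. -/
lemma norm_sub_mul_sum_quotCoeff_le {f g : ℕ → ℂ} (hg : g 0 = 1) {F G x : ℂ} {K : ℕ} {C : ℝ} {D : ℕ → ℝ}
    (hF : ‖F - ∑ k ∈ Finset.range K, f k * x ^ k‖ ≤ C * ‖x‖ ^ K)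
    (hG : ∀ m ≤ K, ‖G - ∑ k ∈ Finset.range m, g k * x ^ k‖ ≤ D m * ‖x‖ ^ m) :
    ‖F - G * ∑ k ∈ Finset.range K, quotCoeff f g k * x ^ k‖ ≤
      (C + ∑ j ∈ Finset.range K, ‖quotCoeff f g j‖ * D (K - j)) * ‖x‖ ^ K := by
  have e : F - G * ∑ k ∈ Finset.range K, quotCoeff f g k * x ^ k =
      (F - ∑ k ∈ Finset.range K, f k * x ^ k) - ∑ j ∈ Finset.range K, quotCoeff f g j * x ^ j *
        (G - ∑ i ∈ Finset.range (K - j), g i * x ^ i) := by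
    simp_rw [mul_sub, Finset.sum_sub_distrib, ← Finset.sum_mul]
    rw [sum_mul_quotCoeff (f := f) hg]
    simp_rw [← Finset.mul_sum]
    ring
  rw [e, add_mul, Finset.sum_mul]
  refine (norm_sub_le _ _).trans (add_le_add hF ((norm_sum_le _ _).trans (Finset.sum_le_sum ?_)))
  intro j hj
  rw [norm_mul, norm_mul, norm_pow]
  have h1 := hG (K - j) (Nat.sub_le K j)
  have h2 : ‖x‖ ^ K = ‖x‖ ^ j * ‖x‖ ^ (K - j) := by
    rw [← pow_add, Nat.add_sub_cancel' (Finset.mem_range.mp hj).le]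
  calc _ ≤ ‖quotCoeff f g j‖ * ‖x‖ ^ j * (D (K - j) * ‖x‖ ^ (K - j)) := by gcongr
    _ = _ := by rw [h2]; ring

lemma admissible_zero (T : ℝ) : Admissible T 0 := ⟨by simp, by simp, by simp⟩

lemma exists_norm_quotCoeff_le {T : ℝ} (hT : 0 ≤ T) (μ : ℂ) (k : ℕ) :
    ∃ C : ℝ, ∀ β, Admissible T β → ‖quotCoeff (saddleCoeff μ β) (saddleCoeff μ 0) k‖ ≤ C := by
  induction k using Nat.strong_induction_on with
  | _ k ih =>
    choose! B hB using ih
    obtain ⟨C, hC⟩ := exists_norm_saddleCoeff_le hT μ k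
    refine ⟨C + ∑ j ∈ Finset.range k, B j * ‖saddleCoeff μ 0 (k - j)‖, fun β hβ => ?_⟩
    rw [quotCoeff_eq]
    refine (norm_sub_le _ _).trans (add_le_add (hC β hβ) ((norm_sum_le _ _).trans
      (Finset.sum_le_sum fun j hj => ?_)))
    rw [norm_mul]
    gcongr
    exact hB j (Finset.mem_range.mp hj) β hβ

lemma hessRoot_zero : hessRoot 0 = 1 := by simp [hessRoot]

lemma gammaStar_eq {T : ℝ} {μ ρ : ℂ} (hρ : IsDescentDir T 0 ρ) {ν : ℝ} (hν : 0 < ν)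
    (hμ : -1 < (ν + μ - 1 / 2 : ℂ).re) : gammaStar (μ + 1 / 2) ν =
      contourIntegral μ 0 ρ ν * (Real.sqrt (ν / (2 * Real.pi)) * hessRoot 0) := by
  have h := contourIntegral_zero_mul hρ hν hμ
  have hνc : (ν : ℂ) ≠ 0 := by exact_mod_cast hν.ne'
  have h1 : (ν : ℂ) ^ (1 / 2 : ℂ) = Real.sqrt ν :=
    cpow_half_of_sq_eq (by simpa using hν) (by rw [← Complex.ofReal_pow, Real.sq_sqrt hν.le])
  have h2 : (ν : ℂ) ^ (ν + μ : ℂ) ≠ 0 := by simp [Complex.cpow_eq_zero_iff, hνc]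
  have h3 : (Real.sqrt ν : ℂ) ≠ 0 := by
    rw [← h1]; simp [Complex.cpow_eq_zero_iff, hνc]
  have h4 : (Real.sqrt (2 * Real.pi) : ℂ) ≠ 0 := by
    have : 0 < Real.sqrt (2 * Real.pi) := by positivity
    exact_mod_cast this.ne'
  rw [Complex.cpow_add _ _ hνc, h1] at h
  rw [gammaStar, hessRoot_zero, mul_one, Real.sqrt_div hν.le, Complex.ofReal_div, Complex.exp_neg,
    show (ν + (μ + 1 / 2) - 1 / 2 : ℂ) = ν + μ by ring, ← add_assoc]
  have h5 := Complex.exp_ne_zero (ν : ℂ)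
  generalize Complex.Gamma (ν + μ + 1 / 2) = X at h ⊢
  field_simp
  linear_combination -h

/-- The normalized contour integral at β = 0 is the scaled Gamma function (`gammaStar_eq`), so the
uniform Laplace theorem, taken at the vertex, provides the γ_k. -/
lemma isGammaCoeff_saddleCoeff (μ : ℂ) : IsGammaCoeff (μ + 1 / 2) (saddleCoeff μ 0) := by
  intro K
  obtain ⟨C, N, h⟩ := exists_norm_contourIntegral_sub_le le_rfl μ K
  obtain ⟨ρ, hρ⟩ := (admissible_zero 0).exists_dir le_rfl
  refine IsBigO.of_bound C ?_
  filter_upwards [eventually_ge_atTop N, eventually_gt_atTop 0, eventually_gt_atTop (‖μ‖)] with ν h1 h2 h3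
  have h4 : -1 < (ν + μ - 1 / 2 : ℂ).re := by
    have := (abs_le.mp (Complex.abs_re_le_norm μ)).1
    norm_num; linarith
  rw [gammaStar_eq hρ h2 h4, Real.norm_of_nonneg (by positivity), ← div_eq_mul_inv]
  exact h 0 ρ (admissible_zero 0) hρ ν h1

/-- The coefficients of the expansion of the Bessel polynomials. -/
def expansionCoeff (k : ℕ) (μ z : ℂ) : ℂ :=
  quotCoeff (saddleCoeff μ (betaVar z)) (saddleCoeff μ 0) k

lemma isExpansionCoeff_expansionCoeff (μ : ℂ) {z : ℂ} (hz : 0 < z.re) :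
    IsExpansionCoeff μ z fun k => expansionCoeff k μ z := by
  obtain ⟨s, hs, h⟩ := exists_saddleMap_laplaceCoeff hz
  refine ⟨s, saddleCoeff μ 0, hs, isGammaCoeff_saddleCoeff μ, fun k => ?_⟩
  rw [h]
  exact quotCoeff_eq _ _ k

lemma expansionCoeff_zero (μ z : ℂ) : expansionCoeff 0 μ z = 1 := by
  rw [expansionCoeff, quotCoeff_eq, saddleCoeff_zero]; simp

lemma expansionCoeff_one (μ z : ℂ) :
    expansionCoeff 1 μ z = saddleCoeff μ (betaVar z) 1 - saddleCoeff μ 0 1 := by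
  rw [expansionCoeff, quotCoeff_eq, Finset.sum_range_one, quotCoeff_eq, saddleCoeff_zero]; simp

/-- In the sector cos(ph z) ≥ sin δ, whence |Im z| ≤ |z| ≤ Re z / sin δ. The slope T = 1/sin δ is
not sharp but suffices. -/
lemma re_pos_of_mem_sector {δ : ℝ} (h0 : 0 < δ) (h1 : δ < Real.pi / 2) {z : ℂ} (hz : z ∈ sector δ) :
    0 < z.re ∧ |z.im| ≤ (Real.sin δ)⁻¹ * z.re := by
  obtain ⟨hz0, ha⟩ := hz
  have hs : 0 < Real.sin δ := Real.sin_pos_of_pos_of_lt_pi h0 (by linarith [Real.pi_pos])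
  have hc : Real.sin δ ≤ Real.cos z.arg := by
    rw [← Real.cos_abs z.arg, ← Real.cos_pi_div_two_sub]
    exact Real.cos_le_cos_of_nonneg_of_le_pi (abs_nonneg _) (by linarith [Real.pi_pos]) ha
  have hn : 0 < ‖z‖ := norm_pos_iff.mpr hz0
  have hre : ‖z‖ * Real.cos z.arg = z.re := Complex.norm_mul_cos_arg z
  have h2 : Real.sin δ * ‖z‖ ≤ z.re := by rw [← hre, mul_comm]; gcongr
  refine ⟨lt_of_lt_of_le (by positivity) h2, (Complex.abs_im_le_norm z).trans ?_⟩
  rw [inv_mul_eq_div, le_div_iff₀ hs]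
  linarith

/-- The uniform expansion of the Bessel polynomials. -/
lemma exists_norm_besselPoly_sub_le (μ : ℂ) {T : ℝ} (hT : 0 ≤ T) (K : ℕ) :
    ∃ (C : ℝ) (N : ℕ), ∀ n : ℕ, N ≤ n → ∀ ν : ℝ, ν = (n : ℝ) + 1 / 2 → ∀ z : ℂ, 0 < z.re →
      |z.im| ≤ T * z.re → ‖besselPoly n μ (1 / ((ν : ℂ) * z)) - frontFactor μ z (ν : ℂ)
          * ∑ k ∈ Finset.range K, expansionCoeff k μ z / (ν : ℂ) ^ k‖
        ≤ C / ν ^ K * ‖frontFactor μ z (ν : ℂ)‖ := by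
  choose D N hD using fun m => exists_norm_contourIntegral_sub_le hT μ m
  choose B hB using fun k => exists_norm_quotCoeff_le hT μ k
  obtain ⟨ρ₀, hρ₀⟩ := (admissible_zero T).exists_dir hT
  set D' : ℕ → ℝ := fun m => |D m| with hD'
  -- The factor 2 comes from |G| ≥ 1/2. In the threshold below, the range K+2 covers the orders
  -- 0,…,K and also order 1 when K = 0; ‖μ‖ ensures Re(n+μ) > -1; 2D'(1) ensures |G - 1| ≤ 1/2.
  refine ⟨2 * (D' K + ∑ j ∈ Finset.range K, B j * D' (K - j)),
    ⌈∑ m ∈ Finset.range (K + 2), |N m| + ‖μ‖ + 2 * D' 1⌉₊, fun n hn ν hν z hz hzT => ?_⟩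
  have hn' := Nat.ceil_le.mp hn
  have hS0 : 0 ≤ ∑ m ∈ Finset.range (K + 2), |N m| := Finset.sum_nonneg fun _ _ => abs_nonneg _
  have hD1 : 0 ≤ D' 1 := abs_nonneg _
  have hν0 : 0 < ν := by rw [hν]; positivity
  have hνc : (ν : ℂ) ≠ 0 := by exact_mod_cast hν0.ne'
  have hN : ∀ m < K + 2, N m ≤ ν := fun m hm => by
    have h1 := Finset.single_le_sum (f := fun m => |N m|) (fun _ _ => abs_nonneg _)
      (Finset.mem_range.mpr hm)
    linarith [le_abs_self (N m), norm_nonneg μ]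
  have hβ := admissible_betaVar hz hzT
  obtain ⟨ρ, hρ⟩ := hβ.exists_dir hT
  set β := betaVar z with hβ_def
  set F : ℂ := contourIntegral μ β ρ ν * (Real.sqrt (ν / (2 * Real.pi)) * hessRoot β) with hF
  set G : ℂ := contourIntegral μ 0 ρ₀ ν * (Real.sqrt (ν / (2 * Real.pi)) * hessRoot 0) with hG
  set x : ℂ := (ν : ℂ)⁻¹ with hx
  have hxn : ‖x‖ = ν⁻¹ := by rw [hx, norm_inv, Complex.norm_real, Real.norm_of_nonneg hν0.le]
  have hexp : ∀ γ ω, Admissible T γ → IsDescentDir T γ ω → ∀ m < K + 2,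
      ‖contourIntegral μ γ ω ν * (Real.sqrt (ν / (2 * Real.pi)) * hessRoot γ)
        - ∑ k ∈ Finset.range m, saddleCoeff μ γ k * x ^ k‖ ≤ D' m * ‖x‖ ^ m := by
    intro γ ω hγ hω m hm
    have h1 := hD m γ ω hγ hω ν (hN m hm)
    simp only [div_eq_mul_inv, ← inv_pow] at h1 ⊢
    rw [hxn, hx]
    refine h1.trans ?_
    gcongr
    exact le_abs_self _
  have hmain := norm_sub_mul_sum_quotCoeff_le (saddleCoeff_zero μ 0) (hexp β ρ hβ hρ K (by omega))
    (fun m hm => hexp 0 ρ₀ (admissible_zero T) hρ₀ m (by omega))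
  rw [← hF, ← hG] at hmain
  have hG2 : 1 / 2 ≤ ‖G‖ := by
    have h1 := hexp 0 ρ₀ (admissible_zero T) hρ₀ 1 (by omega)
    rw [← hG, Finset.sum_range_one, saddleCoeff_zero, pow_zero, mul_one, pow_one, hxn,
      ← div_eq_mul_inv] at h1
    have h2 : D' 1 / ν ≤ 1 / 2 := by
      rw [div_le_iff₀ hν0]; linarith [norm_nonneg μ]
    have h3 := norm_sub_norm_le 1 (1 - G)
    rw [sub_sub_cancel, norm_one, norm_sub_rev] at h3
    linarith
  have hG0 : G ≠ 0 := fun h => by rw [h, norm_zero] at hG2; linarith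
  have hid := besselPoly_mul_contourIntegral (μ := μ) hz hβ hρ hρ₀ n (by
    have := (abs_le.mp (Complex.abs_re_le_norm μ)).1
    rw [Complex.add_re, Complex.natCast_re]
    linarith) hν
  rw [← hβ_def] at hid
  have hYG : besselPoly n μ (1 / (ν * z)) * G = frontFactor μ z ν * F := by
    rw [hF, hG, hessRoot_zero]
    linear_combination (Real.sqrt (ν / (2 * Real.pi)) : ℂ) * hid
  have hsum : ∑ k ∈ Finset.range K, expansionCoeff k μ z / (ν : ℂ) ^ k =
      ∑ k ∈ Finset.range K, quotCoeff (saddleCoeff μ β) (saddleCoeff μ 0) k * x ^ k :=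
    Finset.sum_congr rfl fun k _ => by rw [hx, inv_pow, ← div_eq_mul_inv]; rfl
  rw [hsum]
  set A := ∑ k ∈ Finset.range K, quotCoeff (saddleCoeff μ β) (saddleCoeff μ 0) k * x ^ k
  have e : besselPoly n μ (1 / (ν * z)) - frontFactor μ z ν * A =
      frontFactor μ z ν * (F - G * A) / G := by
    rw [eq_div_iff hG0]; linear_combination hYG
  rw [e, norm_div, norm_mul, div_le_iff₀ (by linarith)]
  have hB' : ‖F - G * A‖ ≤ (D' K + ∑ j ∈ Finset.range K, B j * D' (K - j)) * (ν ^ K)⁻¹ := by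
    rw [hxn, inv_pow] at hmain
    refine hmain.trans ?_
    gcongr with j hj
    exact hB j β hβ
  have hB0 := (norm_nonneg _).trans hB'
  set E := (D' K + ∑ j ∈ Finset.range K, B j * D' (K - j))
  calc ‖frontFactor μ z ν‖ * ‖F - G * A‖ ≤ ‖frontFactor μ z ν‖ * (E * (ν ^ K)⁻¹ * (2 * ‖G‖)) := by
        gcongr
        nlinarith
    _ = _ := by rw [div_eq_mul_inv]; ring

end GenBessel
end

/-! ### The coefficient A_1 by second-order expansions. -/

noncomputable section
namespace GenBessel

/-- `f(v) = a + b v + c v² + v³ k(v)` near `0` with `k` analytic. -/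
def HasQuadExpansion (f : ℂ → ℂ) (a b c : ℂ) : Prop :=
  ∃ k : ℂ → ℂ, AnalyticAt ℂ k 0 ∧ ∀ᶠ v in 𝓝 (0 : ℂ), f v = a + b * v + c * v ^ 2 + v ^ 3 * k v

namespace HasQuadExpansion

variable {f g : ℂ → ℂ} {a b c a' b' c' : ℂ}

lemma of_analyticAt (hf : AnalyticAt ℂ f 0) : ∃ b c, HasQuadExpansion f (f 0) b c := by
  have h1 := analyticAt_dslope hf
  have h2 := analyticAt_dslope h1
  have e : ∀ (g : ℂ → ℂ) (v : ℂ), g v = g 0 + v * dslope g 0 v := fun g v => by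
    have := sub_smul_dslope g 0 v
    rw [sub_zero, smul_eq_mul] at this
    rw [this]; ring
  refine ⟨dslope f 0 0, dslope (dslope f 0) 0 0, dslope (dslope (dslope f 0) 0) 0,
    analyticAt_dslope h2, Eventually.of_forall fun v => ?_⟩
  linear_combination e f v + v * e (dslope f 0) v + v ^ 2 * e (dslope (dslope f 0) 0) v

lemma unique (h : HasQuadExpansion f a b c) (h' : HasQuadExpansion f a' b' c') :
    a = a' ∧ b = b' ∧ c = c' := by
  have key : ∀ {a b c : ℂ}, HasQuadExpansion f a b c → a = iteratedDeriv 0 f 0 / (Nat.factorial 0 : ℂ) ∧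
      b = iteratedDeriv 1 f 0 / (Nat.factorial 1 : ℂ) ∧ c = iteratedDeriv 2 f 0 / (Nat.factorial 2 : ℂ) := by
    rintro a b c ⟨k, hk, he⟩
    have he' : ∀ᶠ v in 𝓝 (0 : ℂ), f v = ∑ i ∈ Finset.range 3,
        (fun i => if i = 0 then a else if i = 1 then b else c) i * v ^ i + v ^ 3 * k v := by
      filter_upwards [he] with v hv
      rw [hv]; simp [Finset.sum_range_succ]
    have := fun j (hj : j < 3) => iteratedDeriv_div_factorial_eq hk he' hj
    exact ⟨(this 0 (by norm_num)).symm, (this 1 (by norm_num)).symm, (this 2 (by norm_num)).symm⟩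
  obtain ⟨h1, h2, h3⟩ := key h
  obtain ⟨h1', h2', h3'⟩ := key h'
  exact ⟨h1.trans h1'.symm, h2.trans h2'.symm, h3.trans h3'.symm⟩

lemma congr (h : HasQuadExpansion f a b c) (hfg : ∀ᶠ v in 𝓝 (0 : ℂ), g v = f v) :
    HasQuadExpansion g a b c := by
  obtain ⟨k, hk, he⟩ := h
  exact ⟨k, hk, by filter_upwards [he, hfg] with v h1 h2; rw [h2, h1]⟩

lemma add (hf : HasQuadExpansion f a b c) (hg : HasQuadExpansion g a' b' c') :
    HasQuadExpansion (fun v => f v + g v) (a + a') (b + b') (c + c') := by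
  obtain ⟨k, hk, he⟩ := hf
  obtain ⟨k', hk', he'⟩ := hg
  refine ⟨fun v => k v + k' v, hk.add hk', ?_⟩
  filter_upwards [he, he'] with v h1 h2
  rw [h1, h2]; ring

lemma const_mul (hf : HasQuadExpansion f a b c) (s : ℂ) :
    HasQuadExpansion (fun v => s * f v) (s * a) (s * b) (s * c) := by
  obtain ⟨k, hk, he⟩ := hf
  refine ⟨fun v => s * k v, analyticAt_const.mul hk, ?_⟩
  filter_upwards [he] with v h1
  rw [h1]; ring

lemma mul (hf : HasQuadExpansion f a b c) (hg : HasQuadExpansion g a' b' c') :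
    HasQuadExpansion (fun v => f v * g v) (a * a') (a * b' + b * a') (a * c' + b * b' + c * a') := by
  obtain ⟨k, hk, he⟩ := hf
  obtain ⟨k', hk', he'⟩ := hg
  refine ⟨fun v => (b * c' + c * b' + v * (c * c')) + k v * (a' + b' * v + c' * v ^ 2)
    + k' v * (a + b * v + c * v ^ 2) + v ^ 3 * k v * k' v, by fun_prop, ?_⟩
  filter_upwards [he, he'] with v h1 h2
  rw [h1, h2]; ring

lemma id_mul (hf : HasQuadExpansion f a b c) : HasQuadExpansion (fun v => v * f v) 0 a b := by
  obtain ⟨k, hk, he⟩ := hf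
  refine ⟨fun v => c + v * k v, by fun_prop, ?_⟩
  filter_upwards [he] with v h1
  rw [h1]; ring

lemma comp_const_mul (hf : HasQuadExpansion f a b c) (β : ℂ) :
    HasQuadExpansion (fun v => f (β * v)) a (β * b) (β ^ 2 * c) := by
  obtain ⟨k, hk, he⟩ := hf
  have ht : Tendsto (fun v : ℂ => β * v) (𝓝 0) (𝓝 0) := Continuous.tendsto' (by fun_prop) _ _ (by simp)
  refine ⟨fun v => β ^ 3 * k (β * v), analyticAt_const.mul
    (AnalyticAt.fun_comp (f := fun v => β * v) (by rwa [mul_zero]) (by fun_prop)), ?_⟩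
  filter_upwards [ht.eventually he] with v h1
  rw [h1]; ring

lemma id_mul_deriv (hf : HasQuadExpansion f a b c) :
    HasQuadExpansion (fun v => v * deriv f v) 0 b (2 * c) := by
  obtain ⟨k, hk, he⟩ := hf
  refine ⟨fun v => 3 * k v + v * deriv k v, (analyticAt_const.mul hk).add (analyticAt_id.mul hk.deriv), ?_⟩
  filter_upwards [he.eventually_nhds, hk.eventually_analyticAt] with v h1 h2
  have d1 := h2.differentiableAt.hasDerivAt
  have d2 : HasDerivAt (fun v => a + b * v + c * v ^ 2 + v ^ 3 * k v)
      (b + c * (2 * v) + (3 * v ^ 2 * k v + v ^ 3 * deriv k v)) v := by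
    have := ((((hasDerivAt_id v).const_mul b).const_add a).add ((hasDerivAt_pow 2 v).const_mul c)).add
      ((hasDerivAt_pow 3 v).mul d1)
    convert! this using 1
    simp
  rw [EventuallyEq.deriv_eq h1, d2.deriv]
  ring

lemma one_add : HasQuadExpansion (fun v => 1 + v) 1 1 0 :=
  ⟨0, analyticAt_const, Eventually.of_forall fun v => by simp⟩

/-- Coefficients are compared in (1+v)f' = sf, multiplied by v so that only `id_mul_deriv` is
needed. -/
lemma one_add_cpow (s : ℂ) : HasQuadExpansion (fun v => (1 + v) ^ s) 1 s (s * (s - 1) / 2) := by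
  have hd : ∀ᶠ v in 𝓝 (0 : ℂ), HasDerivAt (fun v => (1 + v) ^ s) (s * (1 + v) ^ (s - 1) * 1) v ∧ 1 + v ≠ 0 := by
    filter_upwards [Metric.ball_mem_nhds (0 : ℂ) one_pos] with v hv
    have hs := one_add_mem_slitPlane (mem_ball_zero_iff.mp hv)
    exact ⟨((hasDerivAt_id v).const_add 1).cpow_const hs, Complex.slitPlane_ne_zero hs⟩
  have ha : AnalyticAt ℂ (fun v : ℂ => (1 + v) ^ s) 0 :=
    AnalyticAt.cpow (by fun_prop) analyticAt_const (by simp)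
  obtain ⟨b, c, h⟩ := of_analyticAt ha
  simp only [add_zero, Complex.one_cpow] at h
  have h1 := one_add.mul h.id_mul_deriv
  have h2 : HasQuadExpansion (fun v => (1 + v) * (v * deriv (fun v => (1 + v) ^ s) v)) _ _ _ :=
    (h.id_mul.const_mul s).congr (by
      filter_upwards [hd] with v hv
      rw [hv.1.deriv, Complex.cpow_sub _ _ hv.2, Complex.cpow_one]
      have := hv.2
      field_simp)
  obtain ⟨-, e1, e2⟩ := h1.unique h2
  have hb : b = s := by linear_combination e1
  have hc : c = s * (s - 1) / 2 := by rw [hb] at e2; linear_combination e2 / 2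
  rwa [hb, hc] at h

/-- Coefficients are compared in 2Q + vQ' = (1+v)⁻¹, giving 3b = -1 and 4c = 1. -/
lemma gammaQuot : HasQuadExpansion gammaQuot (1 / 2) (-1 / 3) (1 / 4) := by
  have ha := analyticAt_gammaQuot (v := 0) (by simp)
  obtain ⟨b, c, h⟩ := of_analyticAt ha
  rw [gammaQuot_zero] at h
  have h1 := (h.const_mul 2).add h.id_mul_deriv
  have h2 : HasQuadExpansion (fun v => 2 * GenBessel.gammaQuot v + v * deriv GenBessel.gammaQuot v) _ _ _ :=
    (one_add_cpow (-1)).congr (by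
      filter_upwards [gammaQuot_deriv_eq, Metric.ball_mem_nhds (0 : ℂ) one_pos] with v hv hb
      have hs := Complex.slitPlane_ne_zero (one_add_mem_slitPlane (mem_ball_zero_iff.mp hb))
      rw [Complex.cpow_neg_one]
      rcases eq_or_ne v 0 with rfl | h0
      · simp [gammaQuot_zero]
      · rw [pow_one] at hv
        exact eq_inv_of_mul_eq_one_right (mul_left_cancel₀ h0 hv))
  obtain ⟨-, e1, e2⟩ := h1.unique h2
  have hb : b = -1 / 3 := by linear_combination e1 / 3
  have hc : c = 1 / 4 := by linear_combination e2 / 4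
  rwa [hb, hc] at h

end HasQuadExpansion

/-- The expansion of the amplitude in w^i w' is multiplied by H = w/v. Then w' enters only through
Hw', which is explicit: differentiating (1+β²)w²/2 = ψ gives (1+β²)Hw' = 1/(1+v) + β²/(1+βv). The
Taylor coefficients of H come from H², and comparing the coefficients of v and v² gives the local
coefficients of orders 1 and 2. -/
lemma localCoeff_two {T : ℝ} (hT : 0 ≤ T) (μ : ℂ) {β : ℂ} (hβ : Admissible T β) :
    localCoeff μ β 2 = (μ - 1 / 2) * (μ - 3 / 2) / 2 + 3 * β ^ 2 / 8 - (μ - 1 / 2) * β / 2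
      + (1 + β ^ 3) / (1 + β ^ 2) * (μ - 1 / 2 - β / 2)
      - 3 / 4 * ((1 + β ^ 4) / (1 + β ^ 2)) + 5 / 6 * ((1 + β ^ 3) / (1 + β ^ 2)) ^ 2 := by
  obtain ⟨ε, M, hε, -, -, hloc⟩ := exists_localBounds hT μ
  have hl := hloc β hβ
  have hκ := hβ.one_add_sq_ne hT
  set κ := 1 + β ^ 2 with hκ_def
  have hball := Metric.ball_mem_nhds (0 : ℂ) hε
  -- the coordinate factor
  obtain ⟨a, b, hH⟩ := HasQuadExpansion.of_analyticAt (hl.diff_factor.analyticAt hball)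
  rw [coordFactor_zero hκ] at hH
  have hS : HasQuadExpansion (fun v => coordFactor β v * coordFactor β v) _ _ _ :=
    ((HasQuadExpansion.gammaQuot.add
      ((HasQuadExpansion.gammaQuot.comp_const_mul β).const_mul (β ^ 2))).const_mul (2 / κ)).congr
      (Eventually.of_forall fun v => by
        rw [← pow_two, coordFactor_sq, phaseQuot]; ring)
  obtain ⟨-, ha, hb⟩ := (hH.mul hH).unique hS
  -- the derivative of the squared coordinate
  have hD : HasQuadExpansion (fun v => coordFactor β v * deriv (localCoord β) v) _ _ _ :=
    (((HasQuadExpansion.one_add_cpow (-1)).add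
      (((HasQuadExpansion.one_add_cpow (-1)).comp_const_mul β).const_mul (β ^ 2))).const_mul (1 / κ)).congr (by
      filter_upwards [hball, Metric.ball_mem_nhds (0 : ℂ) one_pos] with v hv hv1
      have hv1' := mem_ball_zero_iff.mp hv1
      have hs1 := one_add_mem_slitPlane hv1'
      have hs2 := one_add_mem_slitPlane ((norm_mul_le_of_norm_le_one (v := v) hβ.norm_le).trans_lt hv1')
      rw [Complex.cpow_neg_one, Complex.cpow_neg_one]
      rcases eq_or_ne v 0 with rfl | h0
      · rw [coordFactor_zero hκ, hl.deriv_zero]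
        simp only [mul_zero, add_zero, inv_one, mul_one]
        rw [← hκ_def, one_div, inv_mul_cancel₀ hκ]
      have d1 := ((hl.hasDerivAt v hv).pow 2).const_mul (κ / 2)
      have d2 : HasDerivAt (centredPhase β) (v / (1 + v) + β * v / (1 + β * v) * (β * 1)) v :=
        (hasDerivAt_gammaPhase hs1).add
          ((hasDerivAt_gammaPhase hs2).comp v ((hasDerivAt_id v).const_mul β))
      have d3 : (fun v => κ / 2 * (localCoord β ^ 2) v) = centredPhase β :=
        funext fun v => localCoord_sq hκ v
      rw [d3] at d1
      have e := d1.unique d2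
      apply mul_left_cancel₀ h0
      rw [localCoord, show (2 - 1 : ℕ) = 1 from rfl, pow_one, Nat.cast_two, div_eq_mul_inv v,
        div_eq_mul_inv (β * v)] at e
      rw [one_div]
      have hκ1 : κ⁻¹ * κ = 1 := inv_mul_cancel₀ hκ
      clear_value κ
      linear_combination κ⁻¹ * e - v * coordFactor β v * deriv (localCoord β) v * hκ1)
  have hA : HasQuadExpansion (centredAmp μ β) _ _ _ :=
    (HasQuadExpansion.one_add_cpow (μ - 1 / 2)).mul
      ((HasQuadExpansion.one_add_cpow (-1 / 2)).comp_const_mul β)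
  have hR : AnalyticAt ℂ (remainderFactor (centredAmp μ β) (coordFactor β) (deriv (localCoord β)) 3) 0 :=
    (differentiableOn_remainderFactor hε hl.diff_amp hl.diff_factor hl.diff_deriv 3).analyticAt hball
  have hRH : AnalyticAt ℂ (fun v => remainderFactor (centredAmp μ β) (coordFactor β)
      (deriv (localCoord β)) 3 v * coordFactor β v) 0 := hR.mul (hl.diff_factor.analyticAt hball)
  have hrem : HasQuadExpansion (fun v => v ^ 3 * (remainderFactor (centredAmp μ β) (coordFactor β)
      (deriv (localCoord β)) 3 v * coordFactor β v)) 0 0 0 :=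
    ⟨_, hRH, Eventually.of_forall fun v => by ring⟩
  have hexp := (((hD.add ((hH.mul hD).id_mul.const_mul (localCoeff μ β 1))).add
    (((hH.mul (hH.mul hD)).id_mul.id_mul).const_mul (localCoeff μ β 2))).add hrem).congr
    (g := fun v => centredAmp μ β v * coordFactor β v) (Eventually.of_forall fun v => by
      rw [eq_sum_add_remainder (h := centredAmp μ β) (coordFactor_zero hκ) hl.deriv_zero 3 v]
      simp only [Finset.sum_range_succ, Finset.sum_range_zero]
      have h0 := localCoeff_zero μ β
      rw [localCoeff] at h0
      rw [h0, localCoeff, localCoeff]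
      ring)
  obtain ⟨-, e1, e2⟩ := (hA.mul hH).unique hexp
  have hD0 : 1 / κ * (1 + β ^ 2 * 1) = 1 := by rw [mul_one, ← hκ_def, one_div, inv_mul_cancel₀ hκ]
  rw [hD0] at e1 e2
  clear_value κ
  have ha' : a = -(1 + β ^ 3) / (3 * κ) := by linear_combination ha / 2
  have hb' : b = (1 + β ^ 4) / (4 * κ) - a ^ 2 / 2 := by linear_combination hb / 2
  have hf1 : localCoeff μ β 1 = μ - 1 / 2 - β / 2 + a + (1 + β ^ 3) / κ := by
    linear_combination -e1
  rw [hf1] at e2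
  rw [hb', ha'] at e2
  linear_combination -e2

/-- Here A_1 is the first saddle coefficient at β minus its value at 0. With t = 2β/(1+β²) and z =
(1-β²)/(2β) the claim is a rational identity in β. -/
lemma expansionCoeff_one_eq (μ : ℂ) {z : ℂ} (hz : 0 < z.re) : expansionCoeff 1 μ z =
    tVar z * (5 * tVar z ^ 2 - 3) / 24 - μ * tVar z ^ 2 * (z + 1) / 4
      + μ ^ 2 * (tVar z * z - 1) / 4 := by
  have hT : 0 ≤ |z.im| / z.re := by positivity
  have hβ : Admissible (|z.im| / z.re) (betaVar z) :=
    admissible_betaVar hz (by rw [div_mul_cancel₀ _ hz.ne'])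
  have hκ := hβ.one_add_sq_ne hT
  have h0 := betaVar_ne_zero z
  have ht : tVar z = 2 * betaVar z / (1 + betaVar z ^ 2) := by
    rw [tVar, root_eq_of_betaVar, one_div_div]
  have hz' := eq_of_betaVar z
  rw [expansionCoeff_one, saddleCoeff, saddleCoeff, localCoeff_two hT μ hβ,
    localCoeff_two hT μ (admissible_zero _), ascPochhammer_one, Polynomial.eval_X, ht]
  generalize betaVar z = β at hz' hκ h0 ⊢
  rw [hz']
  field_simp
  ring

end GenBessel
end

theorem theorem2 :
    ∃ A : ℕ → ℂ → ℂ → ℂ,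
      (∀ μ z : ℂ, 0 < z.re →
        GenBessel.IsExpansionCoeff μ z (fun k => A k μ z) ∧
        A 0 μ z = 1 ∧
        A 1 μ z = GenBessel.tVar z * (5 * GenBessel.tVar z ^ 2 - 3) / 24
          - μ * GenBessel.tVar z ^ 2 * (z + 1) / 4
          + μ ^ 2 * (GenBessel.tVar z * z - 1) / 4) ∧
      ∀ (μ : ℂ) (δ : ℝ), 0 < δ → δ < Real.pi / 2 → ∀ K : ℕ,
        ∃ (C : ℝ) (N : ℕ), ∀ n : ℕ, N ≤ n → ∀ ν : ℝ, ν = (n : ℝ) + 1 / 2 →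
          ∀ z ∈ GenBessel.sector δ,
            ‖GenBessel.besselPoly n μ (1 / ((ν : ℂ) * z))
                - GenBessel.frontFactor μ z (ν : ℂ)
                  * ∑ k ∈ Finset.range K, A k μ z / (ν : ℂ) ^ k‖
              ≤ C / ν ^ K * ‖GenBessel.frontFactor μ z (ν : ℂ)‖ := by
  refine ⟨GenBessel.expansionCoeff, fun μ z hz => ⟨GenBessel.isExpansionCoeff_expansionCoeff μ hz,
    GenBessel.expansionCoeff_zero μ z, GenBessel.expansionCoeff_one_eq μ hz⟩, fun μ δ h0 h1 K => ?_⟩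
  have hs : 0 < Real.sin δ := Real.sin_pos_of_pos_of_lt_pi h0 (by linarith [Real.pi_pos])
  obtain ⟨C, N, h⟩ := GenBessel.exists_norm_besselPoly_sub_le μ (inv_nonneg.mpr hs.le) K
  refine ⟨C, N, fun n hn ν hν z hz => ?_⟩
  obtain ⟨hre, him⟩ := GenBessel.re_pos_of_mem_sector h0 h1 hz
  exact h n hn ν hν z hre him
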